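/- Let $N\ge 2$ and $\alpha=(\alpha_1,\dots,\alpha_{N+1})\in(0,\infty)^{N+1}$. Let $\Delta=\{x\in[0,1]^N:\ |x|_1:=\sum_{i=1}^N x_i\le 1\}$, and let $\mu=\mu_\alpha^{(N)}$ be the Dirichlet distribution on $\Delta$, with Lebesgue density $$\frac{\Gamma(\alpha_1+\dots+\alpha_{N+1})}{\prod_{i=1}^{N+1}\Gamma(\alpha_i)}\,(1-|x|_1)^{\alpha_{N+1}-1}\prod_{i=1}^N x_i^{\alpha_i-1}.$$ Write $\mu(f)=\int_\Delta f\,d\mu$. Let $(\mathcal E_\alpha,\mathcal D(\mathcal E_\alpha))$ and $(\mathcal E_{FV},\mathcal D(\mathcal E_{FV}))$ be the closures in $L^2(\mu)$ of the forms given for $f,g\in C^1(\Delta)$ by $$\mathcal E_\alpha(f,g)=\int_\Delta\sum_{i=1}^N x_i(1-|x|_1)\,\partial_if\,\partial_ig\;d\mu,\qquad \mathcal E_{FV}(f,g)=\int_\Delta\sum_{i,j=1}^N x_i(\delta_{ij}-x_j)\,\partial_if\,\partial_jg\;d\mu .$$ For $p>0$, say that the Nash inequality with exponent $p$ holds for $\mathcal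 E\in\{\mathcal E_\alpha,\mathcal E_{FV}\}$ if there is a constant $C>0$ with $$\mu(f^2)\le C\,\mathcal E(f,f)^{\frac p{p+1}}\,\mu(|f|)^{\frac 2{p+1}}\qquad\text{for all } f\in\mathcal D(\mathcal E)\text{ with }\mu(f)=0 .$$ 1. The Nash inequality holds for $\mathcal E_\alpha$, and also for $\mathcal E_{FV}$, with exponent $$p_\alpha=\sum_{i=1}^N\max\{1,2\alpha_i\}+\max\{\alpha_{N+1}-1,0\}.$$ 2. If $p>0$ and the Nash inequality with exponent $p$ holds for $\mathcal E_\alpha$, then $$p\ge\max\Big\{\max_{1\le i\le N+1}\ \sum_{1\le j\le N+1,\,j\ne i}\alpha_j,\ \ \alpha_{N+1}+\max_{1\le i\le N}\ \sum_{1\le j\le N,\,j\ne i}\max\{1,\alpha_j\}\Big\}.$$ 3. If $p>0$ and the Nash inequality with exponent $p$ holds for $\mathcal E_{FV}$, then $$p\ge\max\Big\{\sum_{j=1}^N\alpha_j,\ \ \tfrac12\alpha_{N+1}+\tfrac12\max_{1\le i\le N}\ \sum_{1\le j\le N,\,j\ne i}\max\{1,\alpha_j\}\Big\}.$$ Consequently,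 if $\max_{1\le i\le N}\alpha_i\le\frac12$ and $\alpha_{N+1}\ge1$, then $p_\alpha=N+\alpha_{N+1}-1$, and this is the smallest $p>0$ for which the Nash inequality with exponent $p$ holds for $\mathcal E_\alpha$. -/

import Mathlib

open MeasureTheory Filter Topology

noncomputable section

namespace DirichletNash

/-- The corner simplex `{x ∈ [0,1]^N : x_1 + ⋯ + x_N ≤ 1}`. -/
def simplex (N : ℕ) : Set (Fin N → ℝ) :=
  {x | (∀ i, x i ∈ Set.Icc (0 : ℝ) 1) ∧ ∑ i, x i ≤ 1}

/-- The Dirichlet density. The parameter `α_i` with `1 ≤ i ≤ N` is `α i.castSucc`, and `α_{N+1}` is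
`α (Fin.last N)`. -/
def density {N : ℕ} (α : Fin (N + 1) → ℝ) (x : Fin N → ℝ) : ℝ :=
  Real.Gamma (∑ i, α i) / (∏ i, Real.Gamma (α i)) *
    (1 - ∑ i, x i) ^ (α (Fin.last N) - 1) * ∏ i : Fin N, x i ^ (α i.castSucc - 1)

/-- The Dirichlet distribution with parameter `α`. -/
def dirichletMeasure {N : ℕ} (α : Fin (N + 1) → ℝ) : Measure (Fin N → ℝ) :=
  (volume.restrict (simplex N)).withDensity fun x => ENNReal.ofReal (density α x)

/-- The class `C¹` of the closed simplex. -/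
def C1 (N : ℕ) : Set ((Fin N → ℝ) → ℝ) :=
  {f | ContDiffOn ℝ 1 f (simplex N)}

/-- The partial derivative `∂_i f` on the closed simplex. -/
def partialDeriv {N : ℕ} (i : Fin N) (f : (Fin N → ℝ) → ℝ) (x : Fin N → ℝ) : ℝ :=
  fderivWithin ℝ f (simplex N) x (Pi.single i 1)

/-- The form of the multivariate Dirichlet diffusion on `C1 N`. -/
def multivariateForm {N : ℕ} (α : Fin (N + 1) → ℝ) (f g : (Fin N → ℝ) → ℝ) : ℝ :=
  ∫ x, ∑ i, x i * (1 - ∑ k, x k) * (partialDeriv i f x * partialDeriv i g x)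
    ∂(dirichletMeasure α)

/-- The form of the Fleming–Viot process on `C1 N`. -/
def flemingViotForm {N : ℕ} (α : Fin (N + 1) → ℝ) (f g : (Fin N → ℝ) → ℝ) : ℝ :=
  ∫ x, ∑ i, ∑ j, x i * ((if i = j then 1 else 0) - x j) *
    (partialDeriv i f x * partialDeriv j g x) ∂(dirichletMeasure α)

section Closure

variable {X : Type*} [MeasurableSpace X]

/-- `u` is a sequence in the core that converges to `f` in `L²(μ)` and is Cauchy for the form `E`. -/
structure Approximates (μ : Measure X) (core : Set (X → ℝ)) (E : (X → ℝ) → (X → ℝ) → ℝ)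
    (u : ℕ → X → ℝ) (f : X → ℝ) : Prop where
  mem_core : ∀ n, u n ∈ core
  tendsto_L2 : Tendsto (fun n => eLpNorm (u n - f) 2 μ) atTop (𝓝 0)
  cauchy : Tendsto (fun k : ℕ × ℕ => E (u k.1 - u k.2) (u k.1 - u k.2)) atTop (𝓝 0)

/-- The domain of the closure of `(E, core)` in `L²(μ)`. -/
def closureDomain (μ : Measure X) (core : Set (X → ℝ)) (E : (X → ℝ) → (X → ℝ) → ℝ) :
    Set (X → ℝ) :=
  {f | MemLp f 2 μ ∧ ∃ u, Approximates μ core E u f}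

/-- The quadratic form `f ↦ E(f,f)` of the closure: the value at `f` in the domain is the limit of
`E(u_n,u_n)` along an approximating sequence `u`. For a closable form this limit is the same for all
approximating sequences, so that the infimum below is over a single number. -/
def closureEnergy (μ : Measure X) (core : Set (X → ℝ)) (E : (X → ℝ) → (X → ℝ) → ℝ)
    (f : X → ℝ) : ℝ :=
  sInf {e | ∃ u, Approximates μ core E u f ∧ Tendsto (fun n => E (u n) (u n)) atTop (𝓝 e)}

/-- The Nash inequality with exponent `p` and constant `C` for the closure of `(E, core)`. -/
def NashInequality (μ : Measure X) (core : Set (X → ℝ)) (E : (X → ℝ) → (X → ℝ) → ℝ)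
    (p C : ℝ) : Prop :=
  ∀ f ∈ closureDomain μ core E, ∫ x, f x ∂μ = 0 →
    ∫ x, f x ^ 2 ∂μ ≤
      C * closureEnergy μ core E f ^ (p / (p + 1)) * (∫ x, |f x| ∂μ) ^ (2 / (p + 1))

end Closure

/-- The Nash inequality with exponent `p` holds for the multivariate Dirichlet diffusion, for some
constant. -/
def MultivariateNash {N : ℕ} (α : Fin (N + 1) → ℝ) (p : ℝ) : Prop :=
  ∃ C : ℝ, 0 < C ∧ NashInequality (dirichletMeasure α) (C1 N) (multivariateForm α) p C

/-- The Nash inequality with exponent `p` holds for the Fleming–Viot process, for some constant. -/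
def FlemingViotNash {N : ℕ} (α : Fin (N + 1) → ℝ) (p : ℝ) : Prop :=
  ∃ C : ℝ, 0 < C ∧ NashInequality (dirichletMeasure α) (C1 N) (flemingViotForm α) p C

/-- `p_α = ∑_{i ≤ N} 1 ∨ (2 α_i) + (α_{N+1} - 1)⁺`. -/
def nashExponent {N : ℕ} (α : Fin (N + 1) → ℝ) : ℝ :=
  ∑ i : Fin N, max 1 (2 * α i.castSucc) + max (α (Fin.last N) - 1) 0

/-- The lower bound for the exponents of the multivariate Dirichlet diffusion. -/
def multivariateLowerBound {N : ℕ} (α : Fin (N + 1) → ℝ) : ℝ :=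
  max (⨆ i : Fin (N + 1), ∑ j ∈ Finset.univ.erase i, α j)
    (α (Fin.last N) + ⨆ i : Fin N, ∑ j ∈ Finset.univ.erase i, max 1 (α j.castSucc))

/-- The lower bound for the exponents of the Fleming–Viot process. -/
def flemingViotLowerBound {N : ℕ} (α : Fin (N + 1) → ℝ) : ℝ :=
  max (∑ i : Fin N, α i.castSucc)
    (1 / 2 * α (Fin.last N) +
      1 / 2 * ⨆ i : Fin N, ∑ j ∈ Finset.univ.erase i, max 1 (α j.castSucc))

end DirichletNash

end

open MeasureTheory Filter Topology

noncomputable section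

namespace DirichletNash

set_option linter.unusedSectionVars false

open scoped ENNReal

/-! ### Tensorization of oscillations over product measures -/

section Product

variable {ι : Type*} [Fintype ι] [DecidableEq ι]

/-! The Nash inequality for exponent `p` is obtained from two facts: a super Poincaré inequality
`μ(F²) ≤ C (r E(F) + r^(-p) μ(|F|)²)` for small `r`, and a Poincaré inequality, which for mean zero
gives `μ(|F|)² ≤ C E(F)`. Choosing `r` proportional to `(μ(|F|)² / E(F))^(1/(p+1))` is then
permitted and gives the claim (`nash_of_superPoincare`). By Cauchy–Schwarz the Fleming–Viot form
dominates the multivariate one (`sum_multivariateCoeff_le`), so only the latter is estimated from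
below.

Some barycentric coordinate is at least `1/(N+1)` at every point, so it is enough to work near each
vertex. Exchanging that coordinate with the last one (`reflect`) gives a chart in which the measure
is comparable with a product of the measures `t^(β_j - 1) dt`. In this chart the form controls `x_i
(g_i² + ∑_{j ≠ i} x_j g_j²)`; the common weight `x_i` is the original last coordinate, which may
vanish (`chartForm_comp_reflect_le`). At the last vertex the form is stronger and any `i` serves.

In a chart the space is cut into boxes with sides `(k r, (k+1) r]` in direction `i` and `((k r)²,
((k+1) r)²]` in the others. On such a box the Poincaré constant is of order `r`: tensorize, use the
one-dimensional weighted inequality on intervals that begin at `0` or are comparable to their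
distance from `0`, and trade the missing weight `x_i` for oscillation in direction `i`
(`lintegral_mul_coordOsc_le_add`). A box that meets the region considered has measure at least of
order `r^p`, with `max 1 β_i` from direction `i` and `max 1 (2 β_j)` from the others
(`gridPoint_measure`); in every chart `p ≤ p_α`. Summing over boxes gives the super Poincaré
inequality. The Poincaré inequality comes from finitely many larger boxes, glued along a common part
of positive measure.

The inequality passes from `C¹` functions to the closure by subtracting means from approximating
sequences (`nashInequality_of_core`).

For the lower bounds, insert bumps of width `ε` whose support has measure of order `ε^P`. If the
coefficients of the form are at most of order `ε^r` there, the energy is at most of order `ε^(P - 2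
+ r)`, and `ε → 0` forces `P ≤ (2 - r) p`. Bumps at the vertex `0`, and on the face `|x|_1 = 1` with
each other coordinate placed at `0` or in the interior, whichever gives the larger `P`, produce the
stated bounds. They meet the upper bound when `α_i ≤ 1/2` for `i ≤ N` and `α_{N+1} ≥ 1`. -/

theorem lmarginal_prod (μ : ι → Measure ℝ) [∀ j, SigmaFinite (μ j)] {w : ι → ℝ → ℝ≥0∞}
    (hw : ∀ j, Measurable (w j)) (s : Finset ι) (x : ι → ℝ) :
    (∫⋯∫⁻_s, (fun x => ∏ j ∈ s, w j (x j)) ∂μ) x = ∏ j ∈ s, ∫⁻ t, w j t ∂μ j := by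
  induction s using Finset.induction generalizing x with
  | empty => simp
  | insert i s hi ih =>
    have hm : ∀ s : Finset ι, Measurable fun x : ι → ℝ => ∏ j ∈ s, w j (x j) := fun s =>
      Finset.measurable_prod s fun j _ => (hw j).comp (measurable_pi_apply j)
    rw [lmarginal_insert' _ (hm _) hi]
    have : (fun x : ι → ℝ => ∫⁻ t, ∏ j ∈ insert i s, w j (Function.update x i t j) ∂μ i) =
        (∫⁻ t, w i t ∂μ i) • fun x : ι → ℝ => ∏ j ∈ s, w j (x j) := by
      ext x
      simp only [Finset.prod_insert hi, Function.update_self, Pi.smul_apply, smul_eq_mul]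
      rw [← lintegral_mul_const _ (hw i)]
      congr 1
      ext t
      congr 1
      refine Finset.prod_congr rfl fun j hj => ?_
      rw [Function.update_of_ne (by rintro rfl; exact hi hj)]
    rw [this, Finset.prod_insert hi, ← ih x]
    simp only [lmarginal, Pi.smul_apply, smul_eq_mul]
    rw [lintegral_const_mul]
    exact (hm s).comp measurable_updateFinset

theorem lintegral_pi_prod (μ : ι → Measure ℝ) [∀ j, SigmaFinite (μ j)] {w : ι → ℝ → ℝ≥0∞}
    (hw : ∀ j, Measurable (w j)) :
    ∫⁻ x, ∏ j, w j (x j) ∂Measure.pi μ = ∏ j, ∫⁻ t, w j t ∂μ j := by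
  rw [lintegral_eq_lmarginal_univ (fun _ => 0), lmarginal_prod μ hw]

theorem pi_withDensity (μ : ι → Measure ℝ) [∀ j, SigmaFinite (μ j)] {w : ι → ℝ → ℝ≥0∞}
    (hw : ∀ j, Measurable (w j)) [∀ j, SigmaFinite ((μ j).withDensity (w j))] :
    Measure.pi (fun j => (μ j).withDensity (w j)) =
      (Measure.pi μ).withDensity fun x => ∏ j, w j (x j) := by
  refine Measure.pi_eq fun s hs => ?_
  rw [withDensity_apply _ (MeasurableSet.univ_pi hs), Measure.restrict_pi_pi,
    lintegral_pi_prod _ hw]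
  exact Finset.prod_congr rfl fun j _ => (withDensity_apply _ (hs j)).symm

theorem pi_smul (μ : ι → Measure ℝ) [∀ j, SigmaFinite (μ j)] (c : ι → ℝ≥0∞)
    [∀ j, SigmaFinite (c j • μ j)] :
    Measure.pi (fun j => c j • μ j) = (∏ j, c j) • Measure.pi μ := by
  refine Measure.pi_eq fun s hs => ?_
  simp [Measure.pi_pi, Finset.prod_mul_distrib]

/-- Resampling one coordinate of a product of probability measures does not change its law. -/
theorem lintegral_pi_update (ρ : ι → Measure ℝ) [∀ j, IsProbabilityMeasure (ρ j)] (i : ι)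
    {H : (ι → ℝ) → ℝ≥0∞} (hH : Measurable H) :
    ∫⁻ x, ∫⁻ t, H (Function.update x i t) ∂ρ i ∂Measure.pi ρ = ∫⁻ x, H x ∂Measure.pi ρ := by
  have h := lintegral_eq_of_lmarginal_eq (μ := ρ) {i} (g := H)
    (f := fun x => ∫⁻ t, H (Function.update x i t) ∂ρ i) ?_ hH ?_
  · exact h
  · rw [← lmarginal_singleton]; exact hH.lmarginal ρ
  · rw [lmarginal_singleton, lmarginal_singleton]
    simp

theorem measurable_update_pair (i : ι) :
    Measurable fun p : (ι → ℝ) × ℝ => Function.update p.1 i p.2 := by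
  refine measurable_pi_iff.2 fun j => ?_
  rcases eq_or_ne j i with rfl | h
  · simpa using measurable_snd
  · simp only [Function.update_of_ne h]
    fun_prop

theorem ofReal_sq_sub_le (a b c : ℝ) :
    ENNReal.ofReal ((a - c) ^ 2) ≤
      2 * ENNReal.ofReal ((a - b) ^ 2) + 2 * ENNReal.ofReal ((b - c) ^ 2) := by
  rw [← ENNReal.ofReal_ofNat, ← ENNReal.ofReal_mul (by norm_num),
    ← ENNReal.ofReal_mul (by norm_num), ← ENNReal.ofReal_add (by positivity) (by positivity)]
  refine ENNReal.ofReal_le_ofReal ?_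
  nlinarith [sq_nonneg (a - b - (b - c))]

/-- The mean oscillation of `F` in the direction of the coordinate `j`. -/
def coordOsc (ρ : ι → Measure ℝ) (F : (ι → ℝ) → ℝ) (j : ι) : ℝ≥0∞ :=
  ∫⁻ x, ∫⁻ t, ENNReal.ofReal ((F (Function.update x j t) - F x) ^ 2) ∂ρ j ∂Measure.pi ρ

/-- Induction on the set of resampled coordinates. For a new coordinate `i`, insert the point where
only `i` has been changed. The difference from there is the term for `s` at a point with the same
law (`lintegral_pi_update`), and the remaining one is the oscillation in direction `i`. Each
insertion costs a factor 2; the sharp constant of the variance is not needed. -/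
theorem lintegral_updateFinset_le (ρ : ι → Measure ℝ) [∀ j, IsProbabilityMeasure (ρ j)]
    {F : (ι → ℝ) → ℝ} (hF : Measurable F) (s : Finset ι) :
    ∫⁻ x, (∫⋯∫⁻_s, (fun z => ENNReal.ofReal ((F z - F x) ^ 2)) ∂ρ) x ∂Measure.pi ρ ≤
      2 ^ s.card * ∑ j ∈ s, coordOsc ρ F j := by
  induction s using Finset.induction with
  | empty => simp
  | insert i s hi ih =>
    have hm : ∀ a : ℝ, Measurable fun z => ENNReal.ofReal ((F z - a) ^ 2) := fun a =>
      ((hF.sub_const a).pow_const 2).ennreal_ofReal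
    have hm2 : Measurable fun p : (ι → ℝ) × (ι → ℝ) => ENNReal.ofReal ((F p.2 - F p.1) ^ 2) :=
      (((hF.comp measurable_snd).sub (hF.comp measurable_fst)).pow_const 2).ennreal_ofReal
    set V : (ι → ℝ) → ℝ≥0∞ := fun x =>
      (∫⋯∫⁻_s, (fun z => ENNReal.ofReal ((F z - F x) ^ 2)) ∂ρ) x with hV
    have hVm : Measurable V := by
      have : Measurable fun p : (ι → ℝ) × (∀ _ : s, ℝ) => 
          ENNReal.ofReal ((F (Function.updateFinset p.1 s p.2) - F p.1) ^ 2) :=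
        (((hF.comp measurable_updateFinset').sub (hF.comp measurable_fst)).pow_const
          2).ennreal_ofReal
      exact this.lintegral_prod_right
    have key : ∀ x, (∫⋯∫⁻_insert i s, (fun z => ENNReal.ofReal ((F z - F x) ^ 2)) ∂ρ) x ≤
        2 * ∫⁻ t, V (Function.update x i t) ∂ρ i +
          2 * ∫⁻ t, ENNReal.ofReal ((F (Function.update x i t) - F x) ^ 2) ∂ρ i := by
      intro x
      rw [lmarginal_insert _ (hm _) hi]
      have hu : Measurable fun t => Function.update x i t :=
        (measurable_update_pair i).comp (measurable_const.prodMk measurable_id)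
      have hVu : Measurable fun t => V (Function.update x i t) := hVm.comp hu
      have hFu : Measurable fun t => ENNReal.ofReal ((F (Function.update x i t) - F x) ^ 2) :=
        (hm _).comp hu
      rw [← lintegral_const_mul _ hVu, ← lintegral_const_mul _ hFu,
        ← lintegral_add_left (hVu.const_mul 2)]
      refine lintegral_mono fun t => ?_
      simp only [hV, lmarginal]
      rw [← lintegral_const_mul _ (by exact (hm _).comp measurable_updateFinset)]
      calc _ ≤ ∫⁻ y : s → ℝ, (2 * ENNReal.ofReal
            ((F (Function.updateFinset (Function.update x i t) s y) - F (Function.update x i t)) ^ 2)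
            + 2 * ENNReal.ofReal ((F (Function.update x i t) - F x) ^ 2))
              ∂Measure.pi fun j : s => ρ j := lintegral_mono fun y => ofReal_sq_sub_le _ _ _
        _ = _ := by
          rw [lintegral_add_right _ measurable_const]
          simp
    calc _ ≤ ∫⁻ x, (2 * ∫⁻ t, V (Function.update x i t) ∂ρ i +
          2 * ∫⁻ t, ENNReal.ofReal ((F (Function.update x i t) - F x) ^ 2) ∂ρ i) ∂Measure.pi ρ :=
          lintegral_mono key
      _ = 2 * ∫⁻ x, V x ∂Measure.pi ρ + 2 * coordOsc ρ F i := by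
          have h1 : Measurable fun x => ∫⁻ t, V (Function.update x i t) ∂ρ i :=
            Measurable.lintegral_prod_right' (f := fun p : (ι → ℝ) × ℝ =>
              V (Function.update p.1 i p.2)) (hVm.comp (measurable_update_pair i))
          have h2 : Measurable fun x =>
              ∫⁻ t, ENNReal.ofReal ((F (Function.update x i t) - F x) ^ 2) ∂ρ i := by
            have : Measurable fun p : (ι → ℝ) × ℝ =>
                ENNReal.ofReal ((F (Function.update p.1 i p.2) - F p.1) ^ 2) :=
              (((hF.comp (measurable_update_pair i)).sub (hF.comp measurable_fst)).pow_const
                2).ennreal_ofReal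
            exact this.lintegral_prod_right
          rw [lintegral_add_left (h1.const_mul 2), lintegral_const_mul _ h1,
            lintegral_const_mul _ h2, lintegral_pi_update ρ i hVm, coordOsc]
      _ ≤ 2 * (2 ^ s.card * ∑ j ∈ s, coordOsc ρ F j) + 2 * coordOsc ρ F i := by gcongr
      _ ≤ 2 * (2 ^ s.card * ∑ j ∈ s, coordOsc ρ F j) + 2 * (2 ^ s.card * coordOsc ρ F i) := by
          gcongr
          exact le_mul_of_one_le_left (zero_le) (one_le_pow₀ (by norm_num))
      _ = _ := by
          rw [Finset.card_insert_of_notMem hi, Finset.sum_insert hi]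
          ring

/-- Tensorization of the variance. -/
theorem lintegral_pi_sq_sub_le (ρ : ι → Measure ℝ) [∀ j, IsProbabilityMeasure (ρ j)]
    {F : (ι → ℝ) → ℝ} (hF : Measurable F) :
    ∫⁻ x, ∫⁻ y, ENNReal.ofReal ((F y - F x) ^ 2) ∂Measure.pi ρ ∂Measure.pi ρ ≤
      2 ^ Fintype.card ι * ∑ j, coordOsc ρ F j := by
  simpa using lintegral_updateFinset_le ρ hF Finset.univ

end Product

/-! ### Gluing Poincaré inequalities along a common subset -/

section Glue

variable {X : Type*} [MeasurableSpace X]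

/-- The oscillation of `F` between two sets. -/
def setOsc (μ : Measure X) (F : X → ℝ) (A B : Set X) : ℝ≥0∞ :=
  ∫⁻ x in A, ∫⁻ y in B, ENNReal.ofReal ((F y - F x) ^ 2) ∂μ ∂μ

theorem setOsc_mono {μ : Measure X} {F : X → ℝ} {A A' B B' : Set X} (hA : A ⊆ A') (hB : B ⊆ B') :
    setOsc μ F A B ≤ setOsc μ F A' B' :=
  (lintegral_mono_set hA).trans (lintegral_mono fun _ => lintegral_mono_set hB)

/-- Insert an intermediate point `z ∈ B` and integrate `(F y - F x)² ≤ 2 (F y - F z)² + 2 (F z - F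
x)²` over `A × B × D`. The variable absent from a term contributes a total mass. -/
theorem setOsc_comp_le (μ : Measure X) [SFinite μ] {F : X → ℝ} (hF : Measurable F)
    (A B D : Set X) :
    μ B * setOsc μ F A D ≤ 2 * (μ D * setOsc μ F A B) + 2 * (μ A * setOsc μ F B D) := by
  have hm2 : Measurable fun p : X × X => ENNReal.ofReal ((F p.2 - F p.1) ^ 2) :=
    (((hF.comp measurable_snd).sub (hF.comp measurable_fst)).pow_const 2).ennreal_ofReal
  have hm : ∀ x, Measurable fun y => ENNReal.ofReal ((F y - F x) ^ 2) := fun a =>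
    ((hF.sub_const (F a)).pow_const 2).ennreal_ofReal
  have hAB : ∀ S, Measurable fun x => ∫⁻ y in S, ENNReal.ofReal ((F y - F x) ^ 2) ∂μ := fun S =>
    hm2.lintegral_prod_right'
  have key : ∀ x, μ B * ∫⁻ y in D, ENNReal.ofReal ((F y - F x) ^ 2) ∂μ ≤
      2 * (μ D * ∫⁻ z in B, ENNReal.ofReal ((F z - F x) ^ 2) ∂μ) + 2 * setOsc μ F B D := by
    intro x
    calc μ B * ∫⁻ y in D, ENNReal.ofReal ((F y - F x) ^ 2) ∂μ
        = ∫⁻ _ in B, ∫⁻ y in D, ENNReal.ofReal ((F y - F x) ^ 2) ∂μ ∂μ := by simp [mul_comm]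
      _ ≤ ∫⁻ z in B, ∫⁻ y in D, (2 * ENNReal.ofReal ((F y - F z) ^ 2) +
            2 * ENNReal.ofReal ((F z - F x) ^ 2)) ∂μ ∂μ :=
          lintegral_mono fun z => lintegral_mono fun y => ofReal_sq_sub_le _ _ _
      _ = ∫⁻ z in B, (2 * (∫⁻ y in D, ENNReal.ofReal ((F y - F z) ^ 2) ∂μ) +
            2 * (μ D * ENNReal.ofReal ((F z - F x) ^ 2))) ∂μ := by
          refine lintegral_congr fun z => ?_
          rw [lintegral_add_right _ measurable_const, lintegral_const_mul _ (hm z)]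
          simp [mul_assoc, mul_comm (μ D)]
      _ = _ := by
          rw [lintegral_add_left ((hAB D).const_mul 2), lintegral_const_mul _ (hAB D),
            lintegral_const_mul _ ((hm x).const_mul _), lintegral_const_mul _ (hm x), add_comm]
          rfl
  calc μ B * setOsc μ F A D
      = ∫⁻ x in A, μ B * ∫⁻ y in D, ENNReal.ofReal ((F y - F x) ^ 2) ∂μ ∂μ := by
        rw [lintegral_const_mul _ (hAB D), setOsc]
    _ ≤ ∫⁻ x in A, (2 * (μ D * ∫⁻ z in B, ENNReal.ofReal ((F z - F x) ^ 2) ∂μ) +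
          2 * setOsc μ F B D) ∂μ := lintegral_mono key
    _ = _ := by
        rw [lintegral_add_right _ measurable_const, lintegral_const_mul _ ((hAB B).const_mul _),
          lintegral_const_mul _ (hAB B)]
        simp [setOsc, mul_assoc, mul_comm (μ A)]

theorem setOsc_biUnion_le (μ : Measure X) {F : X → ℝ} (hF : Measurable F) [SFinite μ]
    {κ : Type*} (s : Finset κ) (A : κ → Set X) :
    setOsc μ F (⋃ k ∈ s, A k) (⋃ k ∈ s, A k) ≤ ∑ k ∈ s, ∑ l ∈ s, setOsc μ F (A k) (A l) := by
  have hm2 : Measurable fun p : X × X => ENNReal.ofReal ((F p.2 - F p.1) ^ 2) :=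
    (((hF.comp measurable_snd).sub (hF.comp measurable_fst)).pow_const 2).ennreal_ofReal
  have hAB : ∀ S, Measurable fun x => ∫⁻ y in S, ENNReal.ofReal ((F y - F x) ^ 2) ∂μ := fun S =>
    hm2.lintegral_prod_right'
  have hsub : ∀ H : X → ℝ≥0∞, ∫⁻ x in ⋃ k ∈ s, A k, H x ∂μ ≤ ∑ k ∈ s, ∫⁻ x in A k, H x ∂μ := by
    intro H
    classical
    induction s using Finset.induction with
    | empty => simp
    | insert k s hk ih =>
      rw [Finset.set_biUnion_insert, Finset.sum_insert hk]
      exact (lintegral_union_le _ _ _).trans (by gcongr)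
  refine (hsub _).trans (Finset.sum_le_sum fun k _ => ?_)
  simp only [setOsc]
  rw [← lintegral_finsetSum _ fun l _ => hAB (A l)]
  exact lintegral_mono fun x => hsub _

/-- A finite cover by sets that share a set of positive measure controls the oscillation on the
union. -/
theorem exists_setOsc_biUnion_le (μ : Measure X) [SFinite μ] {κ : Type*} (s : Finset κ)
    (A : κ → Set X) (B : Set X) (hB : μ B ≠ 0) (hBA : ∀ k ∈ s, B ⊆ A k)
    (hA : ∀ k ∈ s, μ (A k) ≠ ∞) :
    ∃ C : ℝ≥0∞, C ≠ ∞ ∧ ∀ F : X → ℝ, Measurable F →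
      setOsc μ F (⋃ k ∈ s, A k) (⋃ k ∈ s, A k) ≤ C * ∑ k ∈ s, setOsc μ F (A k) (A k) := by
  rcases s.eq_empty_or_nonempty with rfl | hs
  · exact ⟨0, by simp, fun F hF => by simp [setOsc]⟩
  obtain ⟨k₀, hk₀⟩ := hs
  have hBt : μ B ≠ ∞ := ((measure_mono (hBA k₀ hk₀)).trans_lt (hA k₀ hk₀).lt_top).ne
  -- For each pair `k`, `l`, passing through `B` and dividing by `μ B` bounds the mixed oscillation
  -- by the sum of the diagonal ones.
  refine ⟨∑ k ∈ s, ∑ l ∈ s, ((μ B)⁻¹ * (2 * μ (A l)) + (μ B)⁻¹ * (2 * μ (A k))), ?_, ?_⟩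
  · refine ENNReal.sum_ne_top.2 fun k hk => ENNReal.sum_ne_top.2 fun l hl => ?_
    have := ENNReal.inv_ne_top.2 hB
    have h1 := hA k hk
    have h2 := hA l hl
    finiteness
  · intro F hF
    refine (setOsc_biUnion_le μ hF s A).trans ?_
    rw [Finset.sum_mul]
    refine Finset.sum_le_sum fun k hk => ?_
    rw [Finset.sum_mul]
    refine Finset.sum_le_sum fun l hl => ?_
    set S := ∑ k ∈ s, setOsc μ F (A k) (A k)
    have h1 : setOsc μ F (A k) B ≤ S := (setOsc_mono subset_rfl (hBA k hk)).trans
      (Finset.single_le_sum (f := fun k => setOsc μ F (A k) (A k)) (fun _ _ => zero_le) hk)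
    have h2 : setOsc μ F B (A l) ≤ S := (setOsc_mono (hBA l hl) subset_rfl).trans
      (Finset.single_le_sum (f := fun k => setOsc μ F (A k) (A k)) (fun _ _ => zero_le) hl)
    calc setOsc μ F (A k) (A l) = (μ B)⁻¹ * (μ B * setOsc μ F (A k) (A l)) := by
          rw [← mul_assoc, ENNReal.inv_mul_cancel hB hBt, one_mul]
      _ ≤ (μ B)⁻¹ * (2 * (μ (A l) * S) + 2 * (μ (A k) * S)) := by
          gcongr
          refine (setOsc_comp_le μ hF (A k) B (A l)).trans ?_
          gcongr
      _ = _ := by ring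

end Glue

/-! ### One-dimensional weighted Poincaré inequality on cells -/

/-- The measure `t ^ (β - 1) dt` on the positive half-line. -/
def powMeasure (β : ℝ) : Measure ℝ :=
  (volume.restrict (Set.Ioi 0)).withDensity fun t => ENNReal.ofReal (t ^ (β - 1))

instance (β : ℝ) : SigmaFinite (powMeasure β) := SigmaFinite.withDensity_ofReal _

theorem measurable_ofReal_rpow (γ : ℝ) : Measurable fun t : ℝ => ENNReal.ofReal (t ^ γ) := by
  fun_prop

theorem setLIntegral_powMeasure (β : ℝ) {s : Set ℝ} (hs : MeasurableSet s) (h0 : s ⊆ Set.Ioi 0)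
    (H : ℝ → ℝ≥0∞) :
    ∫⁻ t in s, H t ∂powMeasure β = ∫⁻ t in s, ENNReal.ofReal (t ^ (β - 1)) * H t := by
  rw [powMeasure, setLIntegral_withDensity_eq_setLIntegral_mul_non_measurable _
    (measurable_ofReal_rpow _) _ hs (by simp), Measure.restrict_restrict hs,
    Set.inter_eq_left.2 h0]
  rfl

theorem powMeasure_apply (β : ℝ) {s : Set ℝ} (hs : MeasurableSet s) (h0 : s ⊆ Set.Ioi 0) :
    powMeasure β s = ∫⁻ t in s, ENNReal.ofReal (t ^ (β - 1)) := by
  rw [powMeasure, withDensity_apply _ hs, Measure.restrict_restrict hs, Set.inter_eq_left.2 h0]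

theorem powMeasure_Ioc_zero {β b : ℝ} (hβ : 0 < β) (hb : 0 ≤ b) :
    powMeasure β (Set.Ioc 0 b) = ENNReal.ofReal (b ^ β / β) := by
  have h0 : (Set.Ioc 0 b) ⊆ Set.Ioi (0 : ℝ) := fun t ht => ht.1
  rw [powMeasure_apply β measurableSet_Ioc h0]
  have hi : IntegrableOn (fun t : ℝ => t ^ (β - 1)) (Set.Ioc 0 b) :=
    (intervalIntegrable_iff_integrableOn_Ioc_of_le hb).1
      (intervalIntegral.intervalIntegrable_rpow' (by linarith))
  rw [← ofReal_integral_eq_lintegral_ofReal hi, ← intervalIntegral.integral_of_le hb,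
    integral_rpow (Or.inl (by linarith))]
  · simp [Real.zero_rpow hβ.ne']
  · filter_upwards [ae_restrict_mem measurableSet_Ioc] with t ht
    exact Real.rpow_nonneg ht.1.le _

/-- Intervals on which powers of `t` have a controlled behaviour: they start at `0`, or stay away
from `0` on their own scale. -/
structure IsCell (a b : ℝ) : Prop where
  nonneg : 0 ≤ a
  lt : a < b
  scale : a = 0 ∨ b ≤ 4 * a

theorem IsCell.pos {a b : ℝ} (h : IsCell a b) : 0 < b := h.nonneg.trans_lt h.lt

theorem IsCell.subset {a b : ℝ} (h : IsCell a b) : Set.Ioc a b ⊆ Set.Ioi 0 :=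
  fun _ ht => h.nonneg.trans_lt ht.1

theorem rpow_le_of_scale (γ : ℝ) {b t : ℝ} (h1 : b ≤ 4 * t) (h2 : t ≤ b) (ht : 0 < t) :
    t ^ γ ≤ (4 : ℝ) ^ |γ| * b ^ γ := by
  rcases le_or_gt 0 γ with h | h
  · calc t ^ γ ≤ b ^ γ := Real.rpow_le_rpow ht.le h2 h
      _ ≤ _ := le_mul_of_one_le_left (Real.rpow_nonneg (ht.le.trans h2) _)
        (Real.one_le_rpow (by norm_num) (abs_nonneg _))
  · rw [abs_of_neg h, Real.rpow_neg (by norm_num), ← Real.inv_rpow (by norm_num),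
      ← Real.mul_rpow (by norm_num) (ht.le.trans h2)]
    exact Real.rpow_le_rpow_of_nonpos (by linarith) (by linarith) h.le

theorem le_rpow_of_scale (γ : ℝ) {b t : ℝ} (h1 : b ≤ 4 * t) (h2 : t ≤ b) (ht : 0 < t) :
    (4 : ℝ) ^ (-|γ|) * b ^ γ ≤ t ^ γ := by
  have h := rpow_le_of_scale (-γ) h1 h2 ht
  rw [abs_neg, Real.rpow_neg ht.le, Real.rpow_neg (ht.le.trans h2)] at h
  have ht' : 0 < t ^ γ := Real.rpow_pos_of_pos ht _
  have hb' : 0 < b ^ γ := Real.rpow_pos_of_pos (ht.trans_le h2) _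
  have h4 : (0 : ℝ) < 4 ^ |γ| := Real.rpow_pos_of_pos (by norm_num) _
  rw [Real.rpow_neg (by norm_num)]
  rw [inv_le_iff_one_le_mul₀ ht'] at h
  rw [inv_mul_le_iff₀ h4]
  have : b ^ γ * 1 ≤ b ^ γ * ((4 : ℝ) ^ |γ| * (b ^ γ)⁻¹ * t ^ γ) := by gcongr
  calc b ^ γ ≤ b ^ γ * ((4 : ℝ) ^ |γ| * (b ^ γ)⁻¹ * t ^ γ) := by linarith
    _ = _ := by field_simp

/-- On a cell the density may be replaced by its value at the right end, up to constants. If the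
cell starts at `0` its mass is exactly `b ^ β / β`; otherwise `t` and `b` differ by a factor at most
4. -/
theorem exists_powMeasure_cell {β : ℝ} (hβ : 0 < β) :
    ∃ c C : ℝ, 0 < c ∧ 0 < C ∧ ∀ a b, IsCell a b →
      ENNReal.ofReal (c * ((b - a) * b ^ (β - 1))) ≤ powMeasure β (Set.Ioc a b) ∧
      powMeasure β (Set.Ioc a b) ≤ ENNReal.ofReal (C * ((b - a) * b ^ (β - 1))) := by
  refine ⟨min (1 / β) (4 ^ (-|β - 1|)), max (1 / β) (4 ^ |β - 1|), by positivity, by positivity,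
    fun a b h => ?_⟩
  have hb := h.pos
  have hab : 0 < (b - a) * b ^ (β - 1) :=
    mul_pos (sub_pos.2 h.lt) (Real.rpow_pos_of_pos hb _)
  rcases h.scale with rfl | hs
  · have : b ^ β / β = 1 / β * ((b - 0) * b ^ (β - 1)) := by
      rw [Real.rpow_sub_one hb.ne']; field_simp; ring
    rw [powMeasure_Ioc_zero hβ hb.le, this]
    constructor <;> refine ENNReal.ofReal_le_ofReal (mul_le_mul_of_nonneg_right ?_ hab.le)
    · exact min_le_left _ _
    · exact le_max_left _ _
  · rw [powMeasure_apply β measurableSet_Ioc h.subset]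
    have hv : volume (Set.Ioc a b) = ENNReal.ofReal (b - a) := by simp
    have hba : 0 ≤ b - a := sub_nonneg.2 h.lt.le
    constructor
    · calc _ ≤ ENNReal.ofReal (4 ^ (-|β - 1|) * b ^ (β - 1)) * volume (Set.Ioc a b) := by
            rw [hv, ← ENNReal.ofReal_mul (by positivity)]
            refine ENNReal.ofReal_le_ofReal ?_
            calc _ ≤ (4 : ℝ) ^ (-|β - 1|) * ((b - a) * b ^ (β - 1)) :=
                  mul_le_mul_of_nonneg_right (min_le_right _ _) hab.le
              _ = _ := by ring
        _ = ∫⁻ t in Set.Ioc a b, ENNReal.ofReal (4 ^ (-|β - 1|) * b ^ (β - 1)) := by simp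
        _ ≤ _ := setLIntegral_mono' measurableSet_Ioc fun t ht => ENNReal.ofReal_le_ofReal
            (le_rpow_of_scale _ (by linarith [ht.1]) ht.2 (h.subset ht))
    · calc _ ≤ ∫⁻ t in Set.Ioc a b, ENNReal.ofReal (4 ^ |β - 1| * b ^ (β - 1)) :=
            setLIntegral_mono' measurableSet_Ioc fun t ht => ENNReal.ofReal_le_ofReal
            (rpow_le_of_scale _ (by linarith [ht.1]) ht.2 (h.subset ht))
        _ = ENNReal.ofReal (4 ^ |β - 1| * b ^ (β - 1)) * volume (Set.Ioc a b) := by simp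
        _ ≤ _ := by
            rw [hv, ← ENNReal.ofReal_mul (by positivity)]
            refine ENNReal.ofReal_le_ofReal ?_
            calc _ = (4 : ℝ) ^ |β - 1| * ((b - a) * b ^ (β - 1)) := by ring
              _ ≤ _ := mul_le_mul_of_nonneg_right (le_max_right _ _) hab.le

theorem powMeasure_cell_ne_zero {β : ℝ} (hβ : 0 < β) {a b : ℝ} (h : IsCell a b) :
    powMeasure β (Set.Ioc a b) ≠ 0 := by
  obtain ⟨c, C, hc, -, H⟩ := exists_powMeasure_cell hβ
  refine (lt_of_lt_of_le ?_ (H a b h).1).ne'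
  exact ENNReal.ofReal_pos.2 (mul_pos hc (mul_pos (sub_pos.2 h.lt) (Real.rpow_pos_of_pos h.pos _)))

theorem powMeasure_cell_ne_top {β : ℝ} (hβ : 0 < β) {a b : ℝ} (h : IsCell a b) :
    powMeasure β (Set.Ioc a b) ≠ ∞ := by
  obtain ⟨c, C, -, -, H⟩ := exists_powMeasure_cell hβ
  exact ((H a b h).2.trans_lt ENNReal.ofReal_lt_top).ne

/-- The measure `t · t^(β-1) dt` is `powMeasure (β + 1)`, so the two-sided mass estimates for `β`
and `β + 1` compare the mean of `t` with `b`. This is the lower bound for the mean of the degenerate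
weight `x_i` on a box. -/
theorem exists_le_lintegral_id_cell {β : ℝ} (hβ : 0 < β) :
    ∃ c : ℝ, 0 < c ∧ ∀ a b, IsCell a b →
      ENNReal.ofReal (c * b) * powMeasure β (Set.Ioc a b) ≤
        ∫⁻ t in Set.Ioc a b, ENNReal.ofReal t ∂powMeasure β := by
  obtain ⟨c, C₁, hc, hC₁, H1⟩ := exists_powMeasure_cell (β := β + 1) (by linarith)
  obtain ⟨c₁, C, hc₁, hC, H2⟩ := exists_powMeasure_cell hβ
  refine ⟨c / C, by positivity, fun a b h => ?_⟩
  have hb := h.pos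
  calc _ ≤ ENNReal.ofReal (c / C * b) * ENNReal.ofReal (C * ((b - a) * b ^ (β - 1))) := by
        gcongr
        exact (H2 a b h).2
    _ = ENNReal.ofReal (c * ((b - a) * b ^ (β + 1 - 1))) := by
        rw [← ENNReal.ofReal_mul (by positivity)]
        congr 1
        rw [add_sub_cancel_right, Real.rpow_sub_one hb.ne']
        field_simp
    _ ≤ powMeasure (β + 1) (Set.Ioc a b) := (H1 a b h).1
    _ = _ := by
        rw [powMeasure_apply _ measurableSet_Ioc h.subset,
          setLIntegral_powMeasure _ measurableSet_Ioc h.subset]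
        refine setLIntegral_congr_fun measurableSet_Ioc fun t ht => ?_
        have ht0 : 0 < t := h.subset ht
        rw [← ENNReal.ofReal_mul (by positivity), add_sub_cancel_right, Real.rpow_sub_one ht0.ne']
        congr 1
        field_simp

/-- Write `g y - g x` as the integral of `g'` and apply Cauchy–Schwarz to `h^(-1/2) · (h^(1/2) g')`.
The weight `h` remains free: a constant serves away from `0`, a power of `t` near `0`. -/
theorem ofReal_sq_sub_le_lintegral_mul {g g' h : ℝ → ℝ} {x y : ℝ} (hxy : x ≤ y)
    (hg : ∀ t ∈ Set.Icc x y, HasDerivAt g (g' t) t) (hg' : ContinuousOn g' (Set.Icc x y))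
    (hgm : Measurable g') (hh : ∀ t ∈ Set.Ioc x y, 0 < h t) (hhm : Measurable h) :
    ENNReal.ofReal ((g y - g x) ^ 2) ≤ (∫⁻ t in Set.Ioc x y, ENNReal.ofReal ((h t)⁻¹)) *
      ∫⁻ t in Set.Ioc x y, ENNReal.ofReal (h t * g' t ^ 2) := by
  have hint : ∫ t in Set.Ioc x y, g' t = g y - g x := by
    rw [← intervalIntegral.integral_of_le hxy]
    exact intervalIntegral.integral_eq_sub_of_hasDerivAt (by rwa [Set.uIcc_of_le hxy])
      (ContinuousOn.intervalIntegrable (by rwa [Set.uIcc_of_le hxy]))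
  set u : ℝ → ℝ≥0∞ := fun t => ENNReal.ofReal (√(h t)⁻¹)
  set v : ℝ → ℝ≥0∞ := fun t => ENNReal.ofReal (√(h t * g' t ^ 2))
  have hum : Measurable u := by fun_prop
  have hvm : Measurable v := by fun_prop
  have h1 : ‖g y - g x‖ₑ ≤ ∫⁻ t in Set.Ioc x y, (u * v) t := by
    rw [← hint]
    refine (enorm_integral_le_lintegral_enorm _).trans
      (setLIntegral_mono' measurableSet_Ioc fun t ht => le_of_eq ?_)
    have := hh t ht
    simp only [u, v, Pi.mul_apply]
    rw [← ENNReal.ofReal_mul (by positivity), ← Real.sqrt_mul (by positivity), ← mul_assoc,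
      inv_mul_cancel₀ this.ne', one_mul, Real.sqrt_sq_eq_abs, Real.enorm_eq_ofReal_abs]
  have h2 := ENNReal.lintegral_mul_le_Lp_mul_Lq (volume.restrict (Set.Ioc x y))
    Real.HolderConjugate.two_two hum.aemeasurable hvm.aemeasurable
  have h3 : ENNReal.ofReal ((g y - g x) ^ 2) = ‖g y - g x‖ₑ ^ (2 : ℝ) := by
    rw [Real.enorm_eq_ofReal_abs, ENNReal.rpow_ofNat, ← ENNReal.ofReal_pow (abs_nonneg _), sq_abs]
  rw [h3]
  refine (ENNReal.rpow_le_rpow (h1.trans h2) (by norm_num)).trans (le_of_eq ?_)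
  rw [ENNReal.mul_rpow_of_nonneg _ _ (by norm_num), ← ENNReal.rpow_mul, ← ENNReal.rpow_mul]
  norm_num
  congr 1 <;> refine setLIntegral_congr_fun measurableSet_Ioc fun t ht => ?_ <;>
    have := hh t ht <;> simp only [u, v] <;>
    rw [← ENNReal.ofReal_pow (by positivity), Real.sq_sqrt (by positivity)]

theorem lintegral_rpow_Ioc_le {β x y : ℝ} (hβ : 0 < β) (hx : 0 < x) :
    ∫⁻ t in Set.Ioc x y, ENNReal.ofReal ((t ^ (1 + β))⁻¹) ≤ ENNReal.ofReal (x ^ (-β) / β) := by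
  calc _ ≤ ∫⁻ t in Set.Ioi x, ENNReal.ofReal ((t ^ (1 + β))⁻¹) :=
        lintegral_mono_set fun t ht => ht.1
    _ = ∫⁻ t in Set.Ioi x, ENNReal.ofReal (t ^ (-(1 + β))) :=
        setLIntegral_congr_fun measurableSet_Ioi fun t ht => by
          rw [Real.rpow_neg (hx.trans ht).le]
    _ = _ := by
        rw [← ofReal_integral_eq_lintegral_ofReal
          (integrableOn_Ioi_rpow_of_lt (by linarith) hx), integral_Ioi_rpow_of_lt (by linarith) hx]
        · congr 1
          rw [show -(1 + β) + 1 = -β by ring, neg_div_neg_eq]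
        · filter_upwards [ae_restrict_mem measurableSet_Ioi] with t ht
          exact Real.rpow_nonneg (hx.trans ht).le _

/-- The weight `t^β` in the Dirichlet integral is comparable with `b^β` throughout the cell, so
unweighted Cauchy–Schwarz already bounds every squared difference by `(b - a) b^(-β)` times the
integral. Integrating over both points costs the squared mass, and one of the two masses is replaced
by `(b - a) b^(β-1)`. -/
theorem setOsc_cell_le_of_scale {β : ℝ} (hβ : 0 < β) :
    ∃ C : ℝ, 0 < C ∧ ∀ a b, IsCell a b → b ≤ 4 * a → ∀ g g' : ℝ → ℝ, Measurable g' →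
      (∀ t ∈ Set.Ioc a b, HasDerivAt g (g' t) t) → ContinuousOn g' (Set.Ioc a b) →
      setOsc (powMeasure β) g (Set.Ioc a b) (Set.Ioc a b) ≤
        ENNReal.ofReal (C * ((b - a) ^ 2 / b)) * powMeasure β (Set.Ioc a b) *
          ∫⁻ t in Set.Ioc a b, ENNReal.ofReal (t * g' t ^ 2) ∂powMeasure β := by
  obtain ⟨c₁, C, hc₁, hC, H2⟩ := exists_powMeasure_cell hβ
  refine ⟨4 ^ |β| * C, by positivity, fun a b h hs g g' hgm hg hg' => ?_⟩
  have hb := h.pos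
  have hba : 0 < b - a := sub_pos.2 h.lt
  set W := powMeasure β (Set.Ioc a b) with hW
  set J := ∫⁻ t in Set.Ioc a b, ENNReal.ofReal (t * g' t ^ 2) ∂powMeasure β with hJ
  have hJ1 : ∫⁻ t in Set.Ioc a b, ENNReal.ofReal (g' t ^ 2) ≤
      ENNReal.ofReal (4 ^ |β| * b ^ (-β)) * J := by
    rw [hJ, setLIntegral_powMeasure β measurableSet_Ioc h.subset, ← lintegral_const_mul _
      (by fun_prop)]
    refine setLIntegral_mono' measurableSet_Ioc fun t ht => ?_
    have ht0 : 0 < t := h.subset ht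
    rw [← ENNReal.ofReal_mul (by positivity), ← ENNReal.ofReal_mul (by positivity)]
    refine ENNReal.ofReal_le_ofReal ?_
    have h1 := rpow_le_of_scale (-β) (b := b) (t := t) (by linarith [ht.1]) ht.2 ht0
    rw [abs_neg] at h1
    have h2 : t ^ (-β) * (t ^ (β - 1) * t) = 1 := by
      rw [Real.rpow_neg ht0.le, Real.rpow_sub_one ht0.ne']
      have := Real.rpow_pos_of_pos ht0 β
      field_simp
    calc g' t ^ 2 = t ^ (-β) * (t ^ (β - 1) * t) * g' t ^ 2 := by rw [h2, one_mul]
      _ = t ^ (-β) * (t ^ (β - 1) * (t * g' t ^ 2)) := by ring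
      _ ≤ _ := by gcongr
  have key : ∀ x ∈ Set.Ioc a b, ∀ y ∈ Set.Ioc a b, x ≤ y → ENNReal.ofReal ((g y - g x) ^ 2) ≤
      ENNReal.ofReal (b - a) * (ENNReal.ofReal (4 ^ |β| * b ^ (-β)) * J) := by
    intro x hx y hy hxy
    have hsub : Set.Icc x y ⊆ Set.Ioc a b := fun t ht => ⟨hx.1.trans_le ht.1, ht.2.trans hy.2⟩
    have := ofReal_sq_sub_le_lintegral_mul (h := fun _ => 1) hxy (fun t ht => hg t (hsub ht))
      (hg'.mono hsub) hgm (fun _ _ => one_pos) measurable_const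
    refine this.trans (mul_le_mul' ?_ (le_trans ?_ hJ1))
    · simp only [inv_one, ENNReal.ofReal_one, lintegral_one, Measure.restrict_apply_univ,
        Real.volume_Ioc]
      exact ENNReal.ofReal_le_ofReal (by linarith [hx.1, hy.2])
    · simp only [one_mul]
      exact lintegral_mono_set (Set.Ioc_subset_Icc_self.trans hsub)
  have key' : ∀ x ∈ Set.Ioc a b, ∀ y ∈ Set.Ioc a b, ENNReal.ofReal ((g y - g x) ^ 2) ≤
      ENNReal.ofReal (b - a) * (ENNReal.ofReal (4 ^ |β| * b ^ (-β)) * J) := by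
    intro x hx y hy
    rcases le_total x y with hxy | hxy
    · exact key x hx y hy hxy
    · rw [← neg_sub, neg_sq]; exact key y hy x hx hxy
  calc setOsc (powMeasure β) g (Set.Ioc a b) (Set.Ioc a b)
      ≤ ∫⁻ x in Set.Ioc a b, ∫⁻ y in Set.Ioc a b,
          ENNReal.ofReal (b - a) * (ENNReal.ofReal (4 ^ |β| * b ^ (-β)) * J)
            ∂powMeasure β ∂powMeasure β :=
        setLIntegral_mono' measurableSet_Ioc fun x hx =>
          setLIntegral_mono' measurableSet_Ioc fun y hy => key' x hx y hy
    _ = ENNReal.ofReal (b - a) * (ENNReal.ofReal (4 ^ |β| * b ^ (-β)) * J) * W * W := by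
        simp [hW]
    _ ≤ ENNReal.ofReal (b - a) * (ENNReal.ofReal (4 ^ |β| * b ^ (-β)) * J) *
          ENNReal.ofReal (C * ((b - a) * b ^ (β - 1))) * W := by
        gcongr
        exact (H2 a b h).2
    _ = ENNReal.ofReal (b - a) * ENNReal.ofReal (4 ^ |β| * b ^ (-β)) *
          ENNReal.ofReal (C * ((b - a) * b ^ (β - 1))) * W * J := by ring
    _ = _ := by
        rw [← ENNReal.ofReal_mul (by positivity), ← ENNReal.ofReal_mul (by positivity)]
        congr 3
        rw [Real.rpow_neg hb.le, Real.rpow_sub_one hb.ne']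
        have := Real.rpow_pos_of_pos hb β
        field_simp

/-- A Hardy argument with the weight `h t = t^(1 + β/2)`. The tail integral of `1/h` beyond `x` is
`(2/β) x^(-β/2)`, still integrable against `x^(β-1)` at `0` for every `β > 0`. After exchanging the
integrals, the integral of `x^(β/2 - 1)` over `x < t` restores `t^(β/2)`, and `t^(1+β) ≤ b · t ·
t^(β-1)` produces the factor `b`. -/
theorem setOsc_cell_le_of_zero {β : ℝ} (hβ : 0 < β) {b : ℝ} (hb : 0 < b) {g g' : ℝ → ℝ}
    (hgm' : Measurable g') (hg : ∀ t ∈ Set.Ioc 0 b, HasDerivAt g (g' t) t)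
    (hg' : ContinuousOn g' (Set.Ioc 0 b)) :
    setOsc (powMeasure β) g (Set.Ioc 0 b) (Set.Ioc 0 b) ≤
      ENNReal.ofReal (8 / β ^ 2 * b) * powMeasure β (Set.Ioc 0 b) *
        ∫⁻ t in Set.Ioc 0 b, ENNReal.ofReal (t * g' t ^ 2) ∂powMeasure β := by
  have hβ2 : 0 < β / 2 := by linarith
  have h0 : Set.Ioc 0 b ⊆ Set.Ioi (0 : ℝ) := fun t ht => ht.1
  set W := powMeasure β (Set.Ioc 0 b) with hW
  set J := ∫⁻ t in Set.Ioc 0 b, ENNReal.ofReal (t * g' t ^ 2) ∂powMeasure β with hJ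
  set Φ : ℝ → ℝ≥0∞ := fun t => ENNReal.ofReal (t ^ (1 + β / 2) * g' t ^ 2)
  have hΦ : Measurable Φ := by fun_prop
  set K : ℝ → ℝ → ℝ≥0∞ := fun x t => (Set.Ioi x).indicator Φ t
  have hK : Measurable (Function.uncurry K) := by
    have : Function.uncurry K = {p : ℝ × ℝ | p.1 < p.2}.indicator fun p => Φ p.2 := by
      ext ⟨x, t⟩
      simp only [Function.uncurry, K, Set.indicator, Set.mem_Ioi, Set.mem_ofPred_eq]
    rw [this]
    exact (hΦ.comp measurable_snd).indicator (measurableSet_lt measurable_fst measurable_snd)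
  set H : ℝ → ℝ≥0∞ := fun x =>
    ENNReal.ofReal (x ^ (-(β / 2)) / (β / 2)) * ∫⁻ t in Set.Ioc 0 b, K x t with hH
  have hHm : Measurable H := by
    refine Measurable.mul (by fun_prop) ?_
    exact Measurable.lintegral_prod_right (ν := volume.restrict (Set.Ioc 0 b)) hK
  have key : ∀ x ∈ Set.Ioc 0 b, ∀ y ∈ Set.Ioc 0 b, x ≤ y →
      ENNReal.ofReal ((g y - g x) ^ 2) ≤ H x := by
    intro x hx y hy hxy
    have hsub : Set.Icc x y ⊆ Set.Ioc 0 b := fun t ht => ⟨hx.1.trans_le ht.1, ht.2.trans hy.2⟩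
    refine (ofReal_sq_sub_le_lintegral_mul (h := fun t => t ^ (1 + β / 2)) hxy
      (fun t ht => hg t (hsub ht)) (hg'.mono hsub) hgm'
      (fun t ht => Real.rpow_pos_of_pos (hx.1.trans ht.1) _) (by fun_prop)).trans ?_
    refine mul_le_mul' (lintegral_rpow_Ioc_le hβ2 hx.1) ?_
    rw [setLIntegral_indicator measurableSet_Ioi]
    exact lintegral_mono_set fun t ht => ⟨ht.1, hsub (Set.Ioc_subset_Icc_self ht)⟩
  -- The bound by `H` uses only the smaller of the two points; adding both values makes it
  -- symmetric.
  have key' : ∀ x ∈ Set.Ioc 0 b, ∀ y ∈ Set.Ioc 0 b,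
      ENNReal.ofReal ((g y - g x) ^ 2) ≤ H x + H y := by
    intro x hx y hy
    rcases le_total x y with hxy | hxy
    · exact (key x hx y hy hxy).trans le_self_add
    · rw [← neg_sub, neg_sq]; exact (key y hy x hx hxy).trans le_add_self
  have hHJ : ∫⁻ x in Set.Ioc 0 b, H x ∂powMeasure β ≤ ENNReal.ofReal (4 / β ^ 2 * b) * J := by
    rw [setLIntegral_powMeasure β measurableSet_Ioc h0]
    calc ∫⁻ x in Set.Ioc 0 b, ENNReal.ofReal (x ^ (β - 1)) * H x
        = ∫⁻ x in Set.Ioc 0 b, ∫⁻ t in Set.Ioc 0 b,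
            ENNReal.ofReal (x ^ (β / 2 - 1) / (β / 2)) * K x t := by
          refine setLIntegral_congr_fun measurableSet_Ioc fun x hx => ?_
          have hx0 : 0 < x := hx.1
          rw [lintegral_const_mul _ (by exact hK.of_uncurry_left), hH, ← mul_assoc,
            ← ENNReal.ofReal_mul (by positivity)]
          congr 2
          rw [← mul_div_assoc, ← Real.rpow_add hx0]
          congr 2
          ring
      _ = ∫⁻ t in Set.Ioc 0 b, ∫⁻ x in Set.Ioc 0 b,
            ENNReal.ofReal (x ^ (β / 2 - 1) / (β / 2)) * K x t := by
          refine lintegral_lintegral_swap (Measurable.aemeasurable ?_)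
          exact (Measurable.comp (g := fun x : ℝ => ENNReal.ofReal (x ^ (β / 2 - 1) / (β / 2)))
            (by fun_prop) measurable_fst).mul hK
      _ ≤ ∫⁻ t in Set.Ioc 0 b, ENNReal.ofReal (4 / β ^ 2 * b) *
            (ENNReal.ofReal (t ^ (β - 1)) * ENNReal.ofReal (t * g' t ^ 2)) := by
          refine setLIntegral_mono' measurableSet_Ioc fun t ht => ?_
          have ht0 : 0 < t := ht.1
          calc ∫⁻ x in Set.Ioc 0 b, ENNReal.ofReal (x ^ (β / 2 - 1) / (β / 2)) * K x t
              = ∫⁻ x in Set.Ioc 0 b, (Set.Iio t).indicator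
                  (fun x => ENNReal.ofReal ((β / 2)⁻¹) * Φ t * ENNReal.ofReal (x ^ (β / 2 - 1)))
                  x := by
                refine lintegral_congr fun x => ?_
                by_cases hxt : x < t
                · simp only [K, Set.indicator, Set.mem_Ioi, Set.mem_Iio, hxt, if_true]
                  rw [div_eq_inv_mul, ENNReal.ofReal_mul (by positivity)]
                  ring
                · simp [K, Set.indicator, hxt]
            _ ≤ ∫⁻ x in Set.Ioc 0 t,
                  ENNReal.ofReal ((β / 2)⁻¹) * Φ t * ENNReal.ofReal (x ^ (β / 2 - 1)) := by
                rw [setLIntegral_indicator measurableSet_Iio]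
                exact lintegral_mono_set fun x hx => ⟨hx.2.1, le_of_lt hx.1⟩
            _ = ENNReal.ofReal ((β / 2)⁻¹) * Φ t * ENNReal.ofReal (t ^ (β / 2) / (β / 2)) := by
                rw [lintegral_const_mul _ (measurable_ofReal_rpow _),
                  ← powMeasure_apply _ measurableSet_Ioc fun x hx => hx.1,
                  powMeasure_Ioc_zero hβ2 ht0.le]
            _ ≤ _ := by
                simp only [Φ]
                rw [← ENNReal.ofReal_mul (by positivity), ← ENNReal.ofReal_mul (by positivity),
                  ← ENNReal.ofReal_mul (by positivity), ← ENNReal.ofReal_mul (by positivity)]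
                refine ENNReal.ofReal_le_ofReal ?_
                have e1 : t ^ (1 + β / 2) * t ^ (β / 2) = t * t * t ^ (β - 1) := by
                  rw [← Real.rpow_add ht0, show 1 + β / 2 + β / 2 = (β - 1) + 1 + 1 by ring,
                    Real.rpow_add_one ht0.ne', Real.rpow_add_one ht0.ne']
                  ring
                calc _ = 4 / β ^ 2 * (t ^ (1 + β / 2) * t ^ (β / 2)) * g' t ^ 2 := by
                      field_simp; ring
                  _ = 4 / β ^ 2 * t * (t ^ (β - 1) * (t * g' t ^ 2)) := by rw [e1]; ring
                  _ ≤ _ := by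
                      have := ht.2
                      gcongr
      _ = _ := by
          rw [lintegral_const_mul _ (by fun_prop), hJ,
            setLIntegral_powMeasure β measurableSet_Ioc h0]
  calc setOsc (powMeasure β) g (Set.Ioc 0 b) (Set.Ioc 0 b)
      ≤ ∫⁻ x in Set.Ioc 0 b, ∫⁻ y in Set.Ioc 0 b, (H x + H y) ∂powMeasure β ∂powMeasure β :=
        setLIntegral_mono' measurableSet_Ioc fun x hx =>
          setLIntegral_mono' measurableSet_Ioc fun y hy => key' x hx y hy
    _ = 2 * W * ∫⁻ x in Set.Ioc 0 b, H x ∂powMeasure β := by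
        simp_rw [lintegral_add_right _ hHm]
        rw [lintegral_add_right _ measurable_const]
        simp only [setLIntegral_const, ← hW]
        rw [lintegral_mul_const _ hHm]
        ring
    _ ≤ 2 * W * (ENNReal.ofReal (4 / β ^ 2 * b) * J) := by gcongr
    _ = _ := by
        rw [show 8 / β ^ 2 * b = 2 * (4 / β ^ 2 * b) by ring,
          ENNReal.ofReal_mul (p := 2) (by norm_num), ENNReal.ofReal_ofNat]
        ring

/-- The weighted Poincaré inequality on a cell. -/
theorem exists_setOsc_cell_le {β : ℝ} (hβ : 0 < β) :
    ∃ C : ℝ, 0 < C ∧ ∀ a b, IsCell a b → ∀ g g' : ℝ → ℝ, Measurable g' →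
      (∀ t ∈ Set.Ioc a b, HasDerivAt g (g' t) t) → ContinuousOn g' (Set.Ioc a b) →
      setOsc (powMeasure β) g (Set.Ioc a b) (Set.Ioc a b) ≤
        ENNReal.ofReal (C * ((b - a) ^ 2 / b)) * powMeasure β (Set.Ioc a b) *
          ∫⁻ t in Set.Ioc a b, ENNReal.ofReal (t * g' t ^ 2) ∂powMeasure β := by
  obtain ⟨C, hC, H⟩ := setOsc_cell_le_of_scale hβ
  refine ⟨max C (8 / β ^ 2), lt_max_of_lt_left hC, fun a b h g g' hgm' hg hg' => ?_⟩
  have hb := h.pos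
  rcases h.scale with rfl | hs
  · refine (setOsc_cell_le_of_zero hβ hb hgm' hg hg').trans ?_
    gcongr
    · exact le_max_right _ _
    · rw [sub_zero, sq, mul_div_assoc, div_self hb.ne', mul_one]
  · refine (H a b h hs g g' hgm' hg hg').trans ?_
    gcongr
    exact le_max_left _ _

/-! ### Poincaré inequality on a box for the degenerate form -/

section Box

variable {ι : Type*} [Fintype ι] [DecidableEq ι]

theorem measurable_sq_sub_update {F : (ι → ℝ) → ℝ} (hF : Measurable F) (j : ι) :
    Measurable fun p : (ι → ℝ) × ℝ =>
      ENNReal.ofReal ((F (Function.update p.1 j p.2) - F p.1) ^ 2) :=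
  (((hF.comp (measurable_update_pair j)).sub (hF.comp measurable_fst)).pow_const 2).ennreal_ofReal

theorem measurable_lintegral_sq_sub_update (ν : Measure ℝ) [SFinite ν] {F : (ι → ℝ) → ℝ}
    (hF : Measurable F) (j : ι) :
    Measurable fun x : ι → ℝ =>
      ∫⁻ t, ENNReal.ofReal ((F (Function.update x j t) - F x) ^ 2) ∂ν :=
  (measurable_sq_sub_update hF j).lintegral_prod_right'

/-- Resampling coordinate `j` preserves the law and does not change `φ`, so the one-dimensional
inequality along lines can be integrated over the other coordinates with any such weight. It is
applied with `φ = 1` for `j = i`, and with `φ = x_i` for `j ≠ i`. -/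
theorem lintegral_mul_coordOsc_le (ρ : ι → Measure ℝ) [∀ j, IsProbabilityMeasure (ρ j)]
    {F G : (ι → ℝ) → ℝ} (hF : Measurable F) (hG : Measurable G) (j : ι) {K : ℝ≥0∞}
    (hK : ∀ᵐ x ∂Measure.pi ρ, ∫⁻ s, ∫⁻ t, ENNReal.ofReal
      ((F (Function.update x j t) - F (Function.update x j s)) ^ 2) ∂ρ j ∂ρ j ≤
        K * ∫⁻ s, ENNReal.ofReal (s * G (Function.update x j s) ^ 2) ∂ρ j)
    {φ : (ι → ℝ) → ℝ≥0∞} (hφ : Measurable φ) (hφj : ∀ x s, φ (Function.update x j s) = φ x) :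
    ∫⁻ x, φ x * ∫⁻ t, ENNReal.ofReal ((F (Function.update x j t) - F x) ^ 2) ∂ρ j ∂Measure.pi ρ ≤
      K * ∫⁻ x, φ x * ENNReal.ofReal (x j * G x ^ 2) ∂Measure.pi ρ := by
  have hm := measurable_lintegral_sq_sub_update (ρ j) hF j
  have hu : ∀ x : ι → ℝ, Measurable fun s => Function.update x j s := fun x =>
    (measurable_update_pair j).comp (measurable_const.prodMk measurable_id)
  have hmu : ∀ x : ι → ℝ, Measurable fun s => ∫⁻ t, ENNReal.ofReal
      ((F (Function.update x j t) - F (Function.update x j s)) ^ 2) ∂ρ j := by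
    intro x
    have := hm.comp (hu x)
    simpa [Function.comp_def, Function.update_idem] using this
  have hG2 : Measurable fun x : ι → ℝ => ENNReal.ofReal (x j * G x ^ 2) := by fun_prop
  have hGu : ∀ x : ι → ℝ, Measurable fun s => ENNReal.ofReal (s * G (Function.update x j s) ^ 2) :=
    fun x => by simpa [Function.comp_def] using hG2.comp (hu x)
  have hGm : Measurable fun x : ι → ℝ =>
      ∫⁻ s, ENNReal.ofReal (s * G (Function.update x j s) ^ 2) ∂ρ j := by
    have : Measurable fun p : (ι → ℝ) × ℝ =>
        ENNReal.ofReal (p.2 * G (Function.update p.1 j p.2) ^ 2) :=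
      (measurable_snd.mul ((hG.comp (measurable_update_pair j)).pow_const 2)).ennreal_ofReal
    exact this.lintegral_prod_right'
  rw [← lintegral_pi_update ρ j (H := fun x => φ x *
      ∫⁻ t, ENNReal.ofReal ((F (Function.update x j t) - F x) ^ 2) ∂ρ j) (hφ.mul hm),
    ← lintegral_pi_update ρ j (H := fun x => φ x * ENNReal.ofReal (x j * G x ^ 2)) (hφ.mul hG2)]
  simp only [hφj, Function.update_idem, Function.update_self]
  calc _ = ∫⁻ x, φ x * ∫⁻ s, ∫⁻ t, ENNReal.ofReal
          ((F (Function.update x j t) - F (Function.update x j s)) ^ 2) ∂ρ j ∂ρ j ∂Measure.pi ρ :=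
        lintegral_congr fun x => lintegral_const_mul _ (hmu x)
    _ ≤ ∫⁻ x, φ x * (K * ∫⁻ s, ENNReal.ofReal (s * G (Function.update x j s) ^ 2) ∂ρ j)
          ∂Measure.pi ρ := by
        refine lintegral_mono_ae ?_
        filter_upwards [hK] with x hx
        gcongr
    _ = K * ∫⁻ x, φ x * ∫⁻ s, ENNReal.ofReal (s * G (Function.update x j s) ^ 2) ∂ρ j
          ∂Measure.pi ρ := by
        rw [← lintegral_const_mul _ (by exact hφ.mul hGm)]
        exact lintegral_congr fun x => by ring
    _ = _ := by
        congr 1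
        exact lintegral_congr fun x => (lintegral_const_mul _ (hGu x)).symm

/-- The oscillation in one direction is controlled by a weighted oscillation in this direction and
the oscillation in the direction of the weight. -/
theorem lintegral_mul_coordOsc_le_add (ρ : ι → Measure ℝ) [∀ j, IsProbabilityMeasure (ρ j)]
    {F : (ι → ℝ) → ℝ} (hF : Measurable F) {i j : ι} (hij : j ≠ i) {B : ℝ≥0∞}
    (hB : ∀ᵐ s ∂ρ i, ENNReal.ofReal s ≤ B) :
    (∫⁻ s, ENNReal.ofReal s ∂ρ i) * coordOsc ρ F j ≤ 6 * (B * coordOsc ρ F i) +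
      4 * ∫⁻ x, ENNReal.ofReal (x i) *
        ∫⁻ t, ENNReal.ofReal ((F (Function.update x j t) - F x) ^ 2) ∂ρ j ∂Measure.pi ρ := by
  set Hj : (ι → ℝ) → ℝ≥0∞ := fun x =>
    ∫⁻ t, ENNReal.ofReal ((F (Function.update x j t) - F x) ^ 2) ∂ρ j with hHj
  obtain ⟨L, hL⟩ : ∃ L : (ι → ℝ) → ℝ → ℝ≥0∞, L = fun x s =>
    ENNReal.ofReal ((F (Function.update x i s) - F x) ^ 2) := ⟨_, rfl⟩
  set Hi : (ι → ℝ) → ℝ≥0∞ := fun x => ∫⁻ s, L x s ∂ρ i with hHi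
  have hHjm : Measurable Hj := measurable_lintegral_sq_sub_update (ρ j) hF j
  have hLm : Measurable fun p : (ι → ℝ) × ℝ => L p.1 p.2 := by
    rw [hL]
    exact measurable_sq_sub_update hF i
  have hHim : Measurable Hi := hLm.lintegral_prod_right'
  have hu : ∀ (k : ι) (x : ι → ℝ), Measurable fun s => Function.update x k s := fun k x =>
    (measurable_update_pair k).comp (measurable_const.prodMk measurable_id)
  have hLu : ∀ x : ι → ℝ, Measurable fun p : ℝ × ℝ => L (Function.update x j p.2) p.1 := by
    intro x
    have : Measurable fun p : ℝ × ℝ => (Function.update x j p.2, p.1) :=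
      ((hu j x).comp measurable_snd).prodMk measurable_fst
    exact hLm.comp this
  -- Instead of moving coordinate `j` directly at height `x i`, move `i` to `s`, then `j`, then `i`
  -- back. Splitting the three legs with `(a + b)² ≤ 2a² + 2b²` twice gives the factors 2, 4, 4.
  have pt : ∀ x s, Hj x ≤ 2 * (∫⁻ t, L (Function.update x j t) s ∂ρ j) +
      (4 * Hj (Function.update x i s) + 4 * L x s) := by
    intro x s
    have m1 : Measurable fun t => L (Function.update x j t) s :=
      (hLu x).comp ((measurable_const (a := s)).prodMk measurable_id)
    have m2 : Measurable fun t => ENNReal.ofReal ((F (Function.update (Function.update x i s) j t) -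
        F (Function.update x i s)) ^ 2) :=
      (((hF.comp (hu j (Function.update x i s))).sub_const
        (F (Function.update x i s))).pow_const 2).ennreal_ofReal
    calc Hj x ≤ ∫⁻ t, (2 * L (Function.update x j t) s + (4 * ENNReal.ofReal
          ((F (Function.update (Function.update x i s) j t) - F (Function.update x i s)) ^ 2) +
            4 * L x s)) ∂ρ j := by
          refine lintegral_mono fun t => ?_
          simp only [hL]
          rw [Function.update_comm hij.symm]
          refine (ofReal_sq_sub_le _ (F (Function.update (Function.update x j t) i s)) _).trans ?_
          rw [← neg_sub (F (Function.update x j t)), neg_sq]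
          gcongr
          refine (mul_le_mul_right (ofReal_sq_sub_le _ (F (Function.update x i s)) _) 2).trans ?_
          rw [mul_add, ← mul_assoc, ← mul_assoc]
          norm_num
      _ = _ := by
          rw [lintegral_add_left (m1.const_mul 2), lintegral_add_right _ measurable_const,
            lintegral_const_mul _ m1, lintegral_const_mul _ m2]
          simp [hHj]
  have hid : Measurable fun s : ℝ => ENNReal.ofReal s := ENNReal.measurable_ofReal
  -- Average over `s` with weight `s`. The two legs in direction `i` only need `s ≤ B`, while the
  -- leg in direction `j` keeps the weight that the form provides.
  have pt2 : ∀ x, (∫⁻ s, ENNReal.ofReal s ∂ρ i) * Hj x ≤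
      2 * (B * ∫⁻ t, Hi (Function.update x j t) ∂ρ j) +
      (4 * (∫⁻ s, ENNReal.ofReal s * Hj (Function.update x i s) ∂ρ i) + 4 * (B * Hi x)) := by
    intro x
    have m1 : Measurable fun s => ∫⁻ t, L (Function.update x j t) s ∂ρ j :=
      (hLu x).lintegral_prod_right'
    have m2 : Measurable fun s => ENNReal.ofReal s * Hj (Function.update x i s) :=
      hid.mul (hHjm.comp (hu i x))
    have m3 : Measurable (L x) :=
      hLm.comp ((measurable_const (a := x)).prodMk measurable_id)
    rw [← lintegral_mul_const _ hid]
    calc _ ≤ ∫⁻ s, (2 * (B * ∫⁻ t, L (Function.update x j t) s ∂ρ j) +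
          (4 * (ENNReal.ofReal s * Hj (Function.update x i s)) + 4 * (B * L x s))) ∂ρ i := by
          refine lintegral_mono_ae ?_
          filter_upwards [hB] with s hs
          calc _ ≤ ENNReal.ofReal s * (2 * (∫⁻ t, L (Function.update x j t) s ∂ρ j) +
                (4 * Hj (Function.update x i s) + 4 * L x s)) := by gcongr; exact pt x s
            _ = 2 * (ENNReal.ofReal s * ∫⁻ t, L (Function.update x j t) s ∂ρ j) +
                (4 * (ENNReal.ofReal s * Hj (Function.update x i s)) +
                  4 * (ENNReal.ofReal s * L x s)) := by ring
            _ ≤ _ := by gcongr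
      _ = _ := by
          rw [lintegral_add_left ((m1.const_mul _).const_mul _), lintegral_add_left
            (m2.const_mul _), lintegral_const_mul _ (m1.const_mul _), lintegral_const_mul _ m1,
            lintegral_const_mul _ m2, lintegral_const_mul _ (m3.const_mul _),
            lintegral_const_mul _ m3, lintegral_lintegral_swap (hLu x).aemeasurable]
  have n1 : Measurable fun x => ∫⁻ t, Hi (Function.update x j t) ∂ρ j :=
    Measurable.lintegral_prod_right' (f := fun p : (ι → ℝ) × ℝ => Hi (Function.update p.1 j p.2))
      (hHim.comp (measurable_update_pair j))
  have n2 : Measurable fun x => ∫⁻ s, ENNReal.ofReal s * Hj (Function.update x i s) ∂ρ i :=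
    Measurable.lintegral_prod_right'
      (f := fun p : (ι → ℝ) × ℝ => ENNReal.ofReal p.2 * Hj (Function.update p.1 i p.2))
      ((hid.comp measurable_snd).mul (hHjm.comp (measurable_update_pair i)))
  have hxi : Measurable fun x : ι → ℝ => ENNReal.ofReal (x i) := by fun_prop
  calc (∫⁻ s, ENNReal.ofReal s ∂ρ i) * coordOsc ρ F j
      = ∫⁻ x, (∫⁻ s, ENNReal.ofReal s ∂ρ i) * Hj x ∂Measure.pi ρ := by
        rw [lintegral_const_mul _ hHjm, coordOsc]
    _ ≤ _ := lintegral_mono pt2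
    _ = 2 * (B * ∫⁻ x, Hi x ∂Measure.pi ρ) +
        (4 * (∫⁻ x, ENNReal.ofReal (x i) * Hj x ∂Measure.pi ρ) +
          4 * (B * ∫⁻ x, Hi x ∂Measure.pi ρ)) := by
        rw [lintegral_add_left ((n1.const_mul _).const_mul _), lintegral_add_left
            (n2.const_mul _), lintegral_const_mul _ (n1.const_mul _), lintegral_const_mul _ n1,
            lintegral_const_mul _ n2, lintegral_const_mul _ (hHim.const_mul _),
            lintegral_const_mul _ hHim, lintegral_pi_update ρ j hHim,
            ← lintegral_pi_update ρ i
              (H := fun x => ENNReal.ofReal (x i) * Hj x) (hxi.mul hHjm)]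
        simp
    _ = _ := by
        simp only [coordOsc, hHi, hL]
        ring

/-- The box with lower left corner `a` and upper right corner `b`. -/
def box (a b : ι → ℝ) : Set (ι → ℝ) := Set.univ.pi fun j => Set.Ioc (a j) (b j)

theorem measurableSet_box (a b : ι → ℝ) : MeasurableSet (box a b) :=
  MeasurableSet.univ_pi fun _ => measurableSet_Ioc

/-- The product of the measures `t ^ (β j - 1) dt`. -/
def powPi (β : ι → ℝ) : Measure (ι → ℝ) := Measure.pi fun j => powMeasure (β j)

instance (β : ι → ℝ) : SigmaFinite (powPi β) := by unfold powPi; infer_instance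

theorem powPi_box (β a b : ι → ℝ) :
    powPi β (box a b) = ∏ j, powMeasure (β j) (Set.Ioc (a j) (b j)) := by
  rw [powPi, box, Measure.pi_pi]

/-- The carré du champ `x_i (g_i² + ∑_{j ≠ i} x_j g_j²)`. -/
def chartForm (i : ι) (G : ι → (ι → ℝ) → ℝ) (x : ι → ℝ) : ℝ :=
  x i * G i x ^ 2 + ∑ j ∈ Finset.univ.erase i, x i * (x j * G j x ^ 2)

end Box

section BoxPoincare

variable {ι : Type*} [Fintype ι] [DecidableEq ι]

/-- The normalized restriction of `t ^ (β - 1) dt` to an interval. -/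
def cellProb (β a b : ℝ) : Measure ℝ :=
  (powMeasure β (Set.Ioc a b))⁻¹ • (powMeasure β).restrict (Set.Ioc a b)

theorem isProbabilityMeasure_cellProb {β a b : ℝ} (hβ : 0 < β) (h : IsCell a b) :
    IsProbabilityMeasure (cellProb β a b) :=
  ⟨by simp [cellProb, ENNReal.inv_mul_cancel (powMeasure_cell_ne_zero hβ h)
    (powMeasure_cell_ne_top hβ h)]⟩

theorem exists_cellProb_poincare {β : ℝ} (hβ : 0 < β) :
    ∃ C : ℝ, 0 < C ∧ ∀ a b, IsCell a b → ∀ g g' : ℝ → ℝ, Measurable g' →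
      (∀ t ∈ Set.Ioc a b, HasDerivAt g (g' t) t) → ContinuousOn g' (Set.Ioc a b) →
      ∫⁻ s, ∫⁻ t, ENNReal.ofReal ((g t - g s) ^ 2) ∂cellProb β a b ∂cellProb β a b ≤
        ENNReal.ofReal (C * ((b - a) ^ 2 / b)) *
          ∫⁻ s, ENNReal.ofReal (s * g' s ^ 2) ∂cellProb β a b := by
  obtain ⟨C, hC, H⟩ := exists_setOsc_cell_le hβ
  refine ⟨C, hC, fun a b h g g' hgm hg hg' => ?_⟩
  have hW0 := powMeasure_cell_ne_zero hβ h
  have hWt := powMeasure_cell_ne_top hβ h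
  have key := H a b h g g' hgm hg hg'
  simp only [cellProb, lintegral_smul_measure, smul_eq_mul, setOsc] at key ⊢
  set W := powMeasure β (Set.Ioc a b)
  rw [lintegral_const_mul' _ _ (ENNReal.inv_ne_top.2 hW0)]
  calc _ ≤ W⁻¹ * (W⁻¹ * (ENNReal.ofReal (C * ((b - a) ^ 2 / b)) * W *
          ∫⁻ t in Set.Ioc a b, ENNReal.ofReal (t * g' t ^ 2) ∂powMeasure β)) := by gcongr
    _ = (W⁻¹ * W) * (ENNReal.ofReal (C * ((b - a) ^ 2 / b)) *
          (W⁻¹ * ∫⁻ t in Set.Ioc a b, ENNReal.ofReal (t * g' t ^ 2) ∂powMeasure β)) := by ring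
    _ = _ := by rw [ENNReal.inv_mul_cancel hW0 hWt, one_mul]

theorem exists_le_lintegral_cellProb {β : ℝ} (hβ : 0 < β) :
    ∃ c : ℝ, 0 < c ∧ ∀ a b, IsCell a b →
      ENNReal.ofReal (c * b) ≤ ∫⁻ t, ENNReal.ofReal t ∂cellProb β a b := by
  obtain ⟨c, hc, H⟩ := exists_le_lintegral_id_cell hβ
  refine ⟨c, hc, fun a b h => ?_⟩
  have hW0 := powMeasure_cell_ne_zero hβ h
  have hWt := powMeasure_cell_ne_top hβ h
  simp only [cellProb, lintegral_smul_measure, smul_eq_mul]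
  rw [← ENNReal.div_eq_inv_mul, ENNReal.le_div_iff_mul_le (Or.inl hW0) (Or.inl hWt)]
  exact H a b h

theorem powPi_restrict_box {β a b : ι → ℝ} (hβ : ∀ j, 0 < β j) (h : ∀ j, IsCell (a j) (b j)) :
    (powPi β).restrict (box a b) =
      powPi β (box a b) • Measure.pi fun j => cellProb (β j) (a j) (b j) := by
  have := fun j => isProbabilityMeasure_cellProb (hβ j) (h j)
  have e : Measure.pi (fun j => cellProb (β j) (a j) (b j)) =
      (∏ j, (powMeasure (β j) (Set.Ioc (a j) (b j)))⁻¹) • (powPi β).restrict (box a b) := by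
    rw [powPi, box, Measure.restrict_pi_pi]
    have : ∀ j, SigmaFinite ((powMeasure (β j) (Set.Ioc (a j) (b j)))⁻¹ •
        (powMeasure (β j)).restrict (Set.Ioc (a j) (b j))) := fun j => by
      change SigmaFinite (cellProb (β j) (a j) (b j))
      infer_instance
    exact pi_smul (fun j => (powMeasure (β j)).restrict (Set.Ioc (a j) (b j))) _
  rw [e, smul_smul, powPi_box, ← Finset.prod_mul_distrib]
  rw [Finset.prod_congr rfl fun j _ => ENNReal.mul_inv_cancel
    (powMeasure_cell_ne_zero (hβ j) (h j)) (powMeasure_cell_ne_top (hβ j) (h j))]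
  simp

theorem powPi_box_ne_zero {β a b : ι → ℝ} (hβ : ∀ j, 0 < β j) (h : ∀ j, IsCell (a j) (b j)) :
    powPi β (box a b) ≠ 0 := by
  rw [powPi_box]
  exact Finset.prod_ne_zero_iff.2 fun j _ => powMeasure_cell_ne_zero (hβ j) (h j)

theorem powPi_box_ne_top {β a b : ι → ℝ} (hβ : ∀ j, 0 < β j) (h : ∀ j, IsCell (a j) (b j)) :
    powPi β (box a b) ≠ ∞ := by
  rw [powPi_box]
  exact ENNReal.prod_ne_top fun j _ => powMeasure_cell_ne_top (hβ j) (h j)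

theorem update_mem_box {a b x : ι → ℝ} (hx : x ∈ box a b) {j : ι} {t : ℝ}
    (ht : t ∈ Set.Ioc (a j) (b j)) : Function.update x j t ∈ box a b := by
  intro k _
  rcases eq_or_ne k j with rfl | hk
  · simpa using ht
  · simpa [hk] using hx k trivial

/-- The Poincaré inequality for the carré du champ `chartForm` on a box whose sides are cells. -/
theorem exists_setOsc_box_le {β : ι → ℝ} (hβ : ∀ j, 0 < β j) (i : ι) :
    ∃ C : ℝ, 0 < C ∧ ∀ a b : ι → ℝ, (∀ j, IsCell (a j) (b j)) → ∀ R : ℝ, 0 ≤ R →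
      (b i - a i) ^ 2 / b i ≤ R → (∀ j, j ≠ i → (b j - a j) ^ 2 / b j ≤ R * b i) →
      ∀ (F : (ι → ℝ) → ℝ) (G : ι → (ι → ℝ) → ℝ), Measurable F → (∀ j, Measurable (G j)) →
      (∀ x ∈ box a b, ∀ j, HasDerivAt (fun t => F (Function.update x j t)) (G j x) (x j)) →
      (∀ x ∈ box a b, ∀ j,
        ContinuousOn (fun t => G j (Function.update x j t)) (Set.Ioc (a j) (b j))) →
      setOsc (powPi β) F (box a b) (box a b) ≤ ENNReal.ofReal (C * R) * powPi β (box a b) *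
        ∫⁻ x in box a b, ENNReal.ofReal (chartForm i G x) ∂powPi β := by
  choose C hC H1 using fun j => exists_cellProb_poincare (hβ j)
  obtain ⟨c, hc, H2⟩ := exists_le_lintegral_cellProb (hβ i)
  set M : ℝ := ∑ j, C j
  have hM : 0 < M := Finset.sum_pos (fun j _ => hC j) ⟨i, Finset.mem_univ i⟩
  have hCM : ∀ j, C j ≤ M := fun j =>
    Finset.single_le_sum (fun j _ => (hC j).le) (Finset.mem_univ j)
  refine ⟨2 ^ Fintype.card ι * (Fintype.card ι * (M + 10 * M / c)), ?_, ?_⟩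
  · have : 0 < Fintype.card ι := Fintype.card_pos_iff.2 ⟨i⟩
    positivity
  intro a b h R hR hRi hRj F G hF hG hder hcont
  have hprob := fun j => isProbabilityMeasure_cellProb (hβ j) (h j)
  have hbi := (h i).pos
  set ρ : ι → Measure ℝ := fun j => cellProb (β j) (a j) (b j) with hρ
  set P := Measure.pi ρ with hP
  set W := powPi β (box a b) with hW
  have hres := powPi_restrict_box hβ h
  rw [← hρ, ← hP, ← hW] at hres
  have hW0 : W ≠ 0 := powPi_box_ne_zero hβ h
  have hWt : W ≠ ∞ := powPi_box_ne_top hβ h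
  set Q := ∫⁻ x, ENNReal.ofReal (chartForm i G x) ∂P with hQ
  have hbox : ∀ᵐ x ∂P, x ∈ box a b := by
    have : P = W⁻¹ • (powPi β).restrict (box a b) := by
      rw [hres, smul_smul, ENNReal.inv_mul_cancel hW0 hWt, one_smul]
    rw [this]
    exact Measure.ae_smul_measure (ae_restrict_mem (measurableSet_box a b)) _
  have hpos : ∀ x ∈ box a b, ∀ j, 0 < x j := fun x hx j => (h j).subset (hx j trivial)
  have h1D : ∀ j, ∀ᵐ x ∂P, ∫⁻ s, ∫⁻ t, ENNReal.ofReal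
      ((F (Function.update x j t) - F (Function.update x j s)) ^ 2) ∂ρ j ∂ρ j ≤
        ENNReal.ofReal (C j * ((b j - a j) ^ 2 / b j)) *
          ∫⁻ s, ENNReal.ofReal (s * G j (Function.update x j s) ^ 2) ∂ρ j := by
    intro j
    filter_upwards [hbox] with x hx
    refine H1 j (a j) (b j) (h j) (fun t => F (Function.update x j t))
      (fun t => G j (Function.update x j t)) ?_ (fun t ht => ?_) (hcont x hx j)
    · exact (hG j).comp ((measurable_update_pair j).comp (measurable_const.prodMk measurable_id))
    · have := hder _ (update_mem_box hx ht) j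
      simpa using this
  have hsummand : ∀ x ∈ box a b, ∀ j, 0 ≤ x i * (x j * G j x ^ 2) := fun x hx j => by
    have := hpos x hx i
    have := hpos x hx j
    positivity
  have hoi : coordOsc ρ F i ≤ ENNReal.ofReal (M * R) * Q := by
    have := lintegral_mul_coordOsc_le ρ hF (hG i) i (h1D i) (φ := fun _ => 1) measurable_const
      fun _ _ => rfl
    simp only [one_mul] at this
    refine this.trans ?_
    gcongr
    · exact hCM i
    · refine lintegral_mono_ae ?_
      filter_upwards [hbox] with x hx
      refine ENNReal.ofReal_le_ofReal ?_
      exact le_add_of_nonneg_right (Finset.sum_nonneg fun j _ => hsummand x hx j)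
  have hoj : ∀ j, coordOsc ρ F j ≤ ENNReal.ofReal ((M + 10 * M / c) * R) * Q := by
    intro j
    rcases eq_or_ne j i with rfl | hj
    · refine hoi.trans ?_
      gcongr
      have : 0 ≤ 10 * M / c := by positivity
      linarith
    have hB : ∀ᵐ s ∂ρ i, ENNReal.ofReal s ≤ ENNReal.ofReal (b i) := by
      refine Measure.ae_smul_measure ?_ _
      filter_upwards [ae_restrict_mem measurableSet_Ioc] with s hs
      exact ENNReal.ofReal_le_ofReal hs.2
    have e1 := lintegral_mul_coordOsc_le_add ρ hF hj hB
    have e2 := lintegral_mul_coordOsc_le ρ hF (hG j) j (h1D j)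
      (φ := fun x => ENNReal.ofReal (x i)) (by fun_prop)
      fun x s => by rw [Function.update_of_ne hj.symm]
    have e3 : ∫⁻ x, ENNReal.ofReal (x i) * ENNReal.ofReal (x j * G j x ^ 2) ∂P ≤ Q := by
      refine lintegral_mono_ae ?_
      filter_upwards [hbox] with x hx
      have := hpos x hx i
      rw [← ENNReal.ofReal_mul this.le]
      refine ENNReal.ofReal_le_ofReal ?_
      refine le_trans ?_ (le_add_of_nonneg_left (by positivity))
      exact Finset.single_le_sum (f := fun j => x i * (x j * G j x ^ 2))
        (fun j _ => hsummand x hx j) (Finset.mem_erase.2 ⟨hj, Finset.mem_univ j⟩)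
    have e4 : ENNReal.ofReal (C j * ((b j - a j) ^ 2 / b j)) ≤ ENNReal.ofReal (M * (R * b i)) :=
      ENNReal.ofReal_le_ofReal (mul_le_mul (hCM j) (hRj j hj)
        (div_nonneg (sq_nonneg _) (h j).pos.le) hM.le)
    have hcb : ENNReal.ofReal (c * b i) ≠ 0 := (ENNReal.ofReal_pos.2 (by positivity)).ne'
    -- Both terms carry a factor `b i`, from the bound on the weight in one and from the scale
    -- condition `R * b i` in the other. It cancels against the mean of `x i`, which is at least `c
    -- * b i`; the constant is `(6 + 4) M / c`.
    have e5 : ENNReal.ofReal (c * b i) * coordOsc ρ F j ≤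
        ENNReal.ofReal (c * b i) * (ENNReal.ofReal (10 * M / c * R) * Q) := by
      calc _ ≤ _ := by gcongr; exact H2 _ _ (h i)
        _ ≤ _ := e1
        _ ≤ 6 * (ENNReal.ofReal (b i) * (ENNReal.ofReal (M * R) * Q)) +
            4 * (ENNReal.ofReal (M * (R * b i)) * Q) := by
            gcongr
            exact e2.trans (mul_le_mul' e4 e3)
        _ = (ENNReal.ofReal 6 * (ENNReal.ofReal (b i) * ENNReal.ofReal (M * R)) +
            ENNReal.ofReal 4 * ENNReal.ofReal (M * (R * b i))) * Q := by
            rw [ENNReal.ofReal_ofNat, ENNReal.ofReal_ofNat]; ring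
        _ = _ := by
            rw [← ENNReal.ofReal_mul (by positivity), ← ENNReal.ofReal_mul (by positivity),
              ← ENNReal.ofReal_mul (by positivity), ← ENNReal.ofReal_add (by positivity)
              (by positivity), ← mul_assoc (ENNReal.ofReal (c * b i)),
              ← ENNReal.ofReal_mul (by positivity)]
            congr 2
            field_simp
            ring
    refine ((ENNReal.mul_le_mul_iff_right hcb ENNReal.ofReal_ne_top).1 e5).trans ?_
    gcongr
    linarith
  have hfin : ∫⁻ x, ∫⁻ y, ENNReal.ofReal ((F y - F x) ^ 2) ∂P ∂P ≤ ENNReal.ofReal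
      (2 ^ Fintype.card ι * (Fintype.card ι * (M + 10 * M / c)) * R) * Q := by
    refine (lintegral_pi_sq_sub_le ρ hF).trans ?_
    calc _ ≤ (2 : ℝ≥0∞) ^ Fintype.card ι *
          ∑ _j : ι, ENNReal.ofReal ((M + 10 * M / c) * R) * Q := by
          gcongr with j
          exact hoj j
      _ = ENNReal.ofReal (2 ^ Fintype.card ι) * (ENNReal.ofReal (Fintype.card ι) *
          (ENNReal.ofReal ((M + 10 * M / c) * R) * Q)) := by
          rw [ENNReal.ofReal_pow (by norm_num), ENNReal.ofReal_natCast]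
          simp
      _ = _ := by
          rw [← mul_assoc, ← mul_assoc, ← ENNReal.ofReal_mul (by positivity),
            ← ENNReal.ofReal_mul (by positivity)]
          congr 2
          ring
  simp only [setOsc, hres, lintegral_smul_measure, smul_eq_mul]
  rw [lintegral_const_mul' _ _ hWt, mul_assoc, mul_left_comm (ENNReal.ofReal _)]
  refine mul_le_mul_right ?_ W
  rw [← mul_assoc, mul_comm _ W, mul_assoc]
  exact mul_le_mul_right hfin W

end BoxPoincare

/-! ### Functions on the open simplex and the grid in a chart -/

section Chart

variable {ι : Type*} [Fintype ι] [DecidableEq ι]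

/-- The interior of the corner simplex. -/
def openSimplex (ι : Type*) [Fintype ι] : Set (ι → ℝ) := {x | (∀ j, 0 < x j) ∧ ∑ j, x j < 1}

theorem isOpen_openSimplex : IsOpen (openSimplex ι) := by
  have : openSimplex ι = (⋂ j, {x : ι → ℝ | 0 < x j}) ∩ {x | ∑ j, x j < 1} := by
    ext x; simp [openSimplex]
  rw [this]
  exact (isOpen_iInter_of_finite fun j => isOpen_lt continuous_const (continuous_apply j)).inter
    (isOpen_lt (by fun_prop) continuous_const)

/-- The part of the open simplex where `1 - ∑ x_j ≥ c`. -/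
def cornerRegion (ι : Type*) [Fintype ι] (c : ℝ) : Set (ι → ℝ) :=
  {x | (∀ j, 0 < x j) ∧ ∑ j, x j ≤ 1 - c}

theorem cornerRegion_subset {c : ℝ} (hc : 0 < c) : cornerRegion ι c ⊆ openSimplex ι :=
  fun _ hx => ⟨hx.1, hx.2.trans_lt (by linarith)⟩

theorem measurableSet_cornerRegion (c : ℝ) : MeasurableSet (cornerRegion ι c) := by
  have : cornerRegion ι c = (⋂ j, {x : ι → ℝ | 0 < x j}) ∩ {x | ∑ j, x j ≤ 1 - c} := by
    ext x; simp [cornerRegion]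
  rw [this]
  exact (MeasurableSet.iInter fun j =>
    (isOpen_lt continuous_const (continuous_apply j)).measurableSet).inter
    (isClosed_le (by fun_prop) continuous_const).measurableSet

theorem le_one_of_mem_openSimplex {x : ι → ℝ} (hx : x ∈ openSimplex ι) (j : ι) : x j ≤ 1 :=
  (Finset.single_le_sum (fun j _ => (hx.1 j).le) (Finset.mem_univ j)).trans hx.2.le

/-- Measurable functions that are `C¹` on the open simplex. -/
structure IsSmooth (F : (ι → ℝ) → ℝ) : Prop where
  measurable : Measurable F
  contDiffOn : ContDiffOn ℝ 1 F (openSimplex ι)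

/-- The coordinate derivative. -/
def coordDeriv (F : (ι → ℝ) → ℝ) (j : ι) (x : ι → ℝ) : ℝ := fderiv ℝ F x (Pi.single j 1)

theorem measurable_coordDeriv (F : (ι → ℝ) → ℝ) (j : ι) : Measurable (coordDeriv F j) :=
  measurable_fderiv_apply_const ℝ F _

theorem IsSmooth.hasDerivAt {F : (ι → ℝ) → ℝ} (hF : IsSmooth F) {x : ι → ℝ}
    (hx : x ∈ openSimplex ι) (j : ι) :
    HasDerivAt (fun t => F (Function.update x j t)) (coordDeriv F j x) (x j) := by
  have h1 : HasFDerivAt F (fderiv ℝ F x) x :=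
    ((hF.contDiffOn.contDiffAt (isOpen_openSimplex.mem_nhds hx)).differentiableAt
      (by norm_num)).hasFDerivAt
  have h2 := hasDerivAt_update x j (x j)
  have h3 : HasFDerivAt F (fderiv ℝ F x) (Function.update x j (x j)) := by
    rwa [Function.update_eq_self]
  exact h3.comp_hasDerivAt (x j) h2

theorem IsSmooth.continuousOn_coordDeriv {F : (ι → ℝ) → ℝ} (hF : IsSmooth F) (j : ι) :
    ContinuousOn (coordDeriv F j) (openSimplex ι) :=
  (hF.contDiffOn.continuousOn_fderiv_of_isOpen isOpen_openSimplex (by norm_num)).clm_apply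
    continuousOn_const

theorem box_subset_cornerRegion {a b : ι → ℝ} (h : ∀ j, 0 ≤ a j) {c : ℝ}
    (hb : ∑ j, b j ≤ 1 - c) : box a b ⊆ cornerRegion ι c := fun _ hx =>
  ⟨fun j => (h j).trans_lt (hx j trivial).1,
    (Finset.sum_le_sum fun j _ => (hx j trivial).2).trans hb⟩

theorem exists_setOsc_box_le_chartForm {β : ι → ℝ} (hβ : ∀ j, 0 < β j) (i : ι) :
    ∃ C : ℝ, 0 < C ∧ ∀ a b : ι → ℝ, (∀ j, IsCell (a j) (b j)) → ∑ j, b j < 1 →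
      ∀ R : ℝ, 0 ≤ R →
      (b i - a i) ^ 2 / b i ≤ R → (∀ j, j ≠ i → (b j - a j) ^ 2 / b j ≤ R * b i) →
      ∀ F : (ι → ℝ) → ℝ, IsSmooth F →
      setOsc (powPi β) F (box a b) (box a b) ≤ ENNReal.ofReal (C * R) * powPi β (box a b) *
        ∫⁻ x in box a b, ENNReal.ofReal (chartForm i (coordDeriv F) x) ∂powPi β := by
  obtain ⟨C, hC, H⟩ := exists_setOsc_box_le hβ i
  refine ⟨C, hC, fun a b h hb R hR h1 h2 F hF => ?_⟩
  have hsub : box a b ⊆ openSimplex ι := fun x hx =>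
    ⟨fun j => (h j).subset (hx j trivial),
      (Finset.sum_le_sum fun j _ => (hx j trivial).2).trans_lt hb⟩
  refine H a b h R hR h1 h2 F _ hF.measurable (measurable_coordDeriv F)
    (fun x hx j => hF.hasDerivAt (hsub hx) j) fun x hx j => ?_
  have hu : Continuous (Function.update x j) := continuous_const.update j continuous_id
  exact (hF.continuousOn_coordDeriv j).comp hu.continuousOn
    fun t ht => hsub (update_mem_box hx ht)

/-- Integrate `F(x)² ≤ (F(y) - F(x))² + 2 |F(x)| |F(y)|` over `A × A`. An oscillation bound on a box
thus becomes an `L²` bound at the price of the `L¹` norm on the box, without any condition on the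
mean. -/
theorem measure_mul_lintegral_sq_le {X : Type*} [MeasurableSpace X] (μ : Measure X) {F : X → ℝ}
    (hF : Measurable F) (A : Set X) :
    μ A * ∫⁻ x in A, ENNReal.ofReal (F x ^ 2) ∂μ ≤
      setOsc μ F A A + 2 * (∫⁻ x in A, ENNReal.ofReal |F x| ∂μ) ^ 2 := by
  have ha : Measurable fun x => ENNReal.ofReal |F x| := hF.abs.ennreal_ofReal
  have hs : Measurable fun x => ENNReal.ofReal (F x ^ 2) := (hF.pow_const 2).ennreal_ofReal
  set T := ∫⁻ x in A, ENNReal.ofReal |F x| ∂μ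
  have pt : ∀ x y, ENNReal.ofReal (F x ^ 2) ≤ ENNReal.ofReal ((F y - F x) ^ 2) +
      2 * (ENNReal.ofReal |F x| * ENNReal.ofReal |F y|) := by
    intro x y
    rw [← ENNReal.ofReal_mul (abs_nonneg _), ← ENNReal.ofReal_ofNat,
      ← ENNReal.ofReal_mul (by norm_num), ← ENNReal.ofReal_add (by positivity) (by positivity)]
    refine ENNReal.ofReal_le_ofReal ?_
    rw [← abs_mul]
    nlinarith [le_abs_self (F x * F y), sq_nonneg (F y)]
  rw [← lintegral_const_mul _ hs]
  calc _ = ∫⁻ x in A, ∫⁻ _ in A, ENNReal.ofReal (F x ^ 2) ∂μ ∂μ := by simp [mul_comm]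
    _ ≤ ∫⁻ x in A, ∫⁻ y in A, (ENNReal.ofReal ((F y - F x) ^ 2) +
          2 * (ENNReal.ofReal |F x| * ENNReal.ofReal |F y|)) ∂μ ∂μ :=
        lintegral_mono fun x => lintegral_mono fun y => pt x y
    _ = ∫⁻ x in A, ((∫⁻ y in A, ENNReal.ofReal ((F y - F x) ^ 2) ∂μ) +
          2 * (ENNReal.ofReal |F x| * T)) ∂μ := by
        refine lintegral_congr fun x => ?_
        rw [lintegral_add_right _ ((ha.const_mul _).const_mul _),
          lintegral_const_mul _ (ha.const_mul _), lintegral_const_mul _ ha]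
    _ = _ := by
        rw [lintegral_add_right _ ((ha.mul_const _).const_mul _),
          lintegral_const_mul _ (ha.mul_const _), lintegral_mul_const _ ha, sq]
        rfl

/-- The exponent of the growth of the measure of a grid box in the coordinate `j`. -/
def gridExponent (β : ι → ℝ) (i j : ι) : ℝ := if j = i then max 1 (β j) else max 1 (2 * β j)

/-- The grid points: arithmetic in the coordinate `i`, quadratic in the others. -/
def gridPoint (i : ι) (r : ℝ) (k : ι → ℕ) (j : ι) : ℝ :=
  if j = i then k j * r else (k j * r) ^ 2

/-- The grid box with index `k`. -/
def gridBox (i : ι) (r : ℝ) (k : ι → ℕ) : Set (ι → ℝ) :=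
  box (gridPoint i r k) (gridPoint i r (k + 1))

/-- For `k j ≥ 1` consecutive points have ratio at most 2 in the arithmetic direction and at most 4
in the quadratic ones; this is the 4 in `IsCell`. -/
theorem isCell_grid (i : ι) {r : ℝ} (hr : 0 < r) (k : ι → ℕ) (j : ι) :
    IsCell (gridPoint i r k j) (gridPoint i r (k + 1) j) := by
  have hk : (0 : ℝ) ≤ k j := Nat.cast_nonneg _
  by_cases hj : j = i
  · refine ⟨by simp only [gridPoint, hj, if_true]; positivity, ?_, ?_⟩
    · simp [gridPoint, hj]
      nlinarith
    · rcases Nat.eq_zero_or_pos (k j) with h0 | h0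
      · left; subst hj; simp [gridPoint, h0]
      · right
        have : (1 : ℝ) ≤ k j := by exact_mod_cast h0
        simp only [gridPoint, hj, if_true, Pi.add_apply, Pi.one_apply, Nat.cast_add, Nat.cast_one]
        rw [← hj]
        nlinarith
  · refine ⟨by simp only [gridPoint, hj, if_false]; positivity, ?_, ?_⟩
    · simp only [gridPoint, hj, if_false, Pi.add_apply, Pi.one_apply, Nat.cast_add, Nat.cast_one]
      have : 0 ≤ (k j : ℝ) * r := by positivity
      nlinarith
    · rcases Nat.eq_zero_or_pos (k j) with h0 | h0
      · left; simp [gridPoint, hj, h0]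
      · right
        have : (1 : ℝ) ≤ k j := by exact_mod_cast h0
        simp only [gridPoint, hj, if_false, Pi.add_apply, Pi.one_apply, Nat.cast_add, Nat.cast_one]
        have h1 : ((k j : ℝ) + 1) * r ≤ 2 * (k j * r) := by nlinarith
        have h2 : 0 ≤ ((k j : ℝ) + 1) * r := by positivity
        nlinarith

/-- The index of the grid interval that contains a point. -/
def gridIndex (i : ι) (r : ℝ) (x : ι → ℝ) (j : ι) : ℕ :=
  ⌈(if j = i then x j else √(x j)) / r⌉₊ - 1

/-- The intervals are open on the left and closed on the right, so the index is a ceiling minus one;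
the ceiling is at least 1 for positive coordinates. In the quadratic directions the square root
makes the grid arithmetic. Disjointness and covering are both read off from this equivalence. -/
theorem mem_gridBox_iff (i : ι) {r : ℝ} (hr : 0 < r) {x : ι → ℝ} (hx : ∀ j, 0 < x j)
    (k : ι → ℕ) : x ∈ gridBox i r k ↔ gridIndex i r x = k := by
  have key : ∀ (u : ℝ) (n : ℕ), 0 < u → (n * r < u ∧ u ≤ (n + 1) * r ↔ ⌈u / r⌉₊ - 1 = n) := by
    intro u n hu
    have h1 : 0 < ⌈u / r⌉₊ := Nat.ceil_pos.2 (by positivity)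
    have h2 : ⌈u / r⌉₊ - 1 = n ↔ ⌈u / r⌉₊ = n + 1 := by omega
    rw [h2, Nat.ceil_eq_iff (by omega), lt_div_iff₀ hr, div_le_iff₀ hr]
    simp
  rw [funext_iff]
  simp only [gridBox, box, Set.mem_univ_pi, Set.mem_Ioc]
  refine forall_congr' fun j => ?_
  by_cases hj : j = i
  · simp only [gridPoint, gridIndex, hj, if_true, Pi.add_apply, Pi.one_apply, Nat.cast_add,
      Nat.cast_one]
    exact key _ _ (hx i)
  · simp only [gridPoint, gridIndex, hj, if_false, Pi.add_apply, Pi.one_apply, Nat.cast_add,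
      Nat.cast_one]
    rw [← key _ _ (Real.sqrt_pos.2 (hx j)), Real.lt_sqrt (by positivity),
      Real.sqrt_le_left (by positivity)]

theorem gridPoint_succ_sub_le (i : ι) {r : ℝ} (hr : 0 < r) (hr1 : r ≤ 1) (k : ι → ℕ) (j : ι)
    (h : gridPoint i r k j ≤ 1) : gridPoint i r (k + 1) j ≤ gridPoint i r k j + 3 * r := by
  by_cases hj : j = i
  · simp only [gridPoint, hj, if_true, Pi.add_apply, Pi.one_apply, Nat.cast_add, Nat.cast_one]
    linarith
  · simp only [gridPoint, hj, if_false, Pi.add_apply, Pi.one_apply, Nat.cast_add,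
      Nat.cast_one] at h ⊢
    have h1 : (k j : ℝ) * r ≤ 1 := by
      have : 0 ≤ (k j : ℝ) * r := by positivity
      nlinarith
    nlinarith

/-- This balance is the reason for the quadratic spacing. In a direction `j ≠ i` the length is at
most `2 r √b_j`, so the ratio is at most `4 r²`, and one factor `r` is absorbed by `b_i ≥ r`. Since
the form carries the weight `x_i`, all directions then have Poincaré constant of order `r`. -/
theorem gridPoint_scale (i : ι) {r : ℝ} (hr : 0 < r) (k : ι → ℕ) :
    (gridPoint i r (k + 1) i - gridPoint i r k i) ^ 2 / gridPoint i r (k + 1) i ≤ 4 * r ∧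
    ∀ j, j ≠ i → (gridPoint i r (k + 1) j - gridPoint i r k j) ^ 2 / gridPoint i r (k + 1) j ≤
      4 * r * gridPoint i r (k + 1) i := by
  have hk : ∀ j, (0 : ℝ) ≤ k j := fun j => Nat.cast_nonneg _
  have hi : r ≤ gridPoint i r (k + 1) i := by
    simp only [gridPoint, if_true, Pi.add_apply, Pi.one_apply, Nat.cast_add, Nat.cast_one]
    nlinarith [hk i]
  constructor
  · rw [div_le_iff₀ (isCell_grid i hr k i).pos]
    have : gridPoint i r (k + 1) i - gridPoint i r k i = r := by
      simp only [gridPoint, if_true, Pi.add_apply, Pi.one_apply, Nat.cast_add, Nat.cast_one]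
      ring
    rw [this]
    nlinarith
  · intro j hj
    rw [div_le_iff₀ (isCell_grid i hr k j).pos]
    have e1 : gridPoint i r (k + 1) j - gridPoint i r k j = (2 * k j + 1) * r ^ 2 := by
      simp only [gridPoint, hj, if_false, Pi.add_apply, Pi.one_apply, Nat.cast_add, Nat.cast_one]
      ring
    have e2 : gridPoint i r (k + 1) j = ((k j + 1) * r) ^ 2 := by
      simp [gridPoint, hj]
    rw [e1, e2]
    have h1 : (2 * (k j : ℝ) + 1) * r ^ 2 ≤ 2 * r * ((k j + 1) * r) := by nlinarith [hk j, sq_nonneg r]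
    have h2 : 0 ≤ (2 * (k j : ℝ) + 1) * r ^ 2 := by have := hk j; positivity
    calc ((2 * (k j : ℝ) + 1) * r ^ 2) ^ 2 ≤ (2 * r * ((k j + 1) * r)) ^ 2 := by gcongr
      _ = 4 * r * r * ((k j + 1) * r) ^ 2 := by ring
      _ ≤ _ := by gcongr

/-- With `b` the right end, the arithmetic direction gives `r b^(β-1)` with `r ≤ b ≤ 1`. In a
quadratic direction `b = s²` and the length is at least `r s`, which gives at least `r s^(2β-1)`
with `r ≤ s ≤ 1`. The remaining power is at least the same power of `r` if its exponent is
nonnegative, and at least 1 otherwise; hence the maxima with 1. -/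
theorem gridPoint_measure (β : ι → ℝ) (i : ι) {r : ℝ} (hr : 0 < r) (k : ι → ℕ) (j : ι)
    (h : gridPoint i r (k + 1) j ≤ 1) :
    r ^ gridExponent β i j ≤ (gridPoint i r (k + 1) j - gridPoint i r k j) *
      gridPoint i r (k + 1) j ^ (β j - 1) := by
  have hk : (0 : ℝ) ≤ k j := Nat.cast_nonneg _
  have hb := (isCell_grid i hr k j).pos
  by_cases hj : j = i
  · have e1 : gridPoint i r (k + 1) j - gridPoint i r k j = r := by
      simp only [gridPoint, hj, if_true, Pi.add_apply, Pi.one_apply, Nat.cast_add, Nat.cast_one]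
      ring
    have hrb : r ≤ gridPoint i r (k + 1) j := by
      have := (isCell_grid i hr k j).nonneg
      linarith
    have e2 : r ^ gridExponent β i j = r * r ^ (gridExponent β i j - 1) := by
      rw [Real.rpow_sub_one hr.ne']; field_simp
    rw [e1, e2]
    refine mul_le_mul_of_nonneg_left ?_ hr.le
    simp only [gridExponent, hj, if_true]
    rw [hj] at hrb h hb
    rcases le_total 1 (β i) with h1 | h1
    · rw [max_eq_right h1]
      exact Real.rpow_le_rpow hr.le hrb (by linarith)
    · rw [max_eq_left h1, sub_self, Real.rpow_zero]
      exact Real.one_le_rpow_of_pos_of_le_one_of_nonpos hb h (by linarith)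
  · set s : ℝ := (k j + 1) * r with hs
    have hs0 : 0 < s := by positivity
    have hrs : r ≤ s := by nlinarith
    have e1 : gridPoint i r (k + 1) j - gridPoint i r k j = (2 * k j + 1) * r ^ 2 := by
      simp only [gridPoint, hj, if_false, Pi.add_apply, Pi.one_apply, Nat.cast_add, Nat.cast_one]
      ring
    have e2 : gridPoint i r (k + 1) j = s ^ 2 := by
      simp [gridPoint, hj, hs]
    have hs1 : s ≤ 1 := by rw [e2] at h; nlinarith
    have e3 : r * s ≤ (2 * k j + 1) * r ^ 2 := by rw [hs]; nlinarith [sq_nonneg r]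
    have e4 : (s ^ 2) ^ (β j - 1) = s ^ (2 * β j - 1 - 1) := by
      rw [← Real.rpow_natCast, ← Real.rpow_mul hs0.le]
      congr 1
      push_cast
      ring
    rw [e1, e2, e4]
    have e5 : r ^ gridExponent β i j = r * r ^ (gridExponent β i j - 1) := by
      rw [Real.rpow_sub_one hr.ne']; field_simp
    calc r ^ gridExponent β i j = r * r ^ (gridExponent β i j - 1) := e5
      _ ≤ r * s ^ (2 * β j - 1) := by
          refine mul_le_mul_of_nonneg_left ?_ hr.le
          simp only [gridExponent, hj, if_false]
          rcases le_total 1 (2 * β j) with h1 | h1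
          · rw [max_eq_right h1]
            exact Real.rpow_le_rpow hr.le hrs (by linarith)
          · rw [max_eq_left h1, sub_self, Real.rpow_zero]
            exact Real.one_le_rpow_of_pos_of_le_one_of_nonpos hs0 hs1 (by linarith)
      _ = r * s * s ^ (2 * β j - 1 - 1) := by
          rw [Real.rpow_sub_one hs0.ne' (2 * β j - 1)]; field_simp
      _ ≤ _ := by gcongr

end Chart

/-! ### Super Poincaré and Poincaré inequalities in one chart -/

section ChartInequalities

variable {ι : Type*} [Fintype ι] [DecidableEq ι]

theorem exists_le_powPi_gridBox {β : ι → ℝ} (hβ : ∀ j, 0 < β j) (i : ι) :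
    ∃ c : ℝ, 0 < c ∧ ∀ r : ℝ, 0 < r → ∀ k : ι → ℕ, (∀ j, gridPoint i r (k + 1) j ≤ 1) →
      ENNReal.ofReal (c * r ^ ∑ j, gridExponent β i j) ≤ powPi β (gridBox i r k) := by
  choose c C hc hC H using fun j => exists_powMeasure_cell (hβ j)
  refine ⟨∏ j, c j, Finset.prod_pos fun j _ => hc j, fun r hr k hk => ?_⟩
  rw [gridBox, powPi_box, Real.rpow_sum_of_pos hr, ← Finset.prod_mul_distrib,
    ENNReal.ofReal_prod_of_nonneg fun j _ => mul_nonneg (hc j).le (Real.rpow_nonneg hr.le _)]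
  refine Finset.prod_le_prod' fun j _ => ?_
  refine le_trans (ENNReal.ofReal_le_ofReal ?_) (H j _ _ (isCell_grid i hr k j)).1
  exact mul_le_mul_of_nonneg_left (gridPoint_measure β i hr k j (hk j)) (hc j).le

theorem tsum_sq_le_sq_tsum {κ : Type*} (f : κ → ℝ≥0∞) : ∑' k, f k ^ 2 ≤ (∑' k, f k) ^ 2 := by
  rw [sq, ← ENNReal.tsum_mul_right]
  refine ENNReal.tsum_le_tsum fun k => ?_
  rw [sq]
  gcongr
  exact ENNReal.le_tsum k

/-- The super Poincaré inequality in a chart. -/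
theorem exists_superPoincare_chart {β : ι → ℝ} (hβ : ∀ j, 0 < β j) (i : ι) {c : ℝ} (hc : 0 < c) :
    ∃ C r₀ : ℝ, 0 < C ∧ 0 < r₀ ∧ r₀ ≤ 1 ∧ ∀ r : ℝ, 0 < r → r ≤ r₀ → ∀ F : (ι → ℝ) → ℝ,
      IsSmooth F → ∫⁻ x in cornerRegion ι c, ENNReal.ofReal (F x ^ 2) ∂powPi β ≤
        ENNReal.ofReal (C * r) * (∫⁻ x in cornerRegion ι (c / 2),
          ENNReal.ofReal (chartForm i (coordDeriv F) x) ∂powPi β) +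
        ENNReal.ofReal (C * r ^ (-∑ j, gridExponent β i j)) *
          (∫⁻ x in cornerRegion ι (c / 2), ENNReal.ofReal |F x| ∂powPi β) ^ 2 := by
  obtain ⟨C, hC, H⟩ := exists_setOsc_box_le_chartForm hβ i
  obtain ⟨d, hd, H2⟩ := exists_le_powPi_gridBox hβ i
  have hN : (0 : ℝ) < Fintype.card ι := by
    exact_mod_cast Fintype.card_pos_iff.2 ⟨i⟩
  set p := ∑ j, gridExponent β i j with hp
  -- The 4 is that of `gridPoint_scale`, and `d` is the constant in the lower bound for the mass of
  -- a box. The bound on `r` ensures that a box meeting the region for `c` stays in the region for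
  -- `c / 2`, because each side has length at most `3 r`.
  refine ⟨max (C * 4) (2 / d), min 1 (c / (6 * Fintype.card ι)), by positivity, by positivity,
    min_le_left _ _, fun r hr hr0 F hF => ?_⟩
  have hr1 : r ≤ 1 := hr0.trans (min_le_left _ _)
  have hrc : Fintype.card ι * (3 * r) ≤ c / 2 := by
    have h1 : r ≤ c / (6 * Fintype.card ι) := hr0.trans (min_le_right _ _)
    rw [le_div_iff₀ (by positivity)] at h1
    linarith
  set 𝒦 : Set (ι → ℕ) := {k | (gridBox i r k ∩ cornerRegion ι c).Nonempty} with h𝒦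
  have hsum : ∀ k ∈ 𝒦, ∑ j, gridPoint i r (k + 1) j ≤ 1 - c / 2 := by
    rintro k ⟨x, hxk, hx⟩
    calc ∑ j, gridPoint i r (k + 1) j ≤ ∑ j, (x j + 3 * r) := by
          refine Finset.sum_le_sum fun j _ => ?_
          have h1 : gridPoint i r k j < x j := (hxk j trivial).1
          have h2 := le_one_of_mem_openSimplex (cornerRegion_subset hc hx) j
          linarith [gridPoint_succ_sub_le i hr hr1 k j (h1.le.trans h2)]
      _ = ∑ j, x j + Fintype.card ι * (3 * r) := by
          rw [Finset.sum_add_distrib]; simp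
      _ ≤ _ := by linarith [hx.2]
  have hle1 : ∀ k ∈ 𝒦, ∀ j, gridPoint i r (k + 1) j ≤ 1 := fun k hk j =>
    (Finset.single_le_sum (fun j _ => (isCell_grid i hr k j).pos.le) (Finset.mem_univ j)).trans
      ((hsum k hk).trans (by linarith))
  have hsub : ∀ k ∈ 𝒦, gridBox i r k ⊆ cornerRegion ι (c / 2) := fun k hk =>
    box_subset_cornerRegion (fun j => (isCell_grid i hr k j).nonneg) (hsum k hk)
  have hposbox : ∀ k, ∀ x ∈ gridBox i r k, ∀ j, 0 < x j := fun k x hx j =>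
    (isCell_grid i hr k j).subset (hx j trivial)
  have hdisj : Pairwise (Function.onFun Disjoint fun k : 𝒦 => gridBox i r k) := by
    intro k l hkl
    refine Set.disjoint_left.2 fun x hx hx' => hkl ?_
    have h1 := (mem_gridBox_iff i hr (hposbox _ x hx) _).1 hx
    have h2 := (mem_gridBox_iff i hr (hposbox _ x hx) _).1 hx'
    exact Subtype.ext (h1.symm.trans h2)
  have hcover : cornerRegion ι c ⊆ ⋃ k : 𝒦, gridBox i r k := by
    intro x hx
    have hxk := (mem_gridBox_iff i hr hx.1 (gridIndex i r x)).2 rfl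
    exact Set.mem_iUnion.2 ⟨⟨gridIndex i r x, x, hxk, hx⟩, hxk⟩
  have hUnion : ∀ Φ : (ι → ℝ) → ℝ≥0∞, ∑' k : 𝒦, ∫⁻ x in gridBox i r k, Φ x ∂powPi β =
      ∫⁻ x in ⋃ k : 𝒦, gridBox i r k, Φ x ∂powPi β := fun Φ =>
    (lintegral_iUnion (fun k => measurableSet_box _ _) hdisj Φ).symm
  have hsubU : ⋃ k : 𝒦, gridBox i r k ⊆ cornerRegion ι (c / 2) :=
    Set.iUnion_subset fun k => hsub k k.2
  set q : (ι → ℝ) → ℝ≥0∞ := fun x => ENNReal.ofReal (chartForm i (coordDeriv F) x)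
  have hbox : ∀ k : 𝒦, ∫⁻ x in gridBox i r k, ENNReal.ofReal (F x ^ 2) ∂powPi β ≤
      ENNReal.ofReal (max (C * 4) (2 / d) * r) * (∫⁻ x in gridBox i r k, q x ∂powPi β) +
        ENNReal.ofReal (max (C * 4) (2 / d) * r ^ (-p)) *
          (∫⁻ x in gridBox i r k, ENNReal.ofReal |F x| ∂powPi β) ^ 2 := by
    rintro ⟨k, hk⟩
    have e1 := measure_mul_lintegral_sq_le (powPi β) hF.measurable (gridBox i r k)
    have e2 := H _ _ (isCell_grid i hr k) ((hsum k hk).trans_lt (by linarith)) (4 * r)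
      (by positivity) (gridPoint_scale i hr k).1 (gridPoint_scale i hr k).2 F hF
    have e3 := H2 r hr k (hle1 k hk)
    have hW0 : powPi β (gridBox i r k) ≠ 0 := powPi_box_ne_zero hβ (isCell_grid i hr k)
    have hWt : powPi β (gridBox i r k) ≠ ∞ := powPi_box_ne_top hβ (isCell_grid i hr k)
    change setOsc (powPi β) F (gridBox i r k) (gridBox i r k) ≤
      ENNReal.ofReal (C * (4 * r)) * powPi β (gridBox i r k) *
        ∫⁻ x in gridBox i r k, q x ∂powPi β at e2
    set W := powPi β (gridBox i r k)
    set T := ∫⁻ x in gridBox i r k, ENNReal.ofReal |F x| ∂powPi β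
    refine (ENNReal.mul_le_mul_iff_right hW0 hWt).1 ((e1.trans (add_le_add_left e2 _)).trans ?_)
    rw [mul_add]
    refine add_le_add ?_ ?_
    · calc _ = W * (ENNReal.ofReal (C * (4 * r)) * ∫⁻ x in gridBox i r k, q x ∂powPi β) := by ring
        _ ≤ _ := by
          rw [← mul_assoc C]
          gcongr
          exact le_max_left _ _
    -- The mass `W ≥ d r^p` compensates `r^(-p)`, so after division by `W` the `L¹` term has a
    -- constant independent of the box.
    · have e4 : (2 : ℝ≥0∞) ≤ W * ENNReal.ofReal (max (C * 4) (2 / d) * r ^ (-p)) := by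
        calc (2 : ℝ≥0∞) = ENNReal.ofReal (d * r ^ p * (2 / d * r ^ (-p))) := by
              rw [Real.rpow_neg hr.le]
              have := Real.rpow_pos_of_pos hr p
              rw [show d * r ^ p * (2 / d * (r ^ p)⁻¹) = 2 by field_simp]
              simp
          _ = ENNReal.ofReal (d * r ^ p) * ENNReal.ofReal (2 / d * r ^ (-p)) :=
              ENNReal.ofReal_mul (by positivity)
          _ ≤ _ := by
              gcongr
              exact le_max_right _ _
      rw [← mul_assoc]
      gcongr
  calc ∫⁻ x in cornerRegion ι c, ENNReal.ofReal (F x ^ 2) ∂powPi β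
      ≤ ∫⁻ x in ⋃ k : 𝒦, gridBox i r k, ENNReal.ofReal (F x ^ 2) ∂powPi β :=
        lintegral_mono_set hcover
    _ = ∑' k : 𝒦, ∫⁻ x in gridBox i r k, ENNReal.ofReal (F x ^ 2) ∂powPi β := (hUnion _).symm
    _ ≤ _ := ENNReal.tsum_le_tsum hbox
    _ = ENNReal.ofReal (max (C * 4) (2 / d) * r) *
          (∫⁻ x in ⋃ k : 𝒦, gridBox i r k, q x ∂powPi β) +
        ENNReal.ofReal (max (C * 4) (2 / d) * r ^ (-p)) *
          ∑' k : 𝒦, (∫⁻ x in gridBox i r k, ENNReal.ofReal |F x| ∂powPi β) ^ 2 := by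
        rw [ENNReal.tsum_add, ENNReal.tsum_mul_left, ENNReal.tsum_mul_left, hUnion]
    _ ≤ _ := by
        gcongr
        -- The boxes are disjoint, so the sum of the squared `L¹` norms is at most the square of the
        -- total one, however many boxes there are.
        refine (tsum_sq_le_sq_tsum _).trans ?_
        rw [hUnion]
        gcongr

/-- The Poincaré inequality in a chart. -/
theorem exists_poincare_chart {β : ι → ℝ} (hβ : ∀ j, 0 < β j) (i : ι) {c : ℝ} (hc : 0 < c)
    (hc1 : c < 1) :
    powPi β (cornerRegion ι c) ≠ ∞ ∧
    ∃ C : ℝ≥0∞, C ≠ ∞ ∧ ∀ F : (ι → ℝ) → ℝ, IsSmooth F →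
      setOsc (powPi β) F (cornerRegion ι c) (cornerRegion ι c) ≤ C *
        ∫⁻ x in cornerRegion ι (c / 2),
          ENNReal.ofReal (chartForm i (coordDeriv F) x) ∂powPi β := by
  obtain ⟨C, hC, H⟩ := exists_setOsc_box_le_chartForm hβ i
  have hN : (0 : ℝ) < Fintype.card ι := by
    exact_mod_cast Fintype.card_pos_iff.2 ⟨i⟩
  set δ : ℝ := c / (2 * Fintype.card ι) with hδ
  have hδ0 : 0 < δ := by positivity
  have hδN : Fintype.card ι * δ = c / 2 := by rw [hδ]; field_simp
  obtain ⟨M, hM⟩ := exists_nat_gt (1 / δ)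
  have hM1 : 1 < M * δ := by rwa [div_lt_iff₀ hδ0] at hM
  set B : (ι → Fin M) → ι → ℝ := fun k j => ((k j : ℕ) + 1) * δ with hB
  set s : Finset (ι → Fin M) := Finset.univ.filter fun k => ∑ j, B k j ≤ 1 - c / 2 with hs
  have hmem : ∀ k ∈ s, ∑ j, B k j ≤ 1 - c / 2 := fun k hk => (Finset.mem_filter.1 hk).2
  have hBδ : ∀ k j, δ ≤ B k j := fun k j => by
    have : (0 : ℝ) ≤ (k j : ℕ) := Nat.cast_nonneg _
    simp only [hB]
    nlinarith
  have hcell : ∀ k j, IsCell ((0 : ι → ℝ) j) (B k j) := fun k j =>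
    ⟨le_rfl, hδ0.trans_le (hBδ k j), Or.inl rfl⟩
  have hcover : cornerRegion ι c ⊆ ⋃ k ∈ s, box 0 (B k) := by
    intro x hx
    have hx1 := le_one_of_mem_openSimplex (cornerRegion_subset hc hx)
    have hpos : ∀ j, 0 < ⌈x j / δ⌉₊ := fun j => Nat.ceil_pos.2 (div_pos (hx.1 j) hδ0)
    have hceil : ∀ j, ⌈x j / δ⌉₊ ≤ M := fun j => Nat.ceil_le.2 (by
      rw [div_le_iff₀ hδ0]; linarith [hx1 j])
    set k : ι → Fin M := fun j => ⟨⌈x j / δ⌉₊ - 1, by have := hpos j; have := hceil j; omega⟩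
    have hBk : ∀ j, B k j = ⌈x j / δ⌉₊ * δ := fun j => by
      simp only [hB, k]
      have : ((⌈x j / δ⌉₊ - 1 : ℕ) : ℝ) + 1 = ⌈x j / δ⌉₊ := by
        exact_mod_cast Nat.sub_add_cancel (hpos j)
      rw [this]
    simp only [Set.mem_iUnion]
    refine ⟨k, Finset.mem_filter.2 ⟨Finset.mem_univ _, ?_⟩, fun j _ => ⟨hx.1 j, ?_⟩⟩
    · calc ∑ j, B k j ≤ ∑ j, (x j + δ) := by
            refine Finset.sum_le_sum fun j _ => ?_
            rw [hBk]
            have := Nat.ceil_lt_add_one (div_nonneg (hx.1 j).le hδ0.le)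
            have h2 : x j / δ * δ = x j := by field_simp
            nlinarith
        _ = ∑ j, x j + Fintype.card ι * δ := by rw [Finset.sum_add_distrib]; simp
        _ ≤ _ := by rw [hδN]; linarith [hx.2]
    · rw [hBk, ← div_le_iff₀ hδ0]
      exact Nat.le_ceil _
  have hfin : ∀ k, powPi β (box 0 (B k)) ≠ ∞ := fun k => powPi_box_ne_top hβ (hcell k)
  have hcell0 : ∀ j : ι, IsCell ((0 : ι → ℝ) j) ((fun _ => δ) j) := fun j =>
    ⟨le_rfl, hδ0, Or.inl rfl⟩
  -- Every covering box has its lower corner at the origin and sides at least `δ`, so all of them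
  -- contain the cube of side `δ`, along which they are glued.
  obtain ⟨C', hC', H'⟩ := exists_setOsc_biUnion_le (powPi β) s (fun k => box 0 (B k))
    (box 0 fun _ => δ) (powPi_box_ne_zero hβ hcell0)
    (fun k _ x hx j _ => ⟨(hx j trivial).1, (hx j trivial).2.trans (hBδ k j)⟩) fun k _ => hfin k
  refine ⟨?_, ?_⟩
  · refine ((measure_mono hcover).trans (measure_biUnion_finset_le s _)).trans_lt ?_ |>.ne
    exact (ENNReal.sum_ne_top.2 fun k _ => hfin k).lt_top
  · refine ⟨C' * ∑ k ∈ s, ENNReal.ofReal (C * (1 + 1 / δ)) * powPi β (box 0 (B k)), ?_, ?_⟩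
    · exact ENNReal.mul_ne_top hC' (ENNReal.sum_ne_top.2 fun k _ =>
        ENNReal.mul_ne_top ENNReal.ofReal_ne_top (hfin k))
    · intro F hF
      refine (setOsc_mono hcover hcover).trans ((H' F hF.measurable).trans ?_)
      rw [mul_assoc, Finset.sum_mul]
      gcongr with k hk
      have hb1 : ∀ j, B k j ≤ 1 := fun j =>
        (Finset.single_le_sum (fun j _ => (hcell k j).pos.le) (Finset.mem_univ j)).trans
          ((hmem k hk).trans (by linarith))
      have hsq : ∀ j, (B k j - (0 : ι → ℝ) j) ^ 2 / B k j = B k j := fun j => by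
        have := (hcell k j).pos
        simp only [Pi.zero_apply, sub_zero]
        field_simp
      -- For a side starting at `0` the scale quantity is the side itself, which is at most 1, while
      -- `B k i ≥ δ`. Hence `R = 1 + 1 / δ` satisfies both scale conditions.
      refine (H 0 (B k) (hcell k) ((hmem k hk).trans_lt (by linarith)) (1 + 1 / δ)
        (by positivity) ?_ (fun j _ => ?_) F hF).trans ?_
      · rw [hsq]
        have : 0 < 1 / δ := by positivity
        linarith [hb1 i]
      · rw [hsq]
        have h1 : 1 ≤ 1 / δ * B k i := by
          rw [one_div, ← div_eq_inv_mul, le_div_iff₀ hδ0, one_mul]; exact hBδ k i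
        have h2 := (hcell k i).pos
        linarith [hb1 j]
      · gcongr
        exact box_subset_cornerRegion (fun _ => le_rfl) (hmem k hk)

end ChartInequalities

/-! ### Reflections of the simplex and comparison of the Dirichlet law with a product -/

section Dirichlet

variable {N : ℕ}

theorem openSimplex_subset : openSimplex (Fin N) ⊆ simplex N := fun _ hx =>
  ⟨fun j => ⟨(hx.1 j).le, le_one_of_mem_openSimplex hx j⟩, hx.2.le⟩

/-- Exchange of the `i`-th barycentric coordinate with the last one. -/
def reflect (i : Fin N) (x : Fin N → ℝ) : Fin N → ℝ := Function.update x i (1 - ∑ j, x j)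

theorem sum_update (i : Fin N) (x : Fin N → ℝ) (t : ℝ) :
    ∑ j, Function.update x i t j = t + (∑ j, x j - x i) := by
  rw [Finset.sum_update_of_mem (Finset.mem_univ i), ← Finset.sum_sdiff
    (Finset.subset_univ {i}) (f := x)]
  simp

theorem sum_reflect (i : Fin N) (x : Fin N → ℝ) : ∑ j, reflect i x j = 1 - x i := by
  rw [reflect, sum_update]; ring

theorem reflect_self (i : Fin N) (x : Fin N → ℝ) : reflect i x i = 1 - ∑ j, x j := by
  simp [reflect]

theorem reflect_of_ne {i j : Fin N} (h : j ≠ i) (x : Fin N → ℝ) : reflect i x j = x j := by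
  simp [reflect, h]

theorem reflect_reflect (i : Fin N) (x : Fin N → ℝ) : reflect i (reflect i x) = x := by
  ext j
  rcases eq_or_ne j i with rfl | h
  · rw [reflect_self, sum_reflect]; ring
  · rw [reflect_of_ne h, reflect_of_ne h]

theorem reflect_mem_openSimplex (i : Fin N) {x : Fin N → ℝ} (hx : x ∈ openSimplex (Fin N)) :
    reflect i x ∈ openSimplex (Fin N) := by
  refine ⟨fun j => ?_, ?_⟩
  · rcases eq_or_ne j i with rfl | h
    · rw [reflect_self]; linarith [hx.2]
    · rw [reflect_of_ne h]; exact hx.1 j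
  · rw [sum_reflect]; linarith [hx.1 i]

theorem reflect_mem_simplex (i : Fin N) {x : Fin N → ℝ} (hx : x ∈ simplex N) :
    reflect i x ∈ simplex N := by
  have h0 : 0 ≤ ∑ j, x j := Finset.sum_nonneg fun j _ => (hx.1 j).1
  refine ⟨fun j => ?_, ?_⟩
  · rcases eq_or_ne j i with rfl | h
    · rw [reflect_self]; exact ⟨by linarith [hx.2], by linarith⟩
    · rw [reflect_of_ne h]; exact hx.1 j
  · rw [sum_reflect]; linarith [(hx.1 i).1]

/-- The linear part of `reflect`. -/
def reflectLinear (i : Fin N) : (Fin N → ℝ) →ₗ[ℝ] (Fin N → ℝ) where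
  toFun x := Function.update x i (-∑ j, x j)
  map_add' x y := by
    ext j
    rcases eq_or_ne j i with rfl | h
    · simp [Finset.sum_add_distrib]; ring
    · simp [h]
  map_smul' a x := by
    ext j
    rcases eq_or_ne j i with rfl | h
    · simp [Finset.mul_sum]
    · simp [h]

theorem reflect_eq (i : Fin N) (x : Fin N → ℝ) :
    reflect i x = Pi.single i 1 + reflectLinear i x := by
  ext j
  rcases eq_or_ne j i with rfl | h
  · simp [reflect, reflectLinear, sub_eq_add_neg]
  · simp [reflect, reflectLinear, h]

/-- The linear part of the exchange is an involution, so its determinant is `±1` and Lebesgue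
measure is preserved. -/
theorem det_reflectLinear_sq (i : Fin N) : LinearMap.det (reflectLinear i) ^ 2 = 1 := by
  have : reflectLinear i ∘ₗ reflectLinear i = LinearMap.id := by
    refine LinearMap.ext fun x => ?_
    ext j
    rcases eq_or_ne j i with rfl | h
    · simp [reflectLinear, sum_update]
    · simp [reflectLinear, h]
  rw [sq, ← LinearMap.det_comp, this, LinearMap.det_id]

theorem contDiff_reflect (i : Fin N) : ContDiff ℝ 1 (reflect i) := by
  have : reflect i = fun x => Pi.single i 1 + (reflectLinear i).toContinuousLinearMap x := by
    ext1 x; exact reflect_eq i x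
  rw [this]
  exact contDiff_const.add (ContinuousLinearMap.contDiff _)

theorem measurePreserving_reflect_volume (i : Fin N) :
    MeasurePreserving (reflect i) volume volume := by
  refine ⟨(contDiff_reflect i).continuous.measurable, ?_⟩
  have hd := det_reflectLinear_sq i
  have hd0 : LinearMap.det (reflectLinear i) ≠ 0 := by
    intro h; rw [h] at hd; norm_num at hd
  have habs : |(LinearMap.det (reflectLinear i))⁻¹| = 1 := by
    have h := abs_nonneg (LinearMap.det (reflectLinear i))
    have h2 : |LinearMap.det (reflectLinear i)| = 1 := by
      rw [← sq_abs] at hd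
      nlinarith
    rw [abs_inv, h2, inv_one]
  have h1 : Measure.map (reflectLinear i) volume = volume := by
    rw [Real.map_linearMap_volume_pi_eq_smul_volume_pi hd0, habs]
    simp
  have hL : Measurable (reflectLinear i) :=
    (reflectLinear i).toContinuousLinearMap.continuous.measurable
  have : reflect i = (fun x => Pi.single i 1 + x) ∘ reflectLinear i := by
    ext1 x; exact reflect_eq i x
  rw [this, ← Measure.map_map (measurable_const_add _) hL, h1, map_add_left_eq_self]

/-- The parameter of the Dirichlet distribution in reflected coordinates. -/
def swapLast (α : Fin (N + 1) → ℝ) (i : Fin N) : Fin (N + 1) → ℝ :=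
  α ∘ Equiv.swap i.castSucc (Fin.last N)

theorem swapLast_last (α : Fin (N + 1) → ℝ) (i : Fin N) :
    swapLast α i (Fin.last N) = α i.castSucc := by simp [swapLast]

theorem swapLast_self (α : Fin (N + 1) → ℝ) (i : Fin N) :
    swapLast α i i.castSucc = α (Fin.last N) := by simp [swapLast]

theorem swapLast_of_ne (α : Fin (N + 1) → ℝ) {i j : Fin N} (h : j ≠ i) :
    swapLast α i j.castSucc = α j.castSucc := by
  rw [swapLast, Function.comp_apply, Equiv.swap_apply_of_ne_of_ne]
  · simpa using h
  · exact Fin.castSucc_ne_last j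

theorem density_reflect (α : Fin (N + 1) → ℝ) (i : Fin N) (x : Fin N → ℝ) :
    density α (reflect i x) = density (swapLast α i) x := by
  have h1 : ∑ j, swapLast α i j = ∑ j, α j := Equiv.sum_comp _ α
  have h2 : ∏ j, Real.Gamma (swapLast α i j) = ∏ j, Real.Gamma (α j) :=
    Equiv.prod_comp (Equiv.swap i.castSucc (Fin.last N)) fun j => Real.Gamma (α j)
  rw [density, density, h1, h2, sum_reflect, swapLast_last, mul_assoc, mul_assoc]
  congr 1
  rw [← Finset.mul_prod_erase _ _ (Finset.mem_univ i),
    ← Finset.mul_prod_erase (a := i) (f := fun j : Fin N => x j ^ (swapLast α i j.castSucc - 1)) _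
      (Finset.mem_univ i), reflect_self, swapLast_self]
  have : ∀ j ∈ Finset.univ.erase i, reflect i x j ^ (α j.castSucc - 1) =
      x j ^ (swapLast α i j.castSucc - 1) := fun j hj => by
    have hj' := Finset.ne_of_mem_erase hj
    rw [reflect_of_ne hj', swapLast_of_ne α hj']
  rw [Finset.prod_congr rfl this, sub_sub_cancel]
  ring

theorem measurableSet_simplex : MeasurableSet (simplex N) := by
  have : simplex N = (⋂ j, {x : Fin N → ℝ | x j ∈ Set.Icc (0 : ℝ) 1}) ∩ {x | ∑ j, x j ≤ 1} := by
    ext x; simp [simplex]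
  rw [this]
  exact (MeasurableSet.iInter fun j => measurableSet_Icc.preimage (measurable_pi_apply j)).inter
    (isClosed_le (by fun_prop) continuous_const).measurableSet

theorem measurable_density (α : Fin (N + 1) → ℝ) : Measurable (density α) := by
  unfold density
  fun_prop

theorem dirichletMeasure_apply (α : Fin (N + 1) → ℝ) {s : Set (Fin N → ℝ)}
    (hs : MeasurableSet s) :
    dirichletMeasure α s = ∫⁻ x in s ∩ simplex N, ENNReal.ofReal (density α x) := by
  rw [dirichletMeasure, withDensity_apply _ hs, Measure.restrict_restrict hs]

theorem measurePreserving_reflect (α : Fin (N + 1) → ℝ) (i : Fin N) :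
    MeasurePreserving (reflect i) (dirichletMeasure (swapLast α i)) (dirichletMeasure α) := by
  have hm : Measurable (reflect i) := (contDiff_reflect i).continuous.measurable
  refine ⟨hm, ?_⟩
  ext s hs
  rw [Measure.map_apply hm hs, dirichletMeasure_apply _ (hm hs), dirichletMeasure_apply _ hs]
  have hpre : reflect i ⁻¹' s ∩ simplex N = reflect i ⁻¹' (s ∩ simplex N) := by
    ext x
    refine ⟨fun h => ⟨h.1, reflect_mem_simplex i h.2⟩, fun h => ⟨h.1, ?_⟩⟩
    have := reflect_mem_simplex i h.2
    rwa [reflect_reflect] at this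
  rw [hpre, ← (measurePreserving_reflect_volume i).setLIntegral_comp_preimage
    (hs.inter measurableSet_simplex) (measurable_density α).ennreal_ofReal]
  simp only [density_reflect]

theorem volume_simplex_diff [NeZero N] : volume (simplex N \ openSimplex (Fin N)) = 0 := by
  have h1 : ∀ j : Fin N, volume {x : Fin N → ℝ | x j = 0} = 0 := fun j =>
    Measure.pi_hyperplane (fun _ : Fin N => (volume : Measure ℝ)) j 0
  have h2 : volume {x : Fin N → ℝ | ∑ j, x j = 1} = 0 := by
    -- The oblique face is the image of a coordinate hyperplane under a volume preserving
    -- reflection.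
    have hpre : {x : Fin N → ℝ | ∑ j, x j = 1} = reflect 0 ⁻¹' {x | x 0 = 0} := by
      ext x
      simp only [Set.mem_ofPred_eq, Set.mem_preimage, reflect_self]
      rw [sub_eq_zero, eq_comm]
    rw [hpre, (measurePreserving_reflect_volume (0 : Fin N)).measure_preimage
      ((measurableSet_eq_fun (measurable_pi_apply _) measurable_const).nullMeasurableSet), h1]
  refine measure_mono_null (t := (⋃ j, {x : Fin N → ℝ | x j = 0}) ∪ {x | ∑ j, x j = 1}) ?_
    (measure_union_null (measure_iUnion_null h1) h2)
  rintro x ⟨hx, hx'⟩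
  by_contra hcon
  simp only [Set.mem_union, Set.mem_iUnion, Set.mem_ofPred_eq, not_or, not_exists] at hcon
  exact hx' ⟨fun j => lt_of_le_of_ne (hx.1 j).1 (Ne.symm (hcon.1 j)), lt_of_le_of_ne hx.2 hcon.2⟩

theorem ae_mem_openSimplex [NeZero N] (α : Fin (N + 1) → ℝ) :
    ∀ᵐ x ∂dirichletMeasure α, x ∈ openSimplex (Fin N) := by
  refine (withDensity_absolutelyContinuous _ _).ae_le ?_
  change ∀ᵐ x ∂volume.restrict (simplex N), x ∈ openSimplex (Fin N)
  rw [ae_restrict_iff' measurableSet_simplex, ae_iff]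
  convert volume_simplex_diff (N := N) using 2
  ext x
  simp

theorem powPi_eq (β : Fin N → ℝ) :
    powPi β = (volume.restrict (Set.univ.pi fun _ : Fin N => Set.Ioi (0 : ℝ))).withDensity
      fun x => ∏ j, ENNReal.ofReal (x j ^ (β j - 1)) := by
  have h : ∀ j : Fin N, SigmaFinite ((volume.restrict (Set.Ioi (0 : ℝ))).withDensity
      fun t => ENNReal.ofReal (t ^ (β j - 1))) := fun j => SigmaFinite.withDensity_ofReal _
  rw [volume_pi, Measure.restrict_pi_pi]
  exact pi_withDensity (fun _ : Fin N => volume.restrict (Set.Ioi (0 : ℝ)))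
    (w := fun j t => ENNReal.ofReal (t ^ (β j - 1))) fun j => measurable_ofReal_rpow _

theorem setLIntegral_powPi (β : Fin N → ℝ) {s : Set (Fin N → ℝ)} (hs : MeasurableSet s)
    (h0 : ∀ x ∈ s, ∀ j, 0 < x j) (H : (Fin N → ℝ) → ℝ≥0∞) :
    ∫⁻ x in s, H x ∂powPi β = ∫⁻ x in s, ENNReal.ofReal (∏ j, x j ^ (β j - 1)) * H x := by
  have hm : Measurable fun x : Fin N → ℝ => ∏ j, ENNReal.ofReal (x j ^ (β j - 1)) := by fun_prop
  have hsub : s ⊆ Set.univ.pi fun _ : Fin N => Set.Ioi (0 : ℝ) := fun x hx j _ => h0 x hx j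
  rw [powPi_eq, setLIntegral_withDensity_eq_setLIntegral_mul_non_measurable _ hm _ hs
    (ae_of_all _ fun x => ENNReal.prod_lt_top fun j _ => ENNReal.ofReal_lt_top),
    Measure.restrict_restrict hs, Set.inter_eq_left.2 hsub]
  refine setLIntegral_congr_fun hs fun x hx => ?_
  rw [ENNReal.ofReal_prod_of_nonneg fun j _ => Real.rpow_nonneg (h0 x hx j).le _]
  rfl

theorem setLIntegral_dirichletMeasure (α : Fin (N + 1) → ℝ) {s : Set (Fin N → ℝ)}
    (hs : MeasurableSet s) (h0 : s ⊆ openSimplex (Fin N)) (H : (Fin N → ℝ) → ℝ≥0∞) :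
    ∫⁻ x in s, H x ∂dirichletMeasure α = ∫⁻ x in s, ENNReal.ofReal (density α x) * H x := by
  rw [dirichletMeasure, setLIntegral_withDensity_eq_setLIntegral_mul_non_measurable _
    (measurable_density α).ennreal_ofReal _ hs (by simp), Measure.restrict_restrict hs,
    Set.inter_eq_left.2 (h0.trans openSimplex_subset)]
  rfl

/-- On `cornerRegion` the factor `1 - |x|_1` lies in `[c, 1]`, so its power is bounded above and
away from `0`, and what remains of the density is the normalizing constant times the product
density. The comparison is pointwise between densities; `H` may be any function. -/
theorem exists_dirichlet_comparison {α : Fin (N + 1) → ℝ} (hα : ∀ j, 0 < α j) {c : ℝ}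
    (hc : 0 < c) :
    ∃ κ : ℝ≥0∞, κ ≠ ∞ ∧ ∀ s, MeasurableSet s → s ⊆ cornerRegion (Fin N) c →
      ∀ H : (Fin N → ℝ) → ℝ≥0∞,
      ∫⁻ x in s, H x ∂dirichletMeasure α ≤ κ * ∫⁻ x in s, H x ∂powPi (fun j => α j.castSucc) ∧
      ∫⁻ x in s, H x ∂powPi (fun j => α j.castSucc) ≤ κ * ∫⁻ x in s, H x ∂dirichletMeasure α := by
  set Z : ℝ := Real.Gamma (∑ i, α i) / (∏ i, Real.Gamma (α i)) with hZ
  have hZ0 : 0 < Z := div_pos (Real.Gamma_pos_of_pos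
    (Finset.sum_pos (fun j _ => hα j) ⟨Fin.last N, Finset.mem_univ _⟩))
    (Finset.prod_pos fun j _ => Real.Gamma_pos_of_pos (hα j))
  set γ := α (Fin.last N) - 1 with hγ
  have hup : ∀ t, c ≤ t → t ≤ 1 → t ^ γ ≤ 1 + c ^ γ := by
    intro t h1 h2
    have ht := hc.trans_le h1
    have := Real.rpow_pos_of_pos hc γ
    rcases le_total 0 γ with h | h
    · linarith [Real.rpow_le_one ht.le h2 h]
    · linarith [Real.rpow_le_rpow_of_nonpos hc h1 h]
  have hlow : ∀ t, c ≤ t → t ≤ 1 → (t ^ γ)⁻¹ ≤ 1 + (c ^ γ)⁻¹ := by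
    intro t h1 h2
    have ht := hc.trans_le h1
    have := Real.rpow_pos_of_pos hc γ
    have h3 := Real.rpow_pos_of_pos hc (-γ)
    rw [← Real.rpow_neg ht.le, ← Real.rpow_neg hc.le]
    rcases le_total 0 (-γ) with h | h
    · linarith [Real.rpow_le_one ht.le h2 h]
    · linarith [Real.rpow_le_rpow_of_nonpos hc h1 h]
  have hcγ := Real.rpow_pos_of_pos hc γ
  -- The first summand serves the upper comparison, the second the lower one; their sum gives a
  -- single constant for both.
  refine ⟨ENNReal.ofReal (Z * (1 + c ^ γ) + Z⁻¹ * (1 + (c ^ γ)⁻¹)), ENNReal.ofReal_ne_top,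
    fun s hs hsc H => ?_⟩
  rw [setLIntegral_dirichletMeasure α hs (hsc.trans (cornerRegion_subset hc)),
    setLIntegral_powPi _ hs fun x hx => (hsc hx).1]
  have ht : ∀ x ∈ s, c ≤ 1 - ∑ j, x j ∧ 1 - ∑ j, x j ≤ 1 := fun x hx =>
    ⟨by linarith [(hsc hx).2], by
      linarith [Finset.sum_nonneg fun j (_ : j ∈ Finset.univ) => ((hsc hx).1 j).le]⟩
  have hprod : ∀ x ∈ s, 0 < ∏ j : Fin N, x j ^ (α j.castSucc - 1) := fun x hx =>
    Finset.prod_pos fun j _ => Real.rpow_pos_of_pos ((hsc hx).1 j) _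
  rw [← lintegral_const_mul' _ _ ENNReal.ofReal_ne_top,
    ← lintegral_const_mul' _ _ ENNReal.ofReal_ne_top]
  constructor
  · refine setLIntegral_mono' hs fun x hx => ?_
    rw [← mul_assoc, ← ENNReal.ofReal_mul (by positivity)]
    gcongr
    have := hprod x hx
    have h1 := hup _ (ht x hx).1 (ht x hx).2
    rw [density, ← hZ, ← hγ]
    have h2 : 0 ≤ Z⁻¹ * (1 + (c ^ γ)⁻¹) := by positivity
    gcongr
    nlinarith
  · refine setLIntegral_mono' hs fun x hx => ?_
    rw [← mul_assoc, ← ENNReal.ofReal_mul (by positivity)]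
    gcongr
    have h3 := hprod x hx
    have h1 := hlow _ (ht x hx).1 (ht x hx).2
    have h4 : 0 < (1 - ∑ j, x j) ^ γ := Real.rpow_pos_of_pos (hc.trans_le (ht x hx).1) _
    rw [density, ← hZ, ← hγ, mul_assoc, ← mul_assoc, ← mul_assoc]
    have h2 : 0 ≤ Z * (1 + c ^ γ) := by positivity
    have h5 : 1 ≤ Z⁻¹ * (1 + (c ^ γ)⁻¹) * Z * (1 - ∑ j, x j) ^ γ := by
      calc 1 = Z⁻¹ * ((1 - ∑ j, x j) ^ γ)⁻¹ * Z * (1 - ∑ j, x j) ^ γ := by field_simp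
        _ ≤ _ := by gcongr
    have h6 : 1 ≤ (Z * (1 + c ^ γ) + Z⁻¹ * (1 + (c ^ γ)⁻¹)) * Z * (1 - ∑ j, x j) ^ γ := by
      refine h5.trans ?_
      gcongr
      linarith
    exact le_mul_of_one_le_left h3.le h6

end Dirichlet

/-! ### Charts at the vertices and the global super Poincaré inequality -/

section Global

variable {N : ℕ}

/-- Barycentric coordinates. -/
def bary (x : Fin N → ℝ) : Fin (N + 1) → ℝ := Fin.snoc (α := fun _ => ℝ) x (1 - ∑ j, x j)

@[simp] theorem bary_last (x : Fin N → ℝ) : bary x (Fin.last N) = 1 - ∑ j, x j := by simp [bary]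

@[simp] theorem bary_castSucc (x : Fin N → ℝ) (i : Fin N) : bary x i.castSucc = x i := by
  simp [bary]

theorem sum_bary (x : Fin N → ℝ) : ∑ k, bary x k = 1 := by
  rw [Fin.sum_univ_castSucc]; simp

/-- The carré du champ of the multivariate Dirichlet diffusion. -/
def carre (F : (Fin N → ℝ) → ℝ) (x : Fin N → ℝ) : ℝ :=
  ∑ j, x j * (1 - ∑ k, x k) * coordDeriv F j x ^ 2

theorem measurable_carre (F : (Fin N → ℝ) → ℝ) : Measurable (carre F) := by
  have := measurable_coordDeriv F
  unfold carre
  fun_prop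

theorem hasFDerivAt_reflect (i : Fin N) (x : Fin N → ℝ) :
    HasFDerivAt (reflect i) (reflectLinear i).toContinuousLinearMap x := by
  have : reflect i = fun x => Pi.single i 1 + (reflectLinear i).toContinuousLinearMap x := by
    ext1 x; exact reflect_eq i x
  rw [this]
  exact (ContinuousLinearMap.hasFDerivAt _).const_add _

theorem IsSmooth.comp_reflect {F : (Fin N → ℝ) → ℝ} (hF : IsSmooth F) (i : Fin N) :
    IsSmooth (F ∘ reflect i) :=
  ⟨hF.measurable.comp (contDiff_reflect i).continuous.measurable,
    hF.contDiffOn.comp (contDiff_reflect i).contDiffOn fun _ hx => reflect_mem_openSimplex i hx⟩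

theorem IsSmooth.differentiableAt {F : (Fin N → ℝ) → ℝ} (hF : IsSmooth F) {x : Fin N → ℝ}
    (hx : x ∈ openSimplex (Fin N)) : DifferentiableAt ℝ F x :=
  (hF.contDiffOn.contDiffAt (isOpen_openSimplex.mem_nhds hx)).differentiableAt (by norm_num)

/-- The linear part of the reflection sends `e_j` to `e_j - e_i` for `j ≠ i`, and `e_i` to `-e_i`.
-/
theorem coordDeriv_comp_reflect {F : (Fin N → ℝ) → ℝ} (hF : IsSmooth F) (i j : Fin N)
    {x : Fin N → ℝ} (hx : x ∈ openSimplex (Fin N)) :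
    coordDeriv (F ∘ reflect i) j x =
      (if j = i then 0 else coordDeriv F j (reflect i x)) - coordDeriv F i (reflect i x) := by
  have h1 := (hF.differentiableAt (reflect_mem_openSimplex i hx)).hasFDerivAt
  have h2 := h1.comp x (hasFDerivAt_reflect i x)
  have h3 : reflectLinear i (Pi.single j 1) = (if j = i then 0 else Pi.single j 1) -
      Pi.single i (1 : ℝ) := by
    ext k
    rcases eq_or_ne k i with rfl | hk
    · rcases eq_or_ne j k with rfl | hj
      · simp [reflectLinear]
      · simp [reflectLinear, hj, hj.symm]
    · rcases eq_or_ne j i with rfl | hj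
      · simp [reflectLinear, hk]
      · simp [reflectLinear, hj, hk]
  rw [coordDeriv, h2.fderiv, ContinuousLinearMap.comp_apply, LinearMap.coe_toContinuousLinearMap',
    h3, map_sub]
  split_ifs <;> simp [coordDeriv]

/-- After the exchange `x_i` is the original last coordinate, which multiplies the whole form, and
`1 - |x|_1 ≥ c` is the original `i`-th one. So the form at the reflected point is `(1 - |x|_1) x_i
g_i² + ∑_{j ≠ i} x_i x_j g_j²`. The chart derivatives in the directions `j ≠ i` are `g_j - g_i`; the
extra `g_i²` terms are absorbed because the coordinates `x_j` sum to at most 1. -/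
theorem chartForm_comp_reflect_le {F : (Fin N → ℝ) → ℝ} (hF : IsSmooth F) (i : Fin N) {c : ℝ}
    (hc : 0 < c) {x : Fin N → ℝ} (hx : x ∈ cornerRegion (Fin N) c) :
    chartForm i (coordDeriv (F ∘ reflect i)) x ≤ (3 / c + 2) * carre F (reflect i x) := by
  have hxO := cornerRegion_subset hc hx
  have hpos := hx.1
  set g : Fin N → ℝ := fun j => coordDeriv F j (reflect i x) with hg
  have hi : coordDeriv (F ∘ reflect i) i x = - g i := by
    rw [coordDeriv_comp_reflect hF i i hxO]; simp [hg]
  have hj : ∀ j, j ≠ i → coordDeriv (F ∘ reflect i) j x = g j - g i := fun j hj => by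
    rw [coordDeriv_comp_reflect hF i j hxO]; simp [hg, hj]
  have hcarre : carre F (reflect i x) = (1 - ∑ k, x k) * x i * g i ^ 2 +
      ∑ j ∈ Finset.univ.erase i, x i * (x j * g j ^ 2) := by
    rw [carre, ← Finset.add_sum_erase _ _ (Finset.mem_univ i), sum_reflect, reflect_self,
      sub_sub_cancel]
    congr 1
    refine Finset.sum_congr rfl fun j hj => ?_
    rw [reflect_of_ne (Finset.ne_of_mem_erase hj)]
    simp only [hg]
    ring
  rw [hcarre, chartForm, hi]
  set S := ∑ j ∈ Finset.univ.erase i, x i * (x j * g j ^ 2)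
  have hS0 : 0 ≤ S := Finset.sum_nonneg fun j _ => by
    have := hpos i; have := hpos j; positivity
  have hsum1 : ∑ j ∈ Finset.univ.erase i, x j ≤ 1 :=
    (Finset.sum_le_sum_of_subset_of_nonneg (Finset.erase_subset _ _)
      fun j _ _ => (hpos j).le).trans hxO.2.le
  have hS : ∑ j ∈ Finset.univ.erase i, x i * (x j * coordDeriv (F ∘ reflect i) j x ^ 2) ≤
      2 * S + 2 * (x i * g i ^ 2) := by
    calc _ ≤ ∑ j ∈ Finset.univ.erase i,
          (2 * (x i * (x j * g j ^ 2)) + 2 * (x i * g i ^ 2) * x j) := by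
          refine Finset.sum_le_sum fun j hj' => ?_
          rw [hj j (Finset.ne_of_mem_erase hj')]
          have h1 := hpos i
          have h2 := hpos j
          have h3 : (g j - g i) ^ 2 ≤ 2 * g j ^ 2 + 2 * g i ^ 2 := by
            nlinarith [sq_nonneg (g j + g i)]
          calc x i * (x j * (g j - g i) ^ 2) ≤ x i * (x j * (2 * g j ^ 2 + 2 * g i ^ 2)) := by
                gcongr
            _ = _ := by ring
      _ = 2 * S + 2 * (x i * g i ^ 2) * ∑ j ∈ Finset.univ.erase i, x j := by
          rw [Finset.sum_add_distrib, ← Finset.mul_sum _ _ (2 * (x i * g i ^ 2)),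
            ← Finset.mul_sum _ _ (2 : ℝ)]
      _ ≤ _ := by
          have := hpos i
          have h2 : 0 ≤ 2 * (x i * g i ^ 2) := by positivity
          exact add_le_add le_rfl (mul_le_of_le_one_right h2 hsum1)
  have ht : c ≤ 1 - ∑ k, x k := by linarith [hx.2]
  have hA : 0 ≤ x i * g i ^ 2 := by have := hpos i; positivity
  have h3 : 3 * (x i * g i ^ 2) ≤ 3 / c * ((1 - ∑ k, x k) * x i * g i ^ 2) := by
    calc 3 * (x i * g i ^ 2) = 3 / c * (c * (x i * g i ^ 2)) := by field_simp
      _ ≤ 3 / c * ((1 - ∑ k, x k) * (x i * g i ^ 2)) := by gcongr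
      _ = _ := by ring
  have h4 : 0 ≤ (1 - ∑ k, x k) * x i * g i ^ 2 := by
    have := hpos i
    have := hc.trans_le ht
    positivity
  have h5 : 0 ≤ 3 / c * S := by positivity
  nlinarith

/-- Near the last vertex the factor `1 - |x|_1 ≥ c` does not degenerate, and `x_i ≤ 1` makes
`chartForm` smaller than `∑ x_j g_j²`. The weaker form is used here too, so that all charts are
treated alike. -/
theorem chartForm_le {F : (Fin N → ℝ) → ℝ} (i : Fin N) {c : ℝ}
    (hc : 0 < c) {x : Fin N → ℝ} (hx : x ∈ cornerRegion (Fin N) c) :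
    chartForm i (coordDeriv F) x ≤ 1 / c * carre F x := by
  have hpos := hx.1
  have ht : c ≤ 1 - ∑ k, x k := by linarith [hx.2]
  calc chartForm i (coordDeriv F) x ≤ ∑ j, x j * coordDeriv F j x ^ 2 := by
        rw [chartForm, ← Finset.add_sum_erase _ _ (Finset.mem_univ i)]
        refine add_le_add le_rfl (Finset.sum_le_sum fun j _ => ?_)
        have h1 := le_one_of_mem_openSimplex (cornerRegion_subset hc hx) i
        have h2 : 0 ≤ x j * coordDeriv F j x ^ 2 := by have := hpos j; positivity
        exact mul_le_of_le_one_left h2 h1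
    _ ≤ _ := by
        rw [carre, Finset.mul_sum]
        refine Finset.sum_le_sum fun j _ => ?_
        have := hpos j
        calc x j * coordDeriv F j x ^ 2 = 1 / c * (x j * c * coordDeriv F j x ^ 2) := by
              field_simp
          _ ≤ _ := by gcongr

/-- A chart of the simplex around the vertex `k`. -/
structure IsChart (α : Fin (N + 1) → ℝ) (k : Fin (N + 1)) (e : (Fin N → ℝ) → Fin N → ℝ)
    (i : Fin N) (α' : Fin (N + 1) → ℝ) : Prop where
  pos : ∀ j, 0 < α' j
  measurePreserving : MeasurePreserving e (dirichletMeasure α') (dirichletMeasure α)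
  mem : ∀ x ∈ openSimplex (Fin N), e x ∈ openSimplex (Fin N)
  invol : ∀ x, e (e x) = x
  bary_eq : ∀ x, bary (e x) k = 1 - ∑ j, x j
  smooth : ∀ F : (Fin N → ℝ) → ℝ, IsSmooth F → IsSmooth (F ∘ e)
  exponent : ∑ j, gridExponent (fun j => α' j.castSucc) i j ≤ nashExponent α
  form_le : ∀ c : ℝ, 0 < c → ∃ C : ℝ, 0 < C ∧ ∀ F : (Fin N → ℝ) → ℝ, IsSmooth F →
    ∀ x ∈ cornerRegion (Fin N) c, chartForm i (coordDeriv (F ∘ e)) x ≤ C * carre F (e x)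

theorem isChart_reflect {α : Fin (N + 1) → ℝ} (hα : ∀ j, 0 < α j) (i : Fin N) :
    IsChart α i.castSucc (reflect i) i (swapLast α i) where
  pos j := hα _
  measurePreserving := measurePreserving_reflect α i
  mem _ hx := reflect_mem_openSimplex i hx
  invol := reflect_reflect i
  bary_eq x := by simp [reflect_self]
  smooth F hF := hF.comp_reflect i
  exponent := by
    rw [nashExponent, ← Finset.add_sum_erase _ _ (Finset.mem_univ i),
      ← Finset.add_sum_erase (s := Finset.univ) (a := i)
        (f := fun i : Fin N => max 1 (2 * α i.castSucc)) (Finset.mem_univ i)]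
    have h1 : gridExponent (fun j => swapLast α i j.castSucc) i i = max 1 (α (Fin.last N)) := by
      simp [gridExponent, swapLast_self]
    have h2 : ∀ j ∈ Finset.univ.erase i, gridExponent (fun j => swapLast α i j.castSucc) i j =
        max 1 (2 * α j.castSucc) := fun j hj => by
      have := Finset.ne_of_mem_erase hj
      simp [gridExponent, this, swapLast_of_ne α this]
    rw [h1, Finset.sum_congr rfl h2]
    -- In the reflected chart direction `i` carries the parameter `α_{N+1}`. The 1 on the right is
    -- bounded by `max 1 (2 α_i)`, which is how the chart exponent fits below `p_α`.
    have h3 : max 1 (α (Fin.last N)) ≤ 1 + max (α (Fin.last N) - 1) 0 := by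
      refine max_le (by linarith [le_max_right (α (Fin.last N) - 1) 0]) ?_
      linarith [le_max_left (α (Fin.last N) - 1) 0]
    linarith [le_max_left 1 (2 * α i.castSucc)]
  form_le c hc := ⟨3 / c + 2, by positivity, fun F hF x hx =>
    chartForm_comp_reflect_le hF i hc hx⟩

theorem isChart_id {α : Fin (N + 1) → ℝ} (hα : ∀ j, 0 < α j) (i : Fin N) :
    IsChart α (Fin.last N) id i α where
  pos := hα
  measurePreserving := MeasurePreserving.id _
  mem _ hx := hx
  invol _ := rfl
  bary_eq x := by simp
  smooth F hF := hF
  exponent := by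
    rw [nashExponent]
    refine le_trans (Finset.sum_le_sum fun j _ => ?_) (le_add_of_nonneg_right (le_max_right _ _))
    rw [gridExponent]
    split_ifs
    · exact max_le_max le_rfl (by linarith [hα j.castSucc])
    · exact le_rfl
  form_le c hc := ⟨1 / c, by positivity, fun F _ x hx => chartForm_le i hc hx⟩

theorem exists_chart [NeZero N] {α : Fin (N + 1) → ℝ} (hα : ∀ j, 0 < α j) (k : Fin (N + 1)) :
    ∃ e i α', IsChart α k e i α' := by
  induction k using Fin.lastCases with
  | last => exact ⟨_, _, _, isChart_id hα 0⟩
  | cast i => exact ⟨_, _, _, isChart_reflect hα i⟩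

/-- The part of the open simplex where the `k`-th barycentric coordinate is at least `c`. -/
def vertexRegion (k : Fin (N + 1)) (c : ℝ) : Set (Fin N → ℝ) :=
  {x | x ∈ openSimplex (Fin N) ∧ c ≤ bary x k}

theorem measurableSet_vertexRegion (k : Fin (N + 1)) (c : ℝ) :
    MeasurableSet (vertexRegion (N := N) k c) := by
  have hm : Measurable fun x : Fin N → ℝ => bary x k := by
    induction k using Fin.lastCases with
    | last => simp only [bary_last]; fun_prop
    | cast i => simp only [bary_castSucc]; fun_prop
  exact isOpen_openSimplex.measurableSet.inter (measurableSet_le measurable_const hm)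

theorem IsChart.preimage {α : Fin (N + 1) → ℝ} {k : Fin (N + 1)} {e : (Fin N → ℝ) → Fin N → ℝ}
    {i : Fin N} {α' : Fin (N + 1) → ℝ} (h : IsChart α k e i α') {c : ℝ} (hc : 0 < c) :
    e ⁻¹' vertexRegion k c = cornerRegion (Fin N) c := by
  ext x
  constructor
  · rintro ⟨h1, h2⟩
    have h3 := h.mem _ h1
    rw [h.invol] at h3
    rw [h.bary_eq] at h2
    exact ⟨h3.1, by linarith⟩
  · intro hx
    exact ⟨h.mem _ (cornerRegion_subset hc hx), by rw [h.bary_eq]; linarith [hx.2]⟩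

/-- The `N + 1` barycentric coordinates sum to 1, so they cannot all be below `c`. -/
theorem iUnion_vertexRegion {c : ℝ} (hc : (N + 1) * c ≤ 1) :
    openSimplex (Fin N) ⊆ ⋃ k ∈ (Finset.univ : Finset (Fin (N + 1))), vertexRegion k c := by
  intro x hx
  by_contra hcon
  simp only [Finset.mem_univ, Set.iUnion_true, Set.mem_iUnion, not_exists] at hcon
  have hlt : ∀ k, bary x k < c := fun k => lt_of_not_ge fun h => hcon k ⟨hx, h⟩
  have := Finset.sum_lt_sum_of_nonempty (s := (Finset.univ : Finset (Fin (N + 1))))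
    ⟨0, Finset.mem_univ _⟩ fun k _ => hlt k
  rw [sum_bary] at this
  simp at this
  linarith

/-- The energy as an extended nonnegative number. -/
def energy (α : Fin (N + 1) → ℝ) (F : (Fin N → ℝ) → ℝ) : ℝ≥0∞ :=
  ∫⁻ x, ENNReal.ofReal (carre F x) ∂dirichletMeasure α

theorem IsChart.lintegral_comp_le {α : Fin (N + 1) → ℝ} {k : Fin (N + 1)}
    {e : (Fin N → ℝ) → Fin N → ℝ} {i : Fin N} {α' : Fin (N + 1) → ℝ} (h : IsChart α k e i α')
    {c : ℝ} (hc : 0 < c) :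
    ∃ κ : ℝ≥0∞, κ ≠ ∞ ∧ ∀ H : (Fin N → ℝ) → ℝ≥0∞, Measurable H →
      ∫⁻ x in cornerRegion (Fin N) c, H (e x) ∂powPi (fun j => α' j.castSucc) ≤
        κ * ∫⁻ x, H x ∂dirichletMeasure α := by
  obtain ⟨κ, hκ, hcomp⟩ := exists_dirichlet_comparison h.pos hc
  refine ⟨κ, hκ, fun H hH => ?_⟩
  refine (hcomp _ (measurableSet_cornerRegion c) subset_rfl _).2.trans ?_
  rw [← h.measurePreserving.lintegral_comp hH]
  gcongr
  exact Measure.restrict_le_self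

theorem IsChart.energy_le {α : Fin (N + 1) → ℝ} {k : Fin (N + 1)}
    {e : (Fin N → ℝ) → Fin N → ℝ} {i : Fin N} {α' : Fin (N + 1) → ℝ} (h : IsChart α k e i α')
    {c : ℝ} (hc : 0 < c) :
    ∃ κ : ℝ≥0∞, κ ≠ ∞ ∧ ∀ F : (Fin N → ℝ) → ℝ, IsSmooth F →
      ∫⁻ x in cornerRegion (Fin N) c, ENNReal.ofReal (chartForm i (coordDeriv (F ∘ e)) x)
        ∂powPi (fun j => α' j.castSucc) ≤ κ * energy α F := by
  obtain ⟨κ, hκ, H⟩ := h.lintegral_comp_le hc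
  obtain ⟨C, hC, hform⟩ := h.form_le c hc
  refine ⟨ENNReal.ofReal C * κ, ENNReal.mul_ne_top ENNReal.ofReal_ne_top hκ, fun F hF => ?_⟩
  calc _ ≤ ∫⁻ x in cornerRegion (Fin N) c, ENNReal.ofReal C * ENNReal.ofReal (carre F (e x))
        ∂powPi (fun j => α' j.castSucc) := by
        refine setLIntegral_mono' (measurableSet_cornerRegion c) fun x hx => ?_
        rw [← ENNReal.ofReal_mul hC.le]
        exact ENNReal.ofReal_le_ofReal (hform F hF x hx)
    _ = ENNReal.ofReal C * ∫⁻ x in cornerRegion (Fin N) c, ENNReal.ofReal (carre F (e x))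
        ∂powPi (fun j => α' j.castSucc) := lintegral_const_mul' _ _ ENNReal.ofReal_ne_top
    _ ≤ ENNReal.ofReal C * (κ * energy α F) := by
        gcongr
        exact H _ (measurable_carre F).ennreal_ofReal
    _ = _ := by ring

theorem exists_superPoincare_vertex {α : Fin (N + 1) → ℝ}
    {k : Fin (N + 1)} {e : (Fin N → ℝ) → Fin N → ℝ} {i : Fin N} {α' : Fin (N + 1) → ℝ}
    (h : IsChart α k e i α') {c : ℝ} (hc : 0 < c) :
    ∃ C : ℝ≥0∞, C ≠ ∞ ∧ ∃ r₀ : ℝ, 0 < r₀ ∧ ∀ r : ℝ, 0 < r → r ≤ r₀ →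
      ∀ F : (Fin N → ℝ) → ℝ, IsSmooth F →
      ∫⁻ x in vertexRegion k c, ENNReal.ofReal (F x ^ 2) ∂dirichletMeasure α ≤
        C * (ENNReal.ofReal r * energy α F + ENNReal.ofReal (r ^ (-nashExponent α)) *
          (∫⁻ x, ENNReal.ofReal |F x| ∂dirichletMeasure α) ^ 2) := by
  obtain ⟨κ₁, hκ₁, h1⟩ := exists_dirichlet_comparison h.pos hc
  obtain ⟨κ₂, hκ₂, h2⟩ := h.lintegral_comp_le (half_pos hc)
  obtain ⟨κ₃, hκ₃, h3⟩ := h.energy_le (half_pos hc)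
  obtain ⟨C, r₀, hC, hr₀, hr₁, h4⟩ :=
    exists_superPoincare_chart (β := fun j => α' j.castSucc) (fun j => h.pos _) i hc
  refine ⟨κ₁ * ENNReal.ofReal C * (κ₃ + κ₂ ^ 2), by finiteness, r₀, hr₀,
    fun r hr hrr F hF => ?_⟩
  rw [← h.measurePreserving.setLIntegral_comp_preimage (measurableSet_vertexRegion k c)
    (hF.measurable.pow_const 2).ennreal_ofReal, h.preimage hc]
  refine (h1 _ (measurableSet_cornerRegion c) subset_rfl _).1.trans ?_
  rw [mul_assoc, mul_assoc]
  gcongr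
  refine (h4 r hr hrr _ (h.smooth F hF)).trans ?_
  -- Since `r ≤ 1`, the exponent of the chart may be raised to `p_α`; the same exponent then serves
  -- at all vertices.
  have e1 : r ^ (-∑ j, gridExponent (fun j => α' j.castSucc) i j) ≤ r ^ (-nashExponent α) :=
    Real.rpow_le_rpow_of_exponent_ge hr (hrr.trans hr₁) (neg_le_neg h.exponent)
  have e2 := h2 _ hF.measurable.abs.ennreal_ofReal
  set T := ∫⁻ x, ENNReal.ofReal |F x| ∂dirichletMeasure α
  calc _ ≤ ENNReal.ofReal (C * r) * (κ₃ * energy α F) +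
        ENNReal.ofReal (C * r ^ (-nashExponent α)) * (κ₂ * T) ^ 2 := by
        gcongr
        · exact h3 F hF
        · exact e2
    _ = ENNReal.ofReal C * (κ₃ * (ENNReal.ofReal r * energy α F) +
        κ₂ ^ 2 * (ENNReal.ofReal (r ^ (-nashExponent α)) * T ^ 2)) := by
        rw [ENNReal.ofReal_mul hC.le, ENNReal.ofReal_mul hC.le]
        ring
    _ ≤ ENNReal.ofReal C * ((κ₃ + κ₂ ^ 2) * (ENNReal.ofReal r * energy α F) +
        (κ₃ + κ₂ ^ 2) * (ENNReal.ofReal (r ^ (-nashExponent α)) * T ^ 2)) := by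
        gcongr
        · exact le_self_add
        · exact le_add_self
    _ = _ := by ring

theorem setLIntegral_biUnion_le {X κ : Type*} [MeasurableSpace X] (μ : Measure X) (s : Finset κ)
    (A : κ → Set X) (H : X → ℝ≥0∞) :
    ∫⁻ x in ⋃ k ∈ s, A k, H x ∂μ ≤ ∑ k ∈ s, ∫⁻ x in A k, H x ∂μ := by
  classical
  induction s using Finset.induction with
  | empty => simp
  | insert k s hk ih =>
    rw [Finset.set_biUnion_insert, Finset.sum_insert hk]
    exact (lintegral_union_le _ _ _).trans (by gcongr)

theorem restrict_openSimplex [NeZero N] (α : Fin (N + 1) → ℝ) :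
    (dirichletMeasure α).restrict (openSimplex (Fin N)) = dirichletMeasure α :=
  Measure.restrict_eq_self_of_ae_mem (ae_mem_openSimplex α)

/-- The super Poincaré inequality for the Dirichlet distribution. -/
theorem exists_superPoincare [NeZero N] {α : Fin (N + 1) → ℝ} (hα : ∀ j, 0 < α j) :
    ∃ C : ℝ≥0∞, C ≠ ∞ ∧ ∃ r₀ : ℝ, 0 < r₀ ∧ ∀ r : ℝ, 0 < r → r ≤ r₀ →
      ∀ F : (Fin N → ℝ) → ℝ, IsSmooth F →
      ∫⁻ x, ENNReal.ofReal (F x ^ 2) ∂dirichletMeasure α ≤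
        C * (ENNReal.ofReal r * energy α F + ENNReal.ofReal (r ^ (-nashExponent α)) *
          (∫⁻ x, ENNReal.ofReal |F x| ∂dirichletMeasure α) ^ 2) := by
  choose e i α' hchart using exists_chart hα
  have hc : (0 : ℝ) < 1 / (N + 1) := by positivity
  choose C hC r₀ hr₀ H using fun k => exists_superPoincare_vertex (hchart k) hc
  refine ⟨∑ k, C k, ENNReal.sum_ne_top.2 fun k _ => hC k, Finset.univ.inf' ⟨0, Finset.mem_univ _⟩ r₀,
    (Finset.lt_inf'_iff _).2 fun k _ => hr₀ k, fun r hr hrr F hF => ?_⟩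
  calc ∫⁻ x, ENNReal.ofReal (F x ^ 2) ∂dirichletMeasure α
      = ∫⁻ x in openSimplex (Fin N), ENNReal.ofReal (F x ^ 2) ∂dirichletMeasure α := by
        rw [restrict_openSimplex]
    _ ≤ ∑ k, ∫⁻ x in vertexRegion k (1 / (N + 1)), ENNReal.ofReal (F x ^ 2) ∂dirichletMeasure α :=
        (lintegral_mono_set (iUnion_vertexRegion (by field_simp; rfl))).trans
          (setLIntegral_biUnion_le _ _ _ _)
    _ ≤ _ := by
        rw [Finset.sum_mul]
        exact Finset.sum_le_sum fun k _ =>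
          H k r hr (hrr.trans (Finset.inf'_le _ (Finset.mem_univ k))) F hF

end Global

/-! ### Global Poincaré inequality and optimization to a Nash inequality -/

section Poincare

variable {N : ℕ}

theorem setOsc_preimage {X Y : Type*} [MeasurableSpace X] [MeasurableSpace Y] {μ : Measure X}
    {ν : Measure Y} [SFinite μ] [SFinite ν] {e : X → Y} (he : MeasurePreserving e μ ν) {F : Y → ℝ}
    (hF : Measurable F) {A : Set Y} (hA : MeasurableSet A) :
    setOsc ν F A A = setOsc μ (F ∘ e) (e ⁻¹' A) (e ⁻¹' A) := by
  have hm2 : Measurable fun p : Y × Y => ENNReal.ofReal ((F p.2 - F p.1) ^ 2) :=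
    (((hF.comp measurable_snd).sub (hF.comp measurable_fst)).pow_const 2).ennreal_ofReal
  have hm : ∀ x, Measurable fun y => ENNReal.ofReal ((F y - x) ^ 2) := fun a =>
    ((hF.sub_const a).pow_const 2).ennreal_ofReal
  rw [setOsc, ← he.setLIntegral_comp_preimage hA hm2.lintegral_prod_right']
  refine lintegral_congr fun x => ?_
  exact (he.setLIntegral_comp_preimage hA (hm (F (e x)))).symm

instance (α : Fin (N + 1) → ℝ) : SigmaFinite (dirichletMeasure α) :=
  SigmaFinite.withDensity_ofReal _

theorem exists_poincare_vertex {α : Fin (N + 1) → ℝ} {k : Fin (N + 1)}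
    {e : (Fin N → ℝ) → Fin N → ℝ} {i : Fin N} {α' : Fin (N + 1) → ℝ}
    (h : IsChart α k e i α') {c : ℝ} (hc : 0 < c) (hc1 : c < 1) :
    dirichletMeasure α (vertexRegion k c) ≠ ∞ ∧
    ∃ C : ℝ≥0∞, C ≠ ∞ ∧ ∀ F : (Fin N → ℝ) → ℝ, IsSmooth F →
      setOsc (dirichletMeasure α) F (vertexRegion k c) (vertexRegion k c) ≤ C * energy α F := by
  obtain ⟨κ₁, hκ₁, h1⟩ := exists_dirichlet_comparison h.pos hc
  obtain ⟨κ₃, hκ₃, h3⟩ := h.energy_le (half_pos hc)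
  obtain ⟨hfin, C, hC, h4⟩ :=
    exists_poincare_chart (β := fun j => α' j.castSucc) (fun j => h.pos _) i hc hc1
  have hU := measurableSet_cornerRegion (ι := Fin N) c
  constructor
  · rw [← h.measurePreserving.measure_preimage
      (measurableSet_vertexRegion k c).nullMeasurableSet, h.preimage hc]
    have := (h1 _ hU subset_rfl fun _ => 1).1
    simp only [lintegral_one, Measure.restrict_apply_univ] at this
    exact (this.trans_lt (ENNReal.mul_ne_top hκ₁ hfin).lt_top).ne
  · refine ⟨κ₁ * (κ₁ * (C * κ₃)), by finiteness, fun F hF => ?_⟩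
    rw [setOsc_preimage h.measurePreserving hF.measurable (measurableSet_vertexRegion k c),
      h.preimage hc]
    have h5 := h4 _ (h.smooth F hF)
    calc _ ≤ κ₁ * ∫⁻ x in cornerRegion (Fin N) c, ∫⁻ y in cornerRegion (Fin N) c,
          ENNReal.ofReal (((F ∘ e) y - (F ∘ e) x) ^ 2) ∂dirichletMeasure α'
            ∂powPi (fun j => α' j.castSucc) := (h1 _ hU subset_rfl _).1
      _ ≤ κ₁ * ∫⁻ x in cornerRegion (Fin N) c, κ₁ * ∫⁻ y in cornerRegion (Fin N) c,
          ENNReal.ofReal (((F ∘ e) y - (F ∘ e) x) ^ 2) ∂powPi (fun j => α' j.castSucc)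
            ∂powPi (fun j => α' j.castSucc) := by
          gcongr with x
          exact (h1 _ hU subset_rfl _).1
      _ = κ₁ * (κ₁ * setOsc (powPi fun j => α' j.castSucc) (F ∘ e) (cornerRegion (Fin N) c)
          (cornerRegion (Fin N) c)) := by
          rw [lintegral_const_mul' _ _ hκ₁, setOsc]
      _ ≤ κ₁ * (κ₁ * (C * (κ₃ * energy α F))) := by
          gcongr
          refine h5.trans ?_
          gcongr
          exact h3 F hF
      _ = _ := by ring

/-- With half the covering constant, all vertex regions contain the box with sides `(1/(2(N+1)),
1/(N+1)]`. This is the common part along which the local Poincaré inequalities are glued. -/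
theorem dirichletMeasure_inter_ne_zero [NeZero N] {α : Fin (N + 1) → ℝ} (hα : ∀ j, 0 < α j) :
    dirichletMeasure α (⋂ k, vertexRegion k (1 / (2 * (N + 1)))) ≠ 0 := by
  have hc : (0 : ℝ) < 1 / (N + 1) := by positivity
  have hc2 : (1 : ℝ) / (2 * (N + 1)) = 1 / 2 * (1 / (N + 1)) := by field_simp
  set a : Fin N → ℝ := fun _ => 1 / (2 * (N + 1)) with ha
  set b : Fin N → ℝ := fun _ => 1 / (N + 1) with hb
  have hcell : ∀ j, IsCell (a j) (b j) := fun j =>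
    ⟨by positivity, by simp only [ha, hb]; linarith, Or.inr (by simp only [ha, hb]; linarith)⟩
  have hsum : ∑ j, b j ≤ 1 - 1 / (N + 1) := by
    simp only [hb, Finset.sum_const, Finset.card_univ, Fintype.card_fin, nsmul_eq_mul]
    rw [le_sub_iff_add_le]
    field_simp
    rfl
  have hU : box a b ⊆ cornerRegion (Fin N) (1 / (N + 1)) :=
    box_subset_cornerRegion (fun j => (hcell j).nonneg) hsum
  have hsub : box a b ⊆ ⋂ k, vertexRegion k (1 / (2 * (N + 1))) := by
    intro x hx
    refine Set.mem_iInter.2 fun k => ⟨cornerRegion_subset hc (hU hx), ?_⟩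
    induction k using Fin.lastCases with
    | last => rw [bary_last]; linarith [(hU hx).2]
    | cast i => rw [bary_castSucc]; exact (hx i trivial).1.le
  obtain ⟨κ, hκ, h⟩ := exists_dirichlet_comparison hα hc
  have h1 := (h _ (measurableSet_box a b) hU fun _ => 1).2
  simp only [lintegral_one, Measure.restrict_apply_univ] at h1
  intro h0
  rw [measure_mono_null hsub h0, mul_zero] at h1
  exact powPi_box_ne_zero (fun j : Fin N => hα j.castSucc) hcell (le_antisymm h1 zero_le)

theorem iUnion_vertexRegion_half :
    openSimplex (Fin N) ⊆ ⋃ k ∈ (Finset.univ : Finset (Fin (N + 1))),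
      vertexRegion k (1 / (2 * (N + 1))) :=
  iUnion_vertexRegion (by field_simp; norm_num)

/-- The Poincaré inequality for the Dirichlet distribution. -/
theorem exists_poincare [NeZero N] {α : Fin (N + 1) → ℝ} (hα : ∀ j, 0 < α j) :
    dirichletMeasure α Set.univ ≠ ∞ ∧
    ∃ C : ℝ≥0∞, C ≠ ∞ ∧ ∀ F : (Fin N → ℝ) → ℝ, IsSmooth F →
      setOsc (dirichletMeasure α) F Set.univ Set.univ ≤ C * energy α F := by
  choose e i α' hchart using exists_chart hα
  have hc : (0 : ℝ) < 1 / (2 * (N + 1)) := by positivity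
  have hc1 : (1 : ℝ) / (2 * (N + 1)) < 1 := by
    rw [div_lt_one (by positivity)]
    linarith [(Nat.cast_nonneg N : (0 : ℝ) ≤ N)]
  choose hfin C hC H using fun k => exists_poincare_vertex (hchart k) hc hc1
  have hcov := iUnion_vertexRegion_half (N := N)
  constructor
  · have hO : dirichletMeasure α Set.univ = dirichletMeasure α (openSimplex (Fin N)) := by
      conv_lhs => rw [← restrict_openSimplex α, Measure.restrict_apply_univ]
    rw [hO]
    refine ((measure_mono hcov).trans (measure_biUnion_finset_le Finset.univ _)).trans_lt ?_ |>.ne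
    exact (ENNReal.sum_ne_top.2 fun k _ => hfin k).lt_top
  · obtain ⟨C', hC', H'⟩ := exists_setOsc_biUnion_le (dirichletMeasure α) Finset.univ
      (fun k => vertexRegion k (1 / (2 * (N + 1)))) _ (dirichletMeasure_inter_ne_zero hα)
      (fun k _ => Set.iInter_subset _ k) (fun k _ => hfin k)
    refine ⟨C' * ∑ k, C k, ENNReal.mul_ne_top hC' (ENNReal.sum_ne_top.2 fun k _ => hC k),
      fun F hF => ?_⟩
    have : setOsc (dirichletMeasure α) F Set.univ Set.univ =
        setOsc (dirichletMeasure α) F (openSimplex (Fin N)) (openSimplex (Fin N)) := by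
      simp only [setOsc, restrict_openSimplex, Measure.restrict_univ]
    rw [this, mul_assoc, Finset.sum_mul]
    refine (setOsc_mono hcov hcov).trans ((H' F hF.measurable).trans ?_)
    gcongr with k
    exact H k F hF

theorem isFiniteMeasure_dirichletMeasure [NeZero N] {α : Fin (N + 1) → ℝ} (hα : ∀ j, 0 < α j) :
    IsFiniteMeasure (dirichletMeasure α) := ⟨(exists_poincare hα).1.lt_top⟩

theorem dirichletMeasure_univ_pos [NeZero N] {α : Fin (N + 1) → ℝ} (hα : ∀ j, 0 < α j) :
    0 < (dirichletMeasure α).real Set.univ := by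
  have := isFiniteMeasure_dirichletMeasure hα
  refine ENNReal.toReal_pos (fun h => dirichletMeasure_inter_ne_zero hα ?_) (measure_ne_top _ _)
  exact measure_mono_null (Set.subset_univ _) h

/-- Optimization of the parameter of a super Poincaré inequality. -/
theorem nash_of_superPoincare {p C₁ C₂ r₀ A E T : ℝ} (hp : 0 < p)
    (hC₂ : 0 < C₂) (hr₀ : 0 < r₀) (hE : 0 ≤ E) (hT : 0 ≤ T)
    (h1 : ∀ r, 0 < r → r ≤ r₀ → A ≤ C₁ * (r * E + r ^ (-p) * T ^ 2)) (h2 : T ^ 2 ≤ C₂ * E) :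
    A ≤ C₁ * (r₀ + r₀ ^ (-p) * C₂) * C₂ ^ (-(1 / (p + 1))) *
      E ^ (p / (p + 1)) * T ^ (2 / (p + 1)) := by
  -- If `T = 0` there is no optimal `r`; letting `r → 0` gives `A ≤ 0`.
  rcases hT.eq_or_lt with rfl | hT
  · rw [Real.zero_rpow (by positivity), mul_zero]
    have hlim : Tendsto (fun r : ℝ => C₁ * (r * E)) (𝓝[>] 0) (𝓝 (C₁ * (0 * E))) :=
      ((by fun_prop : Continuous fun r : ℝ => C₁ * (r * E)).tendsto 0).mono_left
        nhdsWithin_le_nhds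
    have := ge_of_tendsto hlim (b := A) (by
      filter_upwards [Ioo_mem_nhdsGT hr₀] with r hr
      simpa using h1 r hr.1 hr.2.le)
    simpa using this
  have hE0 : 0 < E := by
    by_contra hcon
    have : E = 0 := le_antisymm (not_lt.1 hcon) hE
    rw [this] at h2
    nlinarith
  -- With `r = r₀ q` both terms become multiples of `E q`. The Poincaré bound `h2` is what gives `q
  -- ≤ 1`, so that this `r` is admissible.
  set q : ℝ := (T ^ 2 / (C₂ * E)) ^ (1 / (p + 1)) with hq
  have hq0 : 0 < q := by positivity
  have hq1 : q ≤ 1 := Real.rpow_le_one (by positivity)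
    (div_le_one_of_le₀ h2 (by positivity)) (by positivity)
  have hqp : q ^ (-p) * T ^ 2 = C₂ * E * q := by
    have : q ^ (p + 1) = T ^ 2 / (C₂ * E) := by
      rw [hq, ← Real.rpow_mul (by positivity), one_div, inv_mul_cancel₀ (by positivity),
        Real.rpow_one]
    have hT2 : T ^ 2 = C₂ * E * q ^ (p + 1) := by rw [this]; field_simp
    rw [hT2, Real.rpow_add_one hq0.ne', Real.rpow_neg hq0.le]
    have := Real.rpow_pos_of_pos hq0 p
    field_simp
  have hEq : E * q = C₂ ^ (-(1 / (p + 1))) * E ^ (p / (p + 1)) * T ^ (2 / (p + 1)) := by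
    rw [hq, Real.div_rpow (by positivity) (by positivity), Real.mul_rpow hC₂.le hE,
      Real.rpow_neg hC₂.le, ← Real.rpow_natCast, ← Real.rpow_mul hT.le]
    have e1 : E ^ (p / (p + 1)) = E / E ^ (1 / (p + 1)) := by
      rw [show p / (p + 1) = 1 - 1 / (p + 1) by field_simp; ring, Real.rpow_sub hE0, Real.rpow_one]
    rw [e1, show ((2 : ℕ) : ℝ) * (1 / (p + 1)) = 2 / (p + 1) by push_cast; ring]
    have := Real.rpow_pos_of_pos hC₂ (1 / (p + 1))
    have := Real.rpow_pos_of_pos hE0 (1 / (p + 1))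
    field_simp
  refine (h1 (r₀ * q) (by positivity) (mul_le_of_le_one_right hr₀.le hq1)).trans (le_of_eq ?_)
  rw [Real.mul_rpow hr₀.le hq0.le, mul_assoc _ (q ^ (-p)), hqp]
  calc _ = C₁ * (r₀ + r₀ ^ (-p) * C₂) * (E * q) := by ring
    _ = _ := by rw [hEq]; ring

end Poincare

/-! ### The two gradient forms on `C¹` functions -/

section Core

variable {N : ℕ}

theorem convex_simplex : Convex ℝ (simplex N) := by
  have : simplex N = (⋂ j, {x : Fin N → ℝ | x j ∈ Set.Icc (0 : ℝ) 1}) ∩ {x | ∑ j, x j ≤ 1} := by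
    ext x; simp [simplex]
  rw [this]
  refine (convex_iInter fun j => ?_).inter ?_
  · exact (convex_Icc (0 : ℝ) 1).is_linear_preimage (f := fun x : Fin N → ℝ => x j)
      ⟨fun _ _ => rfl, fun _ _ => rfl⟩
  · exact (convex_Iic (1 : ℝ)).is_linear_preimage (f := fun x : Fin N → ℝ => ∑ j, x j)
      ⟨fun _ _ => by simp [Finset.sum_add_distrib], fun _ _ => by simp [Finset.mul_sum]⟩

theorem isCompact_simplex : IsCompact (simplex N) := by
  have : simplex N = (Set.univ.pi fun _ => Set.Icc (0 : ℝ) 1) ∩ {x | ∑ j, x j ≤ 1} := by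
    ext x
    simp only [simplex, Set.mem_ofPred_eq, Set.mem_inter_iff, Set.mem_univ_pi]
  rw [this]
  exact (isCompact_univ_pi fun _ => isCompact_Icc).inter_right
    (isClosed_le (by fun_prop) continuous_const)

theorem nonempty_openSimplex : (openSimplex (Fin N)).Nonempty := by
  refine ⟨fun _ => 1 / (N + 1), fun j => by positivity, ?_⟩
  simp only [Finset.sum_const, Finset.card_univ, Fintype.card_fin, nsmul_eq_mul]
  rw [← mul_div_assoc, mul_one, div_lt_one (by positivity)]
  linarith

theorem uniqueDiffOn_simplex : UniqueDiffOn ℝ (simplex N) :=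
  uniqueDiffOn_convex convex_simplex (nonempty_openSimplex.mono
    (interior_maximal openSimplex_subset isOpen_openSimplex))

theorem integrable_of_continuousOn [NeZero N] {α : Fin (N + 1) → ℝ} (hα : ∀ j, 0 < α j)
    {g : (Fin N → ℝ) → ℝ} (hg : ContinuousOn g (simplex N)) :
    Integrable g (dirichletMeasure α) := by
  have := isFiniteMeasure_dirichletMeasure hα
  obtain ⟨K, hK⟩ := isCompact_simplex.exists_bound_of_continuousOn hg
  refine Integrable.of_bound (C := K) ?_ ?_
  · exact (hg.aestronglyMeasurable measurableSet_simplex).mono_ac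
      (withDensity_absolutelyContinuous _ _)
  · filter_upwards [ae_mem_openSimplex α] with x hx
    exact hK x (openSimplex_subset hx)

theorem continuousOn_partialDeriv {f : (Fin N → ℝ) → ℝ} (hf : f ∈ C1 N) (i : Fin N) :
    ContinuousOn (partialDeriv i f) (simplex N) :=
  (ContDiffOn.continuousOn_fderivWithin (n := 1) hf uniqueDiffOn_simplex (by norm_num)).clm_apply
    continuousOn_const

theorem sub_mem_C1 {f g : (Fin N → ℝ) → ℝ} (hf : f ∈ C1 N) (hg : g ∈ C1 N) : f - g ∈ C1 N :=
  ContDiffOn.sub hf hg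

theorem partialDeriv_sub {f g : (Fin N → ℝ) → ℝ} (hf : f ∈ C1 N) (hg : g ∈ C1 N) (i : Fin N)
    {x : Fin N → ℝ} (hx : x ∈ simplex N) :
    partialDeriv i (f - g) x = partialDeriv i f x - partialDeriv i g x := by
  have h1 : DifferentiableWithinAt ℝ f (simplex N) x :=
    (ContDiffOn.differentiableOn hf (by norm_num)) x hx
  have h2 : DifferentiableWithinAt ℝ g (simplex N) x :=
    (ContDiffOn.differentiableOn hg (by norm_num)) x hx
  rw [partialDeriv, fderivWithin_sub (uniqueDiffOn_simplex x hx) h1 h2]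
  rfl

theorem const_mem_C1 (c : ℝ) : (fun _ => c) ∈ C1 N := contDiffOn_const

theorem partialDeriv_const (c : ℝ) (i : Fin N) (x : Fin N → ℝ) :
    partialDeriv i (fun _ => c) x = 0 := by
  simp [partialDeriv]

/-- A pointwise positive semidefinite form in the gradient, integrated against the Dirichlet
distribution. -/
def gradForm (α : Fin (N + 1) → ℝ) (a : (Fin N → ℝ) → Fin N → Fin N → ℝ)
    (f g : (Fin N → ℝ) → ℝ) : ℝ :=
  ∫ x, ∑ i, ∑ j, a x i j * (partialDeriv i f x * partialDeriv j g x) ∂dirichletMeasure α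

/-- The coefficients of the multivariate Dirichlet diffusion. -/
def multivariateCoeff (x : Fin N → ℝ) (i j : Fin N) : ℝ :=
  if i = j then x i * (1 - ∑ k, x k) else 0

/-- The coefficients of the Fleming–Viot process. -/
def flemingViotCoeff (x : Fin N → ℝ) (i j : Fin N) : ℝ := x i * ((if i = j then 1 else 0) - x j)

theorem multivariateForm_eq (α : Fin (N + 1) → ℝ) :
    multivariateForm α = gradForm α multivariateCoeff := by
  ext f g
  simp [multivariateForm, gradForm, multivariateCoeff, ite_mul]

theorem flemingViotForm_eq (α : Fin (N + 1) → ℝ) :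
    flemingViotForm α = gradForm α flemingViotCoeff := rfl

theorem sq_sum_mul_le (x ξ : Fin N → ℝ) (hx : x ∈ simplex N) :
    (∑ i, x i * ξ i) ^ 2 ≤ (∑ i, x i) * ∑ i, x i * ξ i ^ 2 := by
  refine Finset.sum_sq_le_sum_mul_sum_of_sq_le_mul _ (fun i _ => (hx.1 i).1)
    (fun i _ => mul_nonneg (hx.1 i).1 (sq_nonneg _)) fun i _ => le_of_eq ?_
  ring

theorem sum_flemingViotCoeff (x ξ : Fin N → ℝ) :
    ∑ i, ∑ j, flemingViotCoeff x i j * (ξ i * ξ j) = ∑ i, x i * ξ i ^ 2 - (∑ i, x i * ξ i) ^ 2 := by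
  have h1 : ∀ i j, flemingViotCoeff x i j * (ξ i * ξ j) =
      (if i = j then x i * (ξ i * ξ j) else 0) - (x i * ξ i) * (x j * ξ j) := by
    intro i j
    unfold flemingViotCoeff
    split_ifs <;> ring
  simp_rw [h1, Finset.sum_sub_distrib]
  congr 1
  · simp [sq]
  · rw [sq, Finset.sum_mul_sum]

theorem sum_multivariateCoeff (x ξ : Fin N → ℝ) :
    ∑ i, ∑ j, multivariateCoeff x i j * (ξ i * ξ j) = ∑ i, x i * (1 - ∑ k, x k) * ξ i ^ 2 := by
  simp [multivariateCoeff, ite_mul, sq]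

/-- The difference of the forms is `|x|_1 ∑ x_i ξ_i² - (∑ x_i ξ_i)²`, nonnegative by Cauchy–Schwarz.
Upper bounds for the exponent of the multivariate diffusion therefore hold for Fleming–Viot as well.
-/
theorem sum_multivariateCoeff_le (x ξ : Fin N → ℝ) (hx : x ∈ simplex N) :
    ∑ i, ∑ j, multivariateCoeff x i j * (ξ i * ξ j) ≤
      ∑ i, ∑ j, flemingViotCoeff x i j * (ξ i * ξ j) := by
  rw [sum_multivariateCoeff, sum_flemingViotCoeff]
  have h1 : ∑ i, x i * (1 - ∑ k, x k) * ξ i ^ 2 = (1 - ∑ k, x k) * ∑ i, x i * ξ i ^ 2 := by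
    rw [Finset.mul_sum]
    exact Finset.sum_congr rfl fun i _ => by ring
  rw [h1]
  linarith [sq_sum_mul_le x ξ hx]

/-- The properties of the coefficients of a form that give a Nash inequality. -/
structure IsAdmissible (a : (Fin N → ℝ) → Fin N → Fin N → ℝ) : Prop where
  continuous : ∀ i j, Continuous fun x => a x i j
  le : ∀ x ξ : Fin N → ℝ, x ∈ simplex N → ∑ i, ∑ j, multivariateCoeff x i j * (ξ i * ξ j) ≤
    ∑ i, ∑ j, a x i j * (ξ i * ξ j)

theorem isAdmissible_multivariateCoeff : IsAdmissible (multivariateCoeff (N := N)) where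
  continuous i j := by
    unfold multivariateCoeff
    split_ifs <;> fun_prop
  le _ _ _ := le_rfl

theorem isAdmissible_flemingViotCoeff : IsAdmissible (flemingViotCoeff (N := N)) where
  continuous i j := by unfold flemingViotCoeff; fun_prop
  le := sum_multivariateCoeff_le

variable {a : (Fin N → ℝ) → Fin N → Fin N → ℝ}

theorem IsAdmissible.nonneg (ha : IsAdmissible a) (x ξ : Fin N → ℝ) (hx : x ∈ simplex N) :
    0 ≤ ∑ i, ∑ j, a x i j * (ξ i * ξ j) := by
  refine le_trans ?_ (ha.le x ξ hx)
  rw [sum_multivariateCoeff]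
  refine Finset.sum_nonneg fun i _ => ?_
  have h1 := (hx.1 i).1
  have h2 : 0 ≤ 1 - ∑ k, x k := by linarith [hx.2]
  positivity

theorem IsAdmissible.integrable [NeZero N] {α : Fin (N + 1) → ℝ} (hα : ∀ j, 0 < α j)
    (ha : IsAdmissible a) {f g : (Fin N → ℝ) → ℝ} (hf : f ∈ C1 N) (hg : g ∈ C1 N) :
    Integrable (fun x => ∑ i, ∑ j, a x i j * (partialDeriv i f x * partialDeriv j g x))
      (dirichletMeasure α) := by
  have h1 := continuousOn_partialDeriv hf
  have h2 := continuousOn_partialDeriv hg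
  have h3 := ha.continuous
  exact integrable_of_continuousOn hα (by fun_prop)

theorem ae_mem_simplex [NeZero N] (α : Fin (N + 1) → ℝ) :
    ∀ᵐ x ∂dirichletMeasure α, x ∈ simplex N := by
  filter_upwards [ae_mem_openSimplex α] with x hx using openSimplex_subset hx

theorem IsAdmissible.gradForm_nonneg [NeZero N] (α : Fin (N + 1) → ℝ) (ha : IsAdmissible a)
    (f : (Fin N → ℝ) → ℝ) : 0 ≤ gradForm α a f f := by
  refine integral_nonneg_of_ae ?_
  filter_upwards [ae_mem_simplex α] with x hx
  exact ha.nonneg x (fun i => partialDeriv i f x) hx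

/-- The quadratic form of a difference is controlled as for a seminorm. -/
theorem IsAdmissible.gradForm_sub_le [NeZero N] {α : Fin (N + 1) → ℝ} (hα : ∀ j, 0 < α j)
    (ha : IsAdmissible a) {f g : (Fin N → ℝ) → ℝ} (hf : f ∈ C1 N) (hg : g ∈ C1 N) {t : ℝ}
    (ht : 0 < t) :
    gradForm α a f f ≤ (1 + t) * gradForm α a g g + (1 + t⁻¹) * gradForm α a (f - g) (f - g) := by
  have i1 := ha.integrable hα hf hf
  have i2 := ha.integrable hα hg hg
  have i3 := ha.integrable hα (sub_mem_C1 hf hg) (sub_mem_C1 hf hg)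
  rw [gradForm, gradForm, gradForm, ← integral_const_mul, ← integral_const_mul,
    ← integral_add (i2.const_mul _) (i3.const_mul _)]
  refine integral_mono_ae i1 ((i2.const_mul _).add (i3.const_mul _)) ?_
  filter_upwards [ae_mem_simplex α] with x hx
  set ξ : Fin N → ℝ := fun i => partialDeriv i f x
  set η : Fin N → ℝ := fun i => partialDeriv i g x
  have hd : ∀ i, partialDeriv i (f - g) x = ξ i - η i := fun i => partialDeriv_sub hf hg i hx
  simp only [hd]
  -- The slack in the inequality is exactly `t⁻¹` times the form at `t η - (ξ - η)`.
  have key := ha.nonneg x (fun i => t * η i - (ξ i - η i)) hx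
  have e : (1 + t) * ∑ i, ∑ j, a x i j * (η i * η j) +
      (1 + t⁻¹) * ∑ i, ∑ j, a x i j * ((ξ i - η i) * (ξ j - η j)) -
      ∑ i, ∑ j, a x i j * (ξ i * ξ j) =
      t⁻¹ * ∑ i, ∑ j, a x i j * ((t * η i - (ξ i - η i)) * (t * η j - (ξ j - η j))) := by
    simp only [Finset.mul_sum, ← Finset.sum_add_distrib, ← Finset.sum_sub_distrib]
    refine Finset.sum_congr rfl fun i _ => Finset.sum_congr rfl fun j _ => ?_
    field_simp
    ring
  have : 0 ≤ t⁻¹ * ∑ i, ∑ j, a x i j * ((t * η i - (ξ i - η i)) * (t * η j - (ξ j - η j))) :=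
    mul_nonneg (by positivity) key
  linarith

theorem gradForm_sub_const {α : Fin (N + 1) → ℝ} [NeZero N] {f g : (Fin N → ℝ) → ℝ}
    (hf : f ∈ C1 N) (c : ℝ) (h : g = fun x => f x - c) :
    gradForm α a g g = gradForm α a f f := by
  refine integral_congr_ae ?_
  filter_upwards [ae_mem_simplex α] with x hx
  have : ∀ i, partialDeriv i g x = partialDeriv i f x := fun i => by
    have := partialDeriv_sub hf (const_mem_C1 c) i hx
    rw [partialDeriv_const, sub_zero] at this
    rw [h]
    exact this
  simp only [this]

end Core

/-! ### The Nash inequality on the core -/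

section Nash

variable {N : ℕ}

theorem nashExponent_pos [NeZero N] (α : Fin (N + 1) → ℝ) : 0 < nashExponent α := by
  have h : 0 < ∑ i : Fin N, max 1 (2 * α i.castSucc) :=
    Finset.sum_pos (fun i _ => lt_max_of_lt_left one_pos) ⟨0, Finset.mem_univ _⟩
  unfold nashExponent
  linarith [le_max_right (α (Fin.last N) - 1) 0]

/-- The restriction of a `C¹` function to the open simplex, extended by zero. -/
def interiorPart (f : (Fin N → ℝ) → ℝ) : (Fin N → ℝ) → ℝ := (openSimplex (Fin N)).indicator f

/-- Elements of `C1 N` are arbitrary off the simplex and need not be measurable. Cutting off to the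
open simplex repairs this without changing the function almost everywhere. -/
theorem isSmooth_interiorPart {f : (Fin N → ℝ) → ℝ} (hf : f ∈ C1 N) : IsSmooth (interiorPart f) := by
  have hO : ContDiffOn ℝ 1 f (openSimplex (Fin N)) := ContDiffOn.mono hf openSimplex_subset
  constructor
  · classical
    rw [interiorPart, ← Set.piecewise_eq_indicator]
    exact hO.continuousOn.measurable_piecewise continuousOn_const
      isOpen_openSimplex.measurableSet
  · exact hO.congr fun x hx => Set.indicator_of_mem hx f

theorem coordDeriv_interiorPart {f : (Fin N → ℝ) → ℝ} (i : Fin N) {x : Fin N → ℝ}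
    (hx : x ∈ openSimplex (Fin N)) : coordDeriv (interiorPart f) i x = partialDeriv i f x := by
  have h1 : openSimplex (Fin N) ∈ 𝓝 x := isOpen_openSimplex.mem_nhds hx
  have h2 : interiorPart f =ᶠ[𝓝 x] f := by
    filter_upwards [h1] with y hy using Set.indicator_of_mem hy f
  rw [coordDeriv, partialDeriv, h2.fderiv_eq,
    fderivWithin_of_mem_nhds (mem_of_superset h1 openSimplex_subset)]

theorem lintegral_interiorPart [NeZero N] (α : Fin (N + 1) → ℝ) (f : (Fin N → ℝ) → ℝ) (φ : ℝ → ℝ≥0∞) :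
    ∫⁻ x, φ (interiorPart f x) ∂dirichletMeasure α = ∫⁻ x, φ (f x) ∂dirichletMeasure α := by
  refine lintegral_congr_ae ?_
  filter_upwards [ae_mem_openSimplex α] with x hx
  rw [interiorPart, Set.indicator_of_mem hx]

theorem energy_interiorPart_le [NeZero N] {α : Fin (N + 1) → ℝ} (hα : ∀ j, 0 < α j)
    {a : (Fin N → ℝ) → Fin N → Fin N → ℝ} (ha : IsAdmissible a) {f : (Fin N → ℝ) → ℝ}
    (hf : f ∈ C1 N) : energy α (interiorPart f) ≤ ENNReal.ofReal (gradForm α a f f) := by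
  rw [gradForm, ofReal_integral_eq_lintegral_ofReal (ha.integrable hα hf hf)]
  · refine lintegral_mono_ae ?_
    filter_upwards [ae_mem_openSimplex α] with x hx
    refine ENNReal.ofReal_le_ofReal ?_
    refine le_trans (le_of_eq ?_)
      (ha.le x (fun i => partialDeriv i f x) (openSimplex_subset hx))
    rw [sum_multivariateCoeff, carre]
    exact Finset.sum_congr rfl fun i _ => by rw [coordDeriv_interiorPart i hx]
  · filter_upwards [ae_mem_simplex α] with x hx
    exact ha.nonneg x (fun i => partialDeriv i f x) hx

theorem integral_sq_sub_mul_add {X : Type*} [MeasurableSpace X] {μ : Measure X}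
    [IsFiniteMeasure μ] {f : X → ℝ} (h1 : Integrable f μ) (h2 : Integrable (fun x => f x ^ 2) μ)
    (b c : ℝ) : Integrable (fun x => f x ^ 2 - b * f x + c) μ ∧
      ∫ x, (f x ^ 2 - b * f x + c) ∂μ =
        ∫ x, f x ^ 2 ∂μ - b * ∫ x, f x ∂μ + μ.real Set.univ * c := by
  have h3 : Integrable (fun x => b * f x) μ := h1.const_mul b
  have h4 : Integrable (fun x => f x ^ 2 - b * f x) μ := h2.sub h3
  refine ⟨h4.add (integrable_const c), ?_⟩
  rw [integral_add h4 (integrable_const c), integral_sub h2 h3, integral_const_mul,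
    integral_const, smul_eq_mul]

theorem sq_integral_abs_le {X : Type*} [MeasurableSpace X] {μ : Measure X} [IsFiniteMeasure μ]
    {f : X → ℝ} (h1 : Integrable f μ) (h2 : Integrable (fun x => f x ^ 2) μ)
    (hμ : 0 < μ.real Set.univ) :
    (∫ x, |f x| ∂μ) ^ 2 ≤ μ.real Set.univ * ∫ x, f x ^ 2 ∂μ := by
  set M := μ.real Set.univ
  set T := ∫ x, |f x| ∂μ with hT
  have h0 : 0 ≤ ∫ x, (|f x| ^ 2 - 2 * (T / M) * |f x| + (T / M) ^ 2) ∂μ :=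
    integral_nonneg fun x => show 0 ≤ |f x| ^ 2 - 2 * (T / M) * |f x| + (T / M) ^ 2 by
      nlinarith [sq_nonneg (|f x| - T / M)]
  rw [(integral_sq_sub_mul_add h1.abs (by simpa using h2) _ _).2, ← hT] at h0
  simp only [sq_abs] at h0
  have : M * (T / M) ^ 2 = T / M * T := by field_simp
  rw [show μ.real Set.univ = M from rfl, this] at h0
  have h3 : T ^ 2 / M ≤ ∫ x, f x ^ 2 ∂μ := by
    have : T ^ 2 / M = T / M * T := by ring
    rw [this]; linarith
  rw [div_le_iff₀ hμ] at h3
  linarith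

/-- For mean zero the cross term vanishes, and the inner integral is `μ(f²) + μ(X) f(x)²`. Dropping
the first summand is enough. -/
theorem lintegral_sq_le_setOsc {X : Type*} [MeasurableSpace X] {μ : Measure X} [IsFiniteMeasure μ]
    {f : X → ℝ} (h1 : Integrable f μ) (h2 : Integrable (fun x => f x ^ 2) μ)
    (h0 : ∫ x, f x ∂μ = 0) :
    ENNReal.ofReal (μ.real Set.univ * ∫ x, f x ^ 2 ∂μ) ≤ setOsc μ f Set.univ Set.univ := by
  set M := μ.real Set.univ
  rw [← integral_const_mul, ofReal_integral_eq_lintegral_ofReal (h2.const_mul _)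
    (ae_of_all _ fun x => by positivity)]
  simp only [setOsc, Measure.restrict_univ]
  refine lintegral_mono fun x => ?_
  have hsq : (fun y => (f y - f x) ^ 2) = fun y => f y ^ 2 - 2 * f x * f y + f x ^ 2 := by
    ext y; ring
  obtain ⟨hint, e⟩ := integral_sq_sub_mul_add h1 h2 (2 * f x) (f x ^ 2)
  rw [← hsq] at hint
  rw [← ofReal_integral_eq_lintegral_ofReal hint (ae_of_all _ fun y => sq_nonneg _)]
  refine ENNReal.ofReal_le_ofReal ?_
  rw [hsq, e, h0]
  have : 0 ≤ ∫ y, f y ^ 2 ∂μ := integral_nonneg fun y => sq_nonneg _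
  linarith

/-- The Nash inequality for `C¹` functions with mean zero. -/
theorem exists_nash_core [NeZero N] {α : Fin (N + 1) → ℝ} (hα : ∀ j, 0 < α j)
    {a : (Fin N → ℝ) → Fin N → Fin N → ℝ} (ha : IsAdmissible a) :
    ∃ C : ℝ, 0 < C ∧ ∀ f ∈ C1 N, ∫ x, f x ∂dirichletMeasure α = 0 →
      ∫ x, f x ^ 2 ∂dirichletMeasure α ≤ C * gradForm α a f f ^
        (nashExponent α / (nashExponent α + 1)) *
          (∫ x, |f x| ∂dirichletMeasure α) ^ (2 / (nashExponent α + 1)) := by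
  have hfin := isFiniteMeasure_dirichletMeasure hα
  have hM := dirichletMeasure_univ_pos hα
  obtain ⟨C₁, hC₁, r₀, hr₀, h1⟩ := exists_superPoincare hα
  obtain ⟨-, C₂, hC₂, h2⟩ := exists_poincare hα
  set M := (dirichletMeasure α).real Set.univ
  set p := nashExponent α
  have hp : 0 < p := nashExponent_pos α
  -- The constant of `nash_of_superPoincare`; the added ones keep both inputs positive.
  set K := (C₁.toReal + 1) * (r₀ + r₀ ^ (-p) * (C₂.toReal + 1)) *
    (C₂.toReal + 1) ^ (-(1 / (p + 1))) with hK
  have hC₁0 : 0 ≤ C₁.toReal := ENNReal.toReal_nonneg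
  have hC₂0 : 0 ≤ C₂.toReal := ENNReal.toReal_nonneg
  refine ⟨K, by positivity, fun f hf hf0 => ?_⟩
  have hcont : ContinuousOn f (simplex N) := ContDiffOn.continuousOn hf
  have hi : Integrable f (dirichletMeasure α) := integrable_of_continuousOn hα hcont
  have hi2 : Integrable (fun x => f x ^ 2) (dirichletMeasure α) :=
    integrable_of_continuousOn hα (hcont.pow 2)
  set A := ∫ x, f x ^ 2 ∂dirichletMeasure α
  set T := ∫ x, |f x| ∂dirichletMeasure α
  set E := gradForm α a f f
  have hE : 0 ≤ E := ha.gradForm_nonneg α f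
  have hT : 0 ≤ T := integral_nonneg fun x => abs_nonneg _
  have hEe : energy α (interiorPart f) ≤ ENNReal.ofReal E := energy_interiorPart_le hα ha hf
  have hAe : ENNReal.ofReal A = ∫⁻ x, ENNReal.ofReal (interiorPart f x ^ 2) ∂dirichletMeasure α := by
    rw [lintegral_interiorPart α f fun t => ENNReal.ofReal (t ^ 2)]
    exact ofReal_integral_eq_lintegral_ofReal hi2 (ae_of_all _ fun x => sq_nonneg _)
  have hTe : ENNReal.ofReal T = ∫⁻ x, ENNReal.ofReal |interiorPart f x| ∂dirichletMeasure α := by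
    rw [lintegral_interiorPart α f fun t => ENNReal.ofReal |t|]
    exact ofReal_integral_eq_lintegral_ofReal hi.abs (ae_of_all _ fun x => abs_nonneg _)
  refine nash_of_superPoincare hp (by positivity) hr₀ hE hT (fun r hr hrr => ?_) ?_
  · have h3 := h1 r hr hrr (interiorPart f) (isSmooth_interiorPart hf)
    rw [← hAe, ← hTe] at h3
    have hrp : 0 ≤ r ^ (-p) := by positivity
    have h4 : ENNReal.ofReal A ≤ ENNReal.ofReal ((C₁.toReal + 1) * (r * E + r ^ (-p) * T ^ 2)) := by
      refine h3.trans ?_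
      rw [ENNReal.ofReal_mul (by positivity),
        ENNReal.ofReal_add (p := r * E) (q := r ^ (-p) * T ^ 2) (by positivity) (by positivity),
        ENNReal.ofReal_mul hr.le, ENNReal.ofReal_mul hrp, ENNReal.ofReal_pow hT]
      refine mul_le_mul' ?_ (by gcongr)
      rw [← ENNReal.ofReal_toReal hC₁]
      exact ENNReal.ofReal_le_ofReal (by simp)
    exact (ENNReal.ofReal_le_ofReal_iff (by positivity)).1 h4
  -- Mean zero enters only here: `T² ≤ M μ(f²)`, and `M μ(f²)` is at most the oscillation, hence at
  -- most a multiple of the energy.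
  · refine (sq_integral_abs_le hi hi2 hM).trans ?_
    have h3 := lintegral_sq_le_setOsc hi hi2 hf0
    have h5 : setOsc (dirichletMeasure α) f Set.univ Set.univ =
        setOsc (dirichletMeasure α) (interiorPart f) Set.univ Set.univ := by
      simp only [setOsc, Measure.restrict_univ]
      refine lintegral_congr_ae ?_
      filter_upwards [ae_mem_openSimplex α] with x hx
      rw [lintegral_interiorPart α f fun t => ENNReal.ofReal ((t - interiorPart f x) ^ 2), interiorPart,
        Set.indicator_of_mem hx]
    have h4 : ENNReal.ofReal (M * A) ≤ ENNReal.ofReal ((C₂.toReal + 1) * E) := by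
      rw [h5] at h3
      refine h3.trans ((h2 _ (isSmooth_interiorPart hf)).trans ?_)
      rw [ENNReal.ofReal_mul (by positivity)]
      refine mul_le_mul' ?_ hEe
      rw [← ENNReal.ofReal_toReal hC₂]
      exact ENNReal.ofReal_le_ofReal (by simp)
    exact (ENNReal.ofReal_le_ofReal_iff (by positivity)).1 h4

end Nash

/-! ### Passage between the core and the closure -/

section ClosureNash

variable {X : Type*} [MeasurableSpace X] {μ : Measure X}

/-- The inequalities for all `t > 0` encode the triangle inequality for `√E`, recovered at `t = √e /
√y`. Both roots are enlarged by `δ / 2` so that nothing is divided by zero. -/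
theorem sqrt_le_sqrt_add_sqrt {x y e : ℝ} (hy : 0 ≤ y) (he : 0 ≤ e)
    (h : ∀ t : ℝ, 0 < t → x ≤ (1 + t) * y + (1 + t⁻¹) * e) : √x ≤ √y + √e := by
  refine le_of_forall_pos_le_add fun δ hδ => ?_
  set a := √y + δ / 2 with ha
  set b := √e + δ / 2 with hb
  have ha0 : 0 < a := by positivity
  have hb0 : 0 < b := by positivity
  have h1 := h (b / a) (by positivity)
  have hya : y ≤ a ^ 2 := by
    rw [← Real.sq_sqrt hy]; exact pow_le_pow_left₀ (Real.sqrt_nonneg _) (by linarith) 2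
  have heb : e ≤ b ^ 2 := by
    rw [← Real.sq_sqrt he]; exact pow_le_pow_left₀ (Real.sqrt_nonneg _) (by linarith) 2
  have h2 : x ≤ (a + b) ^ 2 := by
    calc x ≤ (1 + b / a) * y + (1 + (b / a)⁻¹) * e := h1
      _ ≤ (1 + b / a) * a ^ 2 + (1 + (b / a)⁻¹) * b ^ 2 := by gcongr
      _ = (a + b) ^ 2 := by field_simp; ring
  have h3 : √x ≤ a + b := Real.sqrt_le_iff.2 ⟨by positivity, h2⟩
  linarith

/-- By the triangle inequality `√(s n)` is a Cauchy sequence, so the energies along an approximating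
sequence converge. Since `d` is not assumed symmetric, both orders of the pair are used. -/
theorem exists_tendsto_of_cauchy {s : ℕ → ℝ} {d : ℕ × ℕ → ℝ} (hs : ∀ n, 0 ≤ s n)
    (hd : ∀ k, 0 ≤ d k) (hd0 : Tendsto d atTop (𝓝 0))
    (h : ∀ n m, ∀ t : ℝ, 0 < t → s n ≤ (1 + t) * s m + (1 + t⁻¹) * d (n, m)) :
    ∃ e, Tendsto s atTop (𝓝 e) := by
  have hsq : Tendsto (fun k => √(d k)) atTop (𝓝 0) := by
    simpa using hd0.sqrt
  have hsw : Tendsto (fun k : ℕ × ℕ => √(d k.swap)) atTop (𝓝 0) := by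
    refine hsq.comp ?_
    rw [← prod_atTop_atTop_eq]
    exact Filter.tendsto_prod_swap
  have hc : CauchySeq fun n => √(s n) := by
    rw [cauchySeq_iff_tendsto_dist_atTop_0]
    refine squeeze_zero (fun _ => dist_nonneg) (fun k => ?_) (by simpa using hsq.add hsw)
    have h1 := sqrt_le_sqrt_add_sqrt (hs k.2) (hd (k.1, k.2)) (h k.1 k.2)
    have h2 := sqrt_le_sqrt_add_sqrt (hs k.1) (hd (k.2, k.1)) (h k.2 k.1)
    have h3 := Real.sqrt_nonneg (d k)
    have h4 := Real.sqrt_nonneg (d k.swap)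
    rw [Real.dist_eq, abs_le]
    constructor
    · change √(s k.2) ≤ √(s k.1) + √(d k.swap) at h2
      linarith
    · change √(s k.1) ≤ √(s k.2) + √(d k) at h1
      linarith
  obtain ⟨L, hL⟩ := cauchySeq_tendsto_of_complete hc
  refine ⟨L ^ 2, (hL.pow 2).congr fun n => Real.sq_sqrt (hs n)⟩

theorem tendsto_eLpNorm_one_of_two [IsFiniteMeasure μ] {u : ℕ → X → ℝ}
    (hu : ∀ n, AEStronglyMeasurable (u n) μ)
    (h : Tendsto (fun n => eLpNorm (u n) 2 μ) atTop (𝓝 0)) :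
    Tendsto (fun n => eLpNorm (u n) 1 μ) atTop (𝓝 0) := by
  have h1 : Tendsto (fun n => eLpNorm (u n) 2 μ *
      μ Set.univ ^ (1 / (1 : ℝ≥0∞).toReal - 1 / (2 : ℝ≥0∞).toReal)) atTop (𝓝 0) := by
    have := ENNReal.Tendsto.mul_const h
      (b := μ Set.univ ^ (1 / (1 : ℝ≥0∞).toReal - 1 / (2 : ℝ≥0∞).toReal))
      (Or.inr (ENNReal.rpow_ne_top_of_nonneg (by norm_num) (measure_ne_top _ _)))
    simpa using this
  exact tendsto_of_tendsto_of_tendsto_of_le_of_le tendsto_const_nhds h1 (fun _ => zero_le)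
    fun n => eLpNorm_le_eLpNorm_mul_rpow_measure_univ (by norm_num) (hu n)

theorem integral_sq_eq_toReal_eLpNorm_sq {f : X → ℝ} (hf : MemLp f 2 μ) :
    ∫ x, f x ^ 2 ∂μ = (eLpNorm f 2 μ).toReal ^ 2 := by
  rw [hf.eLpNorm_eq_integral_rpow_norm (by norm_num) (by norm_num)]
  have h0 : 0 ≤ ∫ x, ‖f x‖ ^ (2 : ℝ≥0∞).toReal ∂μ := integral_nonneg fun x => by positivity
  rw [ENNReal.toReal_ofReal (by positivity), ← Real.rpow_natCast, ← Real.rpow_mul h0]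
  simp

theorem tendsto_integral_sq {u : ℕ → X → ℝ} {f : X → ℝ} (hu : ∀ n, MemLp (u n) 2 μ)
    (hf : MemLp f 2 μ) (h : Tendsto (fun n => eLpNorm (u n - f) 2 μ) atTop (𝓝 0)) :
    Tendsto (fun n => ∫ x, u n x ^ 2 ∂μ) atTop (𝓝 (∫ x, f x ^ 2 ∂μ)) := by
  have := Fact.mk (show (1 : ℝ≥0∞) ≤ 2 by norm_num)
  have h1 := (Lp.tendsto_Lp_iff_tendsto_eLpNorm'' u hu f hf).2 h
  have h2 := (h1.norm).pow 2
  simp only [Lp.norm_toLp] at h2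
  simpa only [integral_sq_eq_toReal_eLpNorm_sq hf, integral_sq_eq_toReal_eLpNorm_sq (hu _)] using h2

theorem tendsto_integral_of_eLpNorm_two [IsFiniteMeasure μ] {u : ℕ → X → ℝ} {f : X → ℝ}
    (hu : ∀ n, MemLp (u n) 2 μ) (hf : MemLp f 2 μ)
    (h : Tendsto (fun n => eLpNorm (u n - f) 2 μ) atTop (𝓝 0)) :
    Tendsto (fun n => ∫ x, u n x ∂μ) atTop (𝓝 (∫ x, f x ∂μ)) :=
  tendsto_integral_of_L1' f hf.1
    (Eventually.of_forall fun n => (hu n).integrable (by norm_num))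
    (tendsto_eLpNorm_one_of_two (fun n => ((hu n).sub hf).1) h)

theorem tendsto_integral_abs [IsFiniteMeasure μ] {u : ℕ → X → ℝ} {f : X → ℝ}
    (hu : ∀ n, MemLp (u n) 2 μ) (hf : MemLp f 2 μ)
    (h : Tendsto (fun n => eLpNorm (u n - f) 2 μ) atTop (𝓝 0)) :
    Tendsto (fun n => ∫ x, |u n x| ∂μ) atTop (𝓝 (∫ x, |f x| ∂μ)) := by
  refine tendsto_integral_of_eLpNorm_two (fun n => (hu n).abs) hf.abs ?_
  refine tendsto_of_tendsto_of_tendsto_of_le_of_le tendsto_const_nhds h (fun _ => zero_le)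
    fun n => eLpNorm_mono fun x => ?_
  exact abs_abs_sub_abs_le (u n x) (f x)

/-- A Nash inequality on a core invariant under subtraction of constants extends to the closure. -/
theorem nashInequality_of_core [IsFiniteMeasure μ] (hμ : 0 < μ.real Set.univ)
    {core : Set (X → ℝ)} {E : (X → ℝ) → (X → ℝ) → ℝ} {p C : ℝ} (hp : 0 < p)
    (hmem : ∀ f ∈ core, MemLp f 2 μ) (hE : ∀ f, 0 ≤ E f f)
    (hsub : ∀ f ∈ core, ∀ g ∈ core, ∀ t : ℝ, 0 < t →
      E f f ≤ (1 + t) * E g g + (1 + t⁻¹) * E (f - g) (f - g))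
    (hconst : ∀ f ∈ core, ∀ c : ℝ, (fun x => f x - c) ∈ core ∧
      E (fun x => f x - c) (fun x => f x - c) = E f f)
    (hnash : ∀ f ∈ core, ∫ x, f x ∂μ = 0 →
      ∫ x, f x ^ 2 ∂μ ≤ C * E f f ^ (p / (p + 1)) * (∫ x, |f x| ∂μ) ^ (2 / (p + 1))) :
    NashInequality μ core E p C := by
  rintro f ⟨hf, u₀, hu₀⟩ hf0
  have hp1 : 0 ≤ p / (p + 1) := by positivity
  have hp2 : 0 ≤ 2 / (p + 1) := by positivity
  -- The inequality is proved for every limiting energy, so it survives the infimum, and closability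
  -- of the form is not needed. Approximants need not have mean zero; subtracting the means `c n →
  -- 0` keeps the energies and the limit.
  have key : ∀ e, (∃ u, Approximates μ core E u f ∧
      Tendsto (fun n => E (u n) (u n)) atTop (𝓝 e)) →
      ∫ x, f x ^ 2 ∂μ ≤ C * e ^ (p / (p + 1)) * (∫ x, |f x| ∂μ) ^ (2 / (p + 1)) := by
    rintro e ⟨u, hu, he⟩
    have hum : ∀ n, MemLp (u n) 2 μ := fun n => hmem _ (hu.mem_core n)
    set c : ℕ → ℝ := fun n => (∫ x, u n x ∂μ) / μ.real Set.univ with hc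
    have hc0 : Tendsto c atTop (𝓝 0) := by
      have := (tendsto_integral_of_eLpNorm_two hum hf hu.tendsto_L2).div_const (μ.real Set.univ)
      simpa [hf0] using this
    set v : ℕ → X → ℝ := fun n x => u n x - c n with hv
    have hvcore : ∀ n, v n ∈ core := fun n => (hconst _ (hu.mem_core n) (c n)).1
    have hvE : ∀ n, E (v n) (v n) = E (u n) (u n) := fun n => (hconst _ (hu.mem_core n) (c n)).2
    have hvm : ∀ n, MemLp (v n) 2 μ := fun n => hmem _ (hvcore n)
    have hv0 : ∀ n, ∫ x, v n x ∂μ = 0 := by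
      intro n
      rw [hv]
      simp only
      rw [integral_sub ((hum n).integrable (by norm_num)) (integrable_const _), integral_const,
        smul_eq_mul, hc]
      field_simp
      simp
    have hvf : Tendsto (fun n => eLpNorm (v n - f) 2 μ) atTop (𝓝 0) := by
      have hcn : Tendsto (fun n => eLpNorm (fun _ : X => c n) 2 μ) atTop (𝓝 0) := by
        have h1 : Tendsto (fun n => ‖c n‖ₑ * μ Set.univ ^ (1 / (2 : ℝ≥0∞).toReal)) atTop (𝓝 0) := by
          have h2 : Tendsto (fun n => ‖c n‖ₑ) atTop (𝓝 0) := by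
            simpa using hc0.enorm
          simpa using ENNReal.Tendsto.mul_const h2
            (b := μ Set.univ ^ (1 / (2 : ℝ≥0∞).toReal))
            (Or.inr (ENNReal.rpow_ne_top_of_nonneg (by norm_num) (measure_ne_top _ _)))
        refine h1.congr fun n => ?_
        rw [eLpNorm_const' _ (by norm_num) (by norm_num)]
      have h3 := hu.tendsto_L2.add hcn
      rw [add_zero] at h3
      refine tendsto_of_tendsto_of_tendsto_of_le_of_le tendsto_const_nhds h3 (fun _ => zero_le)
        fun n => ?_
      have h4 : v n - f = (u n - f) - fun _ => c n := by
        ext x; simp [hv]; ring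
      simp only
      rw [h4]
      exact eLpNorm_sub_le ((hum n).sub hf).1 aestronglyMeasurable_const (by norm_num)
    have hlim := ((he.rpow_const (Or.inr hp1)).const_mul C).mul
      ((tendsto_integral_abs hvm hf hvf).rpow_const (Or.inr hp2))
    refine le_of_tendsto_of_tendsto' (tendsto_integral_sq hvm hf hvf) hlim fun n => ?_
    rw [← hvE]
    exact hnash _ (hvcore n) (hv0 n)
  obtain ⟨e₀, he₀⟩ := exists_tendsto_of_cauchy (s := fun n => E (u₀ n) (u₀ n)) (fun n => hE _)
    (fun k => hE _) hu₀.cauchy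
    fun n m t ht => hsub _ (hu₀.mem_core n) _ (hu₀.mem_core m) t ht
  -- The set is nonempty by convergence of the energies, so its infimum is a limit of elements and
  -- not the default value of `sInf`.
  obtain ⟨s, -, hs, hsm⟩ := exists_seq_tendsto_sInf
    (S := {e | ∃ u, Approximates μ core E u f ∧ Tendsto (fun n => E (u n) (u n)) atTop (𝓝 e)})
    ⟨e₀, u₀, hu₀, he₀⟩
    ⟨0, fun e ⟨u, _, hu⟩ => ge_of_tendsto' hu fun n => hE _⟩
  have hlim := ((hs.rpow_const (Or.inr hp1)).const_mul C).mul_const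
    ((∫ x, |f x| ∂μ) ^ (2 / (p + 1)))
  exact ge_of_tendsto' hlim fun n => key _ (hsm n)

/-- An element of the core belongs to the domain of the closure, and its energy does not increase. -/
theorem NashInequality.of_mem_core {core : Set (X → ℝ)} {E : (X → ℝ) → (X → ℝ) → ℝ} {p C : ℝ}
    (h : NashInequality μ core E p C) (hp : 0 < p) (hC : 0 < C) (hE : ∀ f, 0 ≤ E f f)
    (hE0 : E 0 0 = 0) {f : X → ℝ} (hf : f ∈ core) (hf2 : MemLp f 2 μ) (hf0 : ∫ x, f x ∂μ = 0) :
    ∫ x, f x ^ 2 ∂μ ≤ C * E f f ^ (p / (p + 1)) * (∫ x, |f x| ∂μ) ^ (2 / (p + 1)) := by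
  -- The constant sequence approximates `f`, which makes `E f f` one of the values over which the
  -- infimum is taken.
  have ha : Approximates μ core E (fun _ => f) f :=
    ⟨fun _ => hf, by simp, by simp [hE0]⟩
  refine (h f ⟨hf2, _, ha⟩ hf0).trans ?_
  have hb : ∀ e, (∃ u, Approximates μ core E u f ∧
      Tendsto (fun n => E (u n) (u n)) atTop (𝓝 e)) → 0 ≤ e :=
    fun e ⟨u, _, hu⟩ => ge_of_tendsto' hu fun n => hE _
  have h1 : closureEnergy μ core E f ≤ E f f :=
    csInf_le ⟨0, hb⟩ ⟨_, ha, tendsto_const_nhds⟩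
  have h0 : 0 ≤ closureEnergy μ core E f := Real.sInf_nonneg hb
  have hT : 0 ≤ ∫ x, |f x| ∂μ := integral_nonneg fun x => abs_nonneg _
  gcongr

end ClosureNash

/-! ### Upper bounds for the exponent -/

section UpperBound

variable {N : ℕ} [NeZero N] {α : Fin (N + 1) → ℝ} {a : (Fin N → ℝ) → Fin N → Fin N → ℝ}

theorem memLp_of_mem_C1 (hα : ∀ j, 0 < α j) {f : (Fin N → ℝ) → ℝ} (hf : f ∈ C1 N) :
    MemLp f 2 (dirichletMeasure α) := by
  have hcont : ContinuousOn f (simplex N) := ContDiffOn.continuousOn hf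
  rw [memLp_two_iff_integrable_sq (integrable_of_continuousOn hα hcont).1]
  exact integrable_of_continuousOn hα (hcont.pow 2)

theorem exists_nashInequality (hα : ∀ j, 0 < α j) (ha : IsAdmissible a) :
    ∃ C : ℝ, 0 < C ∧
      NashInequality (dirichletMeasure α) (C1 N) (gradForm α a) (nashExponent α) C := by
  have := isFiniteMeasure_dirichletMeasure hα
  obtain ⟨C, hC, h⟩ := exists_nash_core hα ha
  refine ⟨C, hC, nashInequality_of_core (dirichletMeasure_univ_pos hα) (nashExponent_pos α)
    (fun f hf => memLp_of_mem_C1 hα hf) (fun f => ha.gradForm_nonneg α f)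
    (fun f hf g hg t ht => ha.gradForm_sub_le hα hf hg ht) (fun f hf c => ⟨?_, ?_⟩) h⟩
  · exact sub_mem_C1 hf (const_mem_C1 c)
  · exact gradForm_sub_const hf c rfl

theorem multivariateNash_nashExponent (hα : ∀ j, 0 < α j) :
    MultivariateNash α (nashExponent α) := by
  rw [MultivariateNash, multivariateForm_eq]
  exact exists_nashInequality hα isAdmissible_multivariateCoeff

theorem flemingViotNash_nashExponent (hα : ∀ j, 0 < α j) :
    FlemingViotNash α (nashExponent α) := by
  rw [FlemingViotNash, flemingViotForm_eq]
  exact exists_nashInequality hα isAdmissible_flemingViotCoeff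

end UpperBound

/-! ### Scaling of test families -/

section Exponent

variable {N : ℕ} [NeZero N] {α : Fin (N + 1) → ℝ} {a : (Fin N → ℝ) → Fin N → Fin N → ℝ}

theorem gradForm_zero : gradForm α a 0 0 = 0 := by
  have h : ∀ i x, partialDeriv i (0 : (Fin N → ℝ) → ℝ) x = 0 := partialDeriv_const 0
  simp [gradForm, h]

/-- The Nash inequality for a nonnegative function after subtraction of its mean. -/
theorem NashInequality.sub_mean (hα : ∀ j, 0 < α j) (ha : IsAdmissible a) {p C : ℝ} (hp : 0 < p)
    (hC : 0 < C) (h : NashInequality (dirichletMeasure α) (C1 N) (gradForm α a) p C)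
    {f : (Fin N → ℝ) → ℝ} (hf : f ∈ C1 N) (hf0 : ∀ x, 0 ≤ f x) :
    ∫ x, f x ^ 2 ∂dirichletMeasure α -
        2 * (∫ x, f x ∂dirichletMeasure α) ^ 2 / (dirichletMeasure α).real Set.univ ≤
      C * gradForm α a f f ^ (p / (p + 1)) *
        (2 * ∫ x, f x ∂dirichletMeasure α) ^ (2 / (p + 1)) := by
  have := isFiniteMeasure_dirichletMeasure hα
  have hM := dirichletMeasure_univ_pos hα
  set M := (dirichletMeasure α).real Set.univ with hMdef
  set I := ∫ x, f x ∂dirichletMeasure α with hI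
  have hI0 : 0 ≤ I := integral_nonneg hf0
  have hcont : ContinuousOn f (simplex N) := ContDiffOn.continuousOn hf
  have hi := integrable_of_continuousOn hα hcont
  have hi2 : Integrable (fun x => f x ^ 2) (dirichletMeasure α) :=
    integrable_of_continuousOn hα (hcont.pow 2)
  set m := I / M with hm
  have hm0 : 0 ≤ m := by positivity
  set g : (Fin N → ℝ) → ℝ := fun x => f x - m with hg
  have hgC : g ∈ C1 N := sub_mem_C1 hf (const_mem_C1 m)
  have hg0 : ∫ x, g x ∂dirichletMeasure α = 0 := by
    rw [hg, integral_sub hi (integrable_const _), integral_const, smul_eq_mul, ← hI, ← hMdef, hm]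
    field_simp
    simp
  have hgE : gradForm α a g g = gradForm α a f f := gradForm_sub_const hf m rfl
  have h1 := h.of_mem_core hp hC (fun f => ha.gradForm_nonneg α f) gradForm_zero hgC
    (memLp_of_mem_C1 hα hgC) hg0
  rw [hgE] at h1
  -- The exact correction is `I² / M`; subtracting `2 I² / M` amounts to dropping the square of the
  -- mean and is harmless later.
  have h2 : ∫ x, f x ^ 2 ∂dirichletMeasure α - 2 * I ^ 2 / M ≤
      ∫ x, g x ^ 2 ∂dirichletMeasure α := by
    have e : (fun x => g x ^ 2) = fun x => f x ^ 2 - 2 * m * f x + m ^ 2 := by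
      ext x; simp only [hg]; ring
    rw [e, (integral_sq_sub_mul_add hi hi2 _ _).2, ← hI, ← hMdef]
    have : 2 * I ^ 2 / M = 2 * m * I := by rw [hm]; ring
    rw [this]
    nlinarith [mul_nonneg hM.le (sq_nonneg m)]
  have h3 : ∫ x, |g x| ∂dirichletMeasure α ≤ 2 * I := by
    calc ∫ x, |g x| ∂dirichletMeasure α ≤ ∫ x, (f x + m) ∂dirichletMeasure α := by
          refine integral_mono ((hi.sub (integrable_const m)).abs) (hi.add (integrable_const m))
            fun x => ?_
          simp only [hg]
          rw [abs_le]
          constructor <;> linarith [hf0 x]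
      _ = 2 * I := by
          rw [integral_add hi (integrable_const _), integral_const, smul_eq_mul, ← hI, ← hMdef, hm]
          field_simp
          ring
  refine h2.trans (h1.trans ?_)
  have hT : 0 ≤ ∫ x, |g x| ∂dirichletMeasure α := integral_nonneg fun x => abs_nonneg _
  have hE := ha.gradForm_nonneg α f
  gcongr

/-- A family of test functions that concentrates on sets of measure of order `ε ^ P`, with
energies of order `ε ^ (P - q)`, forces the exponent of a Nash inequality to be at least `P / q`. -/
theorem NashInequality.le_of_family (hα : ∀ j, 0 < α j) (ha : IsAdmissible a) {p C : ℝ}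
    (hp : 0 < p) (hC : 0 < C)
    (h : NashInequality (dirichletMeasure α) (C1 N) (gradForm α a) p C)
    {P q ε₀ k K : ℝ} (hP : 0 < P) (hε₀ : 0 < ε₀) (hk : 0 < k) (hK : 0 < K)
    {f : ℝ → (Fin N → ℝ) → ℝ}
    (hf : ∀ ε, 0 < ε → ε ≤ ε₀ → f ε ∈ C1 N ∧ (∀ x, 0 ≤ f ε x) ∧
      k * ε ^ P ≤ ∫ x, f ε x ^ 2 ∂dirichletMeasure α ∧
      ∫ x, f ε x ∂dirichletMeasure α ≤ K * ε ^ P ∧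
      gradForm α a (f ε) (f ε) ≤ K * ε ^ (P - q)) : P ≤ q * p := by
  by_contra! hlt
  have hM := dirichletMeasure_univ_pos hα
  set M := (dirichletMeasure α).real Set.univ with hMdef
  set θ := p / (p + 1) with hθ
  set τ := 2 / (p + 1) with hτ
  have hθ0 : 0 ≤ θ := by positivity
  have hτ0 : 0 ≤ τ := by positivity
  -- The right side of the Nash inequality scales like `ε` to the power `(P - q) p/(p+1) + 2 P/(p+1)
  -- = P + δ`, the left side like `ε^P`. If `P > q p` then `δ > 0`, and `ε → 0` gives `k ≤ 0`.
  set δ := (P - q * p) / (p + 1) with hδ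
  have hδ0 : 0 < δ := div_pos (by linarith) (by linarith)
  set L := C * K ^ θ * (2 * K) ^ τ with hL
  have hbound : ∀ ε, 0 < ε → ε ≤ ε₀ → k ≤ L * ε ^ δ + 2 * K ^ 2 / M * ε ^ P := by
    intro ε hε hεε
    obtain ⟨h1, h2, h3, h4, h5⟩ := hf ε hε hεε
    have h6 := h.sub_mean hα ha hp hC h1 h2
    have hI0 : 0 ≤ ∫ x, f ε x ∂dirichletMeasure α := integral_nonneg h2
    have hE0 := ha.gradForm_nonneg α (f ε)
    have hεP : 0 < ε ^ P := Real.rpow_pos_of_pos hε _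
    have h7 : C * gradForm α a (f ε) (f ε) ^ θ * (2 * ∫ x, f ε x ∂dirichletMeasure α) ^ τ ≤
        C * (K * ε ^ (P - q)) ^ θ * (2 * (K * ε ^ P)) ^ τ := by gcongr
    have h8 : C * (K * ε ^ (P - q)) ^ θ * (2 * (K * ε ^ P)) ^ τ = L * ε ^ δ * ε ^ P := by
      rw [← mul_assoc 2 K, Real.mul_rpow hK.le (by positivity),
        Real.mul_rpow (by positivity : 0 ≤ 2 * K) hεP.le, ← Real.rpow_mul hε.le,
        ← Real.rpow_mul hε.le]
      have : (P - q) * θ + P * τ = δ + P := by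
        rw [hθ, hτ, hδ]; field_simp; ring
      calc C * (K ^ θ * ε ^ ((P - q) * θ)) * ((2 * K) ^ τ * ε ^ (P * τ))
          = L * (ε ^ ((P - q) * θ) * ε ^ (P * τ)) := by rw [hL]; ring
        _ = L * ε ^ δ * ε ^ P := by
            rw [← Real.rpow_add hε, this, Real.rpow_add hε]; ring
    have h9 : 2 * (∫ x, f ε x ∂dirichletMeasure α) ^ 2 / M ≤ 2 * (K * ε ^ P) ^ 2 / M := by gcongr
    have h10 : k * ε ^ P ≤ (L * ε ^ δ + 2 * K ^ 2 / M * ε ^ P) * ε ^ P := by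
      have : 2 * (K * ε ^ P) ^ 2 / M = 2 * K ^ 2 / M * ε ^ P * ε ^ P := by ring
      rw [add_mul, ← this, ← h8]
      linarith
    exact le_of_mul_le_mul_right h10 hεP
  have hlim : Tendsto (fun ε : ℝ => L * ε ^ δ + 2 * K ^ 2 / M * ε ^ P) (𝓝[>] 0) (𝓝 0) := by
    have t1 : ∀ r : ℝ, 0 < r → Tendsto (fun ε : ℝ => ε ^ r) (𝓝[>] 0) (𝓝 0) := by
      intro r hr
      have := (Real.continuousAt_rpow_const 0 r (Or.inr hr.le)).tendsto
      rw [Real.zero_rpow hr.ne'] at this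
      exact this.mono_left nhdsWithin_le_nhds
    simpa using ((t1 δ hδ0).const_mul L).add ((t1 P hP).const_mul (2 * K ^ 2 / M))
  have hev : ∀ᶠ ε in 𝓝[>] (0 : ℝ), k ≤ L * ε ^ δ + 2 * K ^ 2 / M * ε ^ P := by
    filter_upwards [Ioc_mem_nhdsGT hε₀] with ε hε using hbound ε hε.1 hε.2
  exact absurd (ge_of_tendsto hlim hev) (not_le.2 hk)

end Exponent

/-! ### Mass of small cubes -/

section TestBox

variable {N : ℕ}

/-- The part of the cube with centre `c` and side `2 s` that meets the positive orthant. -/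
def cubeBox (c : Fin N → ℝ) (s : ℝ) : Set (Fin N → ℝ) :=
  box (fun j => max 0 (c j - s)) fun j => c j + s

/-- At `c = 0` the interval is cut off at the singular end and has mass of order `s^β`. At `c = η >
0` the density is bounded above and below on the interval, so the mass is of order `s`. -/
theorem exists_powMeasure_centered {β η c d : ℝ} (hβ : 0 < β) (hη : 0 < η)
    (h : (c = 0 ∧ d = β) ∨ (c = η ∧ d = 1)) :
    ∃ k K : ℝ, 0 < k ∧ 0 < K ∧ ∀ s, 0 < s → s ≤ η / 2 →
      ENNReal.ofReal (k * s ^ d) ≤ powMeasure β (Set.Ioc (max 0 (c - s)) (c + s)) ∧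
      powMeasure β (Set.Ioc (max 0 (c - s)) (c + s)) ≤ ENNReal.ofReal (K * s ^ d) := by
  obtain ⟨k, K, hk, hK, hcell⟩ := exists_powMeasure_cell hβ
  rcases h with ⟨rfl, rfl⟩ | ⟨rfl, rfl⟩
  · refine ⟨k, K, hk, hK, fun s hs _ => ?_⟩
    have h1 : max 0 (0 - s) = 0 := max_eq_left (by linarith)
    have h2 : (s - 0) * s ^ (d - 1) = s ^ d := by
      rw [Real.rpow_sub_one hs.ne']; field_simp; ring
    have h3 := hcell 0 s ⟨le_rfl, hs, Or.inl rfl⟩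
    rw [h2] at h3
    rwa [h1, zero_add]
  · set A := (4 : ℝ) ^ |β - 1| * (2 * c) ^ (β - 1)
    set B := (4 : ℝ) ^ (-|β - 1|) * (2 * c) ^ (β - 1)
    have hA : 0 < A := by positivity
    have hB : 0 < B := by positivity
    refine ⟨k * (2 * B), K * (2 * A), by positivity, by positivity, fun s hs hsc => ?_⟩
    have h1 : max 0 (c - s) = c - s := max_eq_right (by linarith)
    obtain ⟨h3, h4⟩ := hcell (c - s) (c + s) ⟨by linarith, by linarith, Or.inr (by linarith)⟩
    rw [h1, Real.rpow_one]
    have h5 : (c + s) ^ (β - 1) ≤ A :=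
      rpow_le_of_scale _ (by linarith) (by linarith) (by linarith)
    have h6 : B ≤ (c + s) ^ (β - 1) :=
      le_rpow_of_scale _ (by linarith) (by linarith) (by linarith)
    have h7 : c + s - (c - s) = 2 * s := by ring
    rw [h7] at h3 h4
    constructor
    · refine (ENNReal.ofReal_le_ofReal ?_).trans h3
      calc k * (2 * B) * s = k * (2 * s * B) := by ring
        _ ≤ k * (2 * s * (c + s) ^ (β - 1)) := by gcongr
    · refine h4.trans (ENNReal.ofReal_le_ofReal ?_)
      calc K * (2 * s * (c + s) ^ (β - 1)) ≤ K * (2 * s * A) := by gcongr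
        _ = K * (2 * A) * s := by ring

/-- Each coordinate is at most `η + η/2 < 2 η ≤ 1/(2N)`, so the coordinates sum to at most `1/2`,
and the comparison with the product measure applies. -/
theorem cubeBox_subset_cornerRegion [NeZero N] {η s : ℝ} (hη : η ≤ 1 / (4 * N))
    (hs : s ≤ η / 2) {c : Fin N → ℝ} (hc : ∀ j, c j ≤ η) :
    cubeBox c s ⊆ cornerRegion (Fin N) (1 / 2) := by
  intro x hx
  have hN : (0 : ℝ) < N := by exact_mod_cast Nat.pos_of_neZero N
  refine ⟨fun j => (le_max_left _ _).trans_lt (hx j (Set.mem_univ j)).1, ?_⟩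
  calc ∑ j, x j ≤ ∑ _j : Fin N, 1 / (2 * (N : ℝ)) := by
        refine Finset.sum_le_sum fun j _ => ((hx j (Set.mem_univ j)).2).trans ?_
        have h1 : 1 / (2 * (N : ℝ)) = 2 * (1 / (4 * N)) := by field_simp; ring
        have h2 : 0 < 1 / (4 * (N : ℝ)) := by positivity
        rw [h1]
        linarith [hc j]
    _ = 1 - 1 / 2 := by
        rw [Finset.sum_const, Finset.card_univ, Fintype.card_fin, nsmul_eq_mul]
        field_simp
        ring

theorem exists_dirichletMeasure_cubeBox [NeZero N] {β : Fin (N + 1) → ℝ} (hβ : ∀ j, 0 < β j)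
    {η : ℝ} (hη : 0 < η) (hηN : η ≤ 1 / (4 * N)) {c d : Fin N → ℝ}
    (h : ∀ j, (c j = 0 ∧ d j = β j.castSucc) ∨ (c j = η ∧ d j = 1)) :
    ∃ k K : ℝ, 0 < k ∧ 0 < K ∧ ∀ s, 0 < s → s ≤ η / 2 →
      k * s ^ (∑ j, d j) ≤ (dirichletMeasure β).real (cubeBox c s) ∧
      (dirichletMeasure β).real (cubeBox c s) ≤ K * s ^ (∑ j, d j) := by
  have := isFiniteMeasure_dirichletMeasure hβ
  choose k K hk hK hb using fun j => exists_powMeasure_centered (hβ j.castSucc) hη (h j)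
  obtain ⟨κ, hκ, hcomp⟩ := exists_dirichlet_comparison hβ (c := 1 / 2) (by norm_num)
  set κ' := κ.toReal + 1 with hκ'
  have hκ0 : 0 < κ' := by positivity
  have hκκ : κ ≤ ENNReal.ofReal κ' := by
    rw [← ENNReal.ofReal_toReal hκ]
    exact ENNReal.ofReal_le_ofReal (by simp [hκ'])
  refine ⟨κ'⁻¹ * ∏ j, k j, κ' * ∏ j, K j,
    mul_pos (inv_pos.2 hκ0) (Finset.prod_pos fun j _ => hk j),
    mul_pos hκ0 (Finset.prod_pos fun j _ => hK j), fun s hs hsη => ?_⟩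
  have hprod : ∀ l : Fin N → ℝ, (∏ j, l j) * s ^ (∑ j, d j) = ∏ j, (l j * s ^ d j) := by
    intro l
    rw [Finset.prod_mul_distrib, Real.rpow_sum_of_pos hs]
  have hc : ∀ j, c j ≤ η := by
    intro j
    rcases h j with ⟨h1, -⟩ | ⟨h1, -⟩ <;> rw [h1]
    exact hη.le
  obtain ⟨h1, h2⟩ := hcomp _ (measurableSet_box _ _)
    (cubeBox_subset_cornerRegion hηN hsη hc) fun _ => 1
  simp only [setLIntegral_one] at h1 h2
  rw [powPi_box] at h1 h2
  have hs0 : ∀ l : Fin N → ℝ, (∀ j, 0 < l j) → ∀ j ∈ Finset.univ, 0 ≤ l j * s ^ d j :=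
    fun l hl j _ => mul_nonneg (hl j).le (Real.rpow_nonneg hs.le _)
  have hlow : ENNReal.ofReal ((∏ j, k j) * s ^ (∑ j, d j)) ≤
      ENNReal.ofReal (κ' * (dirichletMeasure β).real (cubeBox c s)) := by
    rw [hprod, ENNReal.ofReal_prod_of_nonneg (hs0 k hk), ENNReal.ofReal_mul hκ0.le,
      measureReal_def, ENNReal.ofReal_toReal (measure_ne_top _ _)]
    exact ((Finset.prod_le_prod' fun j _ => (hb j s hs hsη).1).trans h2).trans
      (mul_le_mul' hκκ le_rfl)
  have hupp : ENNReal.ofReal ((dirichletMeasure β).real (cubeBox c s)) ≤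
      ENNReal.ofReal (κ' * ((∏ j, K j) * s ^ (∑ j, d j))) := by
    rw [hprod, ENNReal.ofReal_mul hκ0.le, ENNReal.ofReal_prod_of_nonneg (hs0 K hK),
      measureReal_def, ENNReal.ofReal_toReal (measure_ne_top _ _)]
    exact h1.trans (mul_le_mul' hκκ (Finset.prod_le_prod' fun j _ => (hb j s hs hsη).2))
  have hKp : 0 < ∏ j, K j := Finset.prod_pos fun j _ => hK j
  have hsp : 0 < s ^ (∑ j, d j) := Real.rpow_pos_of_pos hs _
  constructor
  · rw [ENNReal.ofReal_le_ofReal_iff (by positivity)] at hlow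
    rw [mul_assoc, inv_mul_le_iff₀ hκ0]
    exact hlow
  · rw [ENNReal.ofReal_le_ofReal_iff (by positivity)] at hupp
    rw [mul_assoc]
    exact hupp

theorem mem_cubeBox {c x : Fin N → ℝ} {s : ℝ} (hx : ∀ j, 0 < x j) (h : dist x c < s) :
    x ∈ cubeBox c s := by
  intro j _
  have h1 := (dist_le_pi_dist x c j).trans_lt h
  rw [Real.dist_eq, abs_lt] at h1
  exact ⟨max_lt (hx j) (by linarith), by linarith⟩

theorem dist_le_of_mem_cubeBox {c x : Fin N → ℝ} {s : ℝ} (hs : 0 ≤ s) (h : x ∈ cubeBox c s) :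
    dist x c ≤ s := by
  refine (dist_pi_le_iff hs).2 fun j => ?_
  have h1 := h j (Set.mem_univ j)
  have h2 := (le_max_right 0 (c j - s)).trans_lt h1.1
  rw [Real.dist_eq, abs_le]
  exact ⟨by linarith, by linarith [h1.2]⟩

end TestBox

/-! ### Rescaled bumps and their gradients -/

section TestFunction

variable {N : ℕ}

/-- A smooth bump that is one on the unit cube and vanishes outside the cube of twice the size. -/
def unitBump (N : ℕ) : ContDiffBump (0 : Fin N → ℝ) where
  rIn := 1
  rOut := 2
  rIn_pos := one_pos
  rIn_lt_rOut := one_lt_two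

/-- The bump of width `ε` around `c` in the chart `e`. -/
def testFunction (e : (Fin N → ℝ) → Fin N → ℝ) (c : Fin N → ℝ) (ε : ℝ) (z : Fin N → ℝ) : ℝ :=
  unitBump N (ε⁻¹ • (e z - c))

theorem contDiff_unitBump : ContDiff ℝ 1 (unitBump N) := (unitBump N).contDiff (n := 1)

theorem exists_norm_fderiv_unitBump_le :
    ∃ G : ℝ, 0 < G ∧ ∀ y, ‖fderiv ℝ (unitBump N) y‖ ≤ G := by
  obtain ⟨G, hG⟩ := ((unitBump N).hasCompactSupport.fderiv ℝ).exists_bound_of_continuous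
    (contDiff_unitBump.continuous_fderiv (by norm_num))
  exact ⟨|G| + 1, by positivity, fun y => (hG y).trans (by linarith [le_abs_self G])⟩

theorem dist_inv_smul_sub {ε : ℝ} (hε : 0 < ε) (x c : Fin N → ℝ) :
    dist (ε⁻¹ • (x - c)) 0 = ε⁻¹ * dist x c := by
  rw [dist_zero_right, norm_smul, dist_eq_norm, Real.norm_of_nonneg (inv_nonneg.2 hε.le)]

variable {e : (Fin N → ℝ) → Fin N → ℝ} {c : Fin N → ℝ} {ε : ℝ}

theorem testFunction_nonneg (z : Fin N → ℝ) : 0 ≤ testFunction e c ε z := (unitBump N).nonneg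

theorem testFunction_le_one (z : Fin N → ℝ) : testFunction e c ε z ≤ 1 := (unitBump N).le_one

theorem testFunction_mem_C1 (he : ContDiff ℝ 1 e) : testFunction e c ε ∈ C1 N := by
  have h : ContDiff ℝ 1 fun z => ε⁻¹ • (e z - c) := by fun_prop
  exact (contDiff_unitBump.comp h).contDiffOn

theorem testFunction_eq_one (hε : 0 < ε) {z : Fin N → ℝ} (hz : dist (e z) c ≤ ε) :
    testFunction e c ε z = 1 := by
  refine (unitBump N).one_of_mem_closedBall ?_
  rw [Metric.mem_closedBall, dist_inv_smul_sub hε]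
  change ε⁻¹ * dist (e z) c ≤ 1
  rwa [inv_mul_le_iff₀ hε, mul_one]

theorem testFunction_eq_zero (hε : 0 < ε) {z : Fin N → ℝ} (hz : 3 * ε ≤ dist (e z) c) :
    testFunction e c ε z = 0 := by
  refine (unitBump N).zero_of_le_dist ?_
  rw [dist_inv_smul_sub hε]
  change 2 ≤ ε⁻¹ * dist (e z) c
  rw [le_inv_mul_iff₀ hε]
  linarith

theorem partialDeriv_testFunction {L : (Fin N → ℝ) →L[ℝ] (Fin N → ℝ)} {z : Fin N → ℝ}
    (he : HasFDerivAt e L z) (hz : z ∈ simplex N) (i : Fin N) :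
    partialDeriv i (testFunction e c ε) z =
      fderiv ℝ (unitBump N) (ε⁻¹ • (e z - c)) (ε⁻¹ • L (Pi.single i 1)) := by
  have h1 : HasFDerivAt (unitBump N) (fderiv ℝ (unitBump N) (ε⁻¹ • (e z - c)))
      (ε⁻¹ • (e z - c)) :=
    (contDiff_unitBump.differentiable (by norm_num) _).hasFDerivAt
  have h2 : HasFDerivAt (fun z => ε⁻¹ • (e z - c)) (ε⁻¹ • L) z := (he.sub_const c).const_smul ε⁻¹
  have h3 : HasFDerivAt (testFunction e c ε) _ z := h1.comp z h2
  rw [partialDeriv, h3.hasFDerivWithinAt.fderivWithin (uniqueDiffOn_simplex z hz)]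
  rfl

/-- The derivative is supported in the closed ball of radius `2 ε`. The threshold `3 ε` leaves a
margin, so that derivatives vanish as well as values. -/
theorem partialDeriv_testFunction_eq_zero {L : (Fin N → ℝ) →L[ℝ] (Fin N → ℝ)} {z : Fin N → ℝ}
    (he : HasFDerivAt e L z) (hε : 0 < ε) (hz : z ∈ simplex N) (hd : 3 * ε ≤ dist (e z) c)
    (i : Fin N) : partialDeriv i (testFunction e c ε) z = 0 := by
  have h : fderiv ℝ (unitBump N) (ε⁻¹ • (e z - c)) = 0 := by
    by_contra hne
    have h1 := support_fderiv_subset ℝ (f := unitBump N) (Function.mem_support.2 hne)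
    rw [ContDiffBump.tsupport_eq, Metric.mem_closedBall, dist_inv_smul_sub hε] at h1
    change ε⁻¹ * dist (e z) c ≤ 2 at h1
    rw [inv_mul_le_iff₀ hε] at h1
    linarith
  rw [partialDeriv_testFunction he hz, h]
  rfl

theorem exists_partialDeriv_testFunction_sq_le (L : (Fin N → ℝ) →L[ℝ] (Fin N → ℝ)) :
    ∃ G : ℝ, 0 < G ∧ ∀ (e : (Fin N → ℝ) → Fin N → ℝ) (c : Fin N → ℝ) (ε : ℝ), 0 < ε →
      ∀ z ∈ simplex N, HasFDerivAt e L z →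
      ∑ i, partialDeriv i (testFunction e c ε) z ^ 2 ≤ G * ε ^ (-2 : ℝ) := by
  obtain ⟨G, hG, hGb⟩ := exists_norm_fderiv_unitBump_le (N := N)
  refine ⟨(N + 1) * (G * (‖L‖ + 1)) ^ 2, by positivity, fun e c ε hε z hz he => ?_⟩
  have h1 : ∀ i, partialDeriv i (testFunction e c ε) z ^ 2 ≤ (G * (‖L‖ + 1) * ε⁻¹) ^ 2 := by
    intro i
    rw [partialDeriv_testFunction he hz, ← sq_abs]
    refine pow_le_pow_left₀ (abs_nonneg _) ?_ 2
    have h2 : ‖(Pi.single i 1 : Fin N → ℝ)‖ = 1 := by rw [Pi.norm_single, norm_one]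
    calc |fderiv ℝ (unitBump N) (ε⁻¹ • (e z - c)) (ε⁻¹ • L (Pi.single i 1))|
        ≤ ‖fderiv ℝ (unitBump N) (ε⁻¹ • (e z - c))‖ * ‖ε⁻¹ • L (Pi.single i 1)‖ :=
          (fderiv ℝ (unitBump N) (ε⁻¹ • (e z - c))).le_opNorm _
      _ ≤ G * (ε⁻¹ * (‖L‖ + 1)) := by
          have h3 := L.le_opNorm (Pi.single i 1)
          rw [h2, mul_one] at h3
          rw [norm_smul, Real.norm_of_nonneg (inv_nonneg.2 hε.le)]
          have := hGb (ε⁻¹ • (e z - c))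
          gcongr
          linarith
      _ = G * (‖L‖ + 1) * ε⁻¹ := by ring
  refine (Finset.sum_le_sum fun i _ => h1 i).trans ?_
  rw [Finset.sum_const, Finset.card_univ, Fintype.card_fin, nsmul_eq_mul,
    Real.rpow_neg hε.le, Real.rpow_two, mul_pow _ ε⁻¹, inv_pow, ← mul_assoc]
  gcongr
  linarith

end TestFunction

/-! ### Lower bounds for the exponent -/

section LowerBound

variable {N : ℕ} [NeZero N] {α β : Fin (N + 1) → ℝ} {a : (Fin N → ℝ) → Fin N → Fin N → ℝ}

/-- The lower bound for the exponent that the test functions around `c` in a chart give, when the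
coefficients of the form are of order `s ^ r` at distance `s` from `c`. -/
theorem NashInequality.le_of_chart (hα : ∀ j, 0 < α j) (hβ : ∀ j, 0 < β j) (ha : IsAdmissible a)
    {p C : ℝ} (hp : 0 < p) (hC : 0 < C)
    (h : NashInequality (dirichletMeasure α) (C1 N) (gradForm α a) p C)
    {e : (Fin N → ℝ) → Fin N → ℝ} {L : (Fin N → ℝ) →L[ℝ] (Fin N → ℝ)} (he : ContDiff ℝ 1 e)
    (heL : ∀ z, HasFDerivAt e L z)
    (hem : MeasurePreserving e (dirichletMeasure α) (dirichletMeasure β))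
    (hmap : ∀ z ∈ openSimplex (Fin N), e z ∈ openSimplex (Fin N))
    {c d : Fin N → ℝ}
    (hcd : ∀ j, (c j = 0 ∧ d j = β j.castSucc) ∨ (c j = 1 / (4 * N) ∧ d j = 1))
    {r : ℝ}
    (hcoef : ∀ z ∈ openSimplex (Fin N), ∀ s, 0 < s → e z ∈ cubeBox c s → ∀ ξ : Fin N → ℝ,
      ∑ i, ∑ j, a z i j * (ξ i * ξ j) ≤ s ^ r * ∑ i, ξ i ^ 2) :
    ∑ j, d j ≤ (2 - r) * p := by
  have := isFiniteMeasure_dirichletMeasure hα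
  have hN : (0 : ℝ) < N := by exact_mod_cast Nat.pos_of_neZero N
  obtain ⟨k, K, hk, hK, hbox⟩ := exists_dirichletMeasure_cubeBox hβ
    (show 0 < 1 / (4 * (N : ℝ)) by positivity) le_rfl hcd
  obtain ⟨G, hG, hgrad⟩ := exists_partialDeriv_testFunction_sq_le L
  have hd : ∀ j, 0 < d j := by
    intro j
    rcases hcd j with ⟨-, h1⟩ | ⟨-, h1⟩ <;> rw [h1]
    · exact hβ _
    · exact one_pos
  set P := ∑ j, d j with hPdef
  have hP : 0 < P := Finset.sum_pos (fun j _ => hd j) ⟨0, Finset.mem_univ _⟩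
  set η := 1 / (4 * (N : ℝ)) with hη
  have hη0 : 0 < η := by positivity
  have hpre : ∀ s, MeasurableSet (e ⁻¹' cubeBox c s) := fun s =>
    hem.measurable (measurableSet_box _ _)
  have hreal : ∀ s, (dirichletMeasure α).real (e ⁻¹' cubeBox c s) =
      (dirichletMeasure β).real (cubeBox c s) := fun s => by
    rw [measureReal_def, measureReal_def,
      hem.measure_preimage (s := cubeBox c s) (measurableSet_box _ _).nullMeasurableSet]
  have hind : ∀ (s b : ℝ), Integrable ((e ⁻¹' cubeBox c s).indicator fun _ => b)
      (dirichletMeasure α) := fun s b => (integrable_const b).indicator (hpre s)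
  have hval : ∀ s b : ℝ, ∫ z, (e ⁻¹' cubeBox c s).indicator (fun _ => b) z ∂dirichletMeasure α =
      (dirichletMeasure β).real (cubeBox c s) * b := fun s b => by
    rw [integral_indicator_const _ (hpre s), hreal, smul_eq_mul]
  have hout : ∀ ε, 0 < ε → ∀ z ∈ openSimplex (Fin N), z ∉ e ⁻¹' cubeBox c (3 * ε) →
      3 * ε ≤ dist (e z) c := by
    intro ε hε z hz hnot
    by_contra! hlt
    exact hnot (mem_cubeBox (hmap z hz).1 hlt)
  -- The upper estimates use the cube of size `3 ε`, and `ε ≤ η / 6` keeps it within the range `s ≤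
  -- η / 2`. The energy collects `(3 ε)^r` from the coefficients, `ε^(-2)` from the squared gradient
  -- and `ε^P` from the mass.
  refine h.le_of_family (q := 2 - r) (ε₀ := η / 6) (k := k)
    (K := max (K * 3 ^ P) (K * 3 ^ P * (3 ^ r * G)))
    (f := testFunction e c) hα ha hp hC hP (by positivity) hk
    (lt_max_of_lt_left (by positivity)) fun ε hε hεη => ?_
  have hf := testFunction_mem_C1 (c := c) (ε := ε) he
  have hcont : ContinuousOn (testFunction e c ε) (simplex N) := ContDiffOn.continuousOn hf
  have h3ε : (3 * ε) ^ P = 3 ^ P * ε ^ P := Real.mul_rpow (by norm_num) hε.le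
  have hupper := (hbox (3 * ε) (by positivity) (by linarith)).2
  rw [h3ε, ← mul_assoc] at hupper
  have hεP : 0 < ε ^ P := Real.rpow_pos_of_pos hε _
  refine ⟨hf, testFunction_nonneg, ?_, ?_, ?_⟩
  · refine (hbox ε hε (by linarith)).1.trans ?_
    rw [← mul_one ((dirichletMeasure β).real _), ← hval]
    refine integral_mono (hind _ _) (integrable_of_continuousOn hα (hcont.pow 2)) fun z => ?_
    refine Set.indicator_le' (f := fun _ => (1 : ℝ)) (fun z hz => ?_) (fun z _ => sq_nonneg _) z
    simp only [testFunction_eq_one hε (dist_le_of_mem_cubeBox hε.le hz), one_pow, le_refl]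
  · have h1 : ∫ z, testFunction e c ε z ∂dirichletMeasure α ≤
        (dirichletMeasure β).real (cubeBox c (3 * ε)) * 1 := by
      rw [← hval]
      refine integral_mono_ae (integrable_of_continuousOn hα hcont) (hind _ _) ?_
      filter_upwards [ae_mem_openSimplex α] with z hz
      by_cases hzb : z ∈ e ⁻¹' cubeBox c (3 * ε)
      · rw [Set.indicator_of_mem hzb]; exact testFunction_le_one z
      · rw [Set.indicator_of_notMem hzb, testFunction_eq_zero hε (hout ε hε z hz hzb)]
    rw [mul_one] at h1
    refine (h1.trans hupper).trans ?_
    gcongr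
    exact le_max_left _ _
  · have h1 : gradForm α a (testFunction e c ε) (testFunction e c ε) ≤
        (dirichletMeasure β).real (cubeBox c (3 * ε)) *
          ((3 * ε) ^ r * (G * ε ^ (-2 : ℝ))) := by
      rw [← hval, gradForm]
      refine integral_mono_ae (ha.integrable hα hf hf) (hind _ _) ?_
      filter_upwards [ae_mem_openSimplex α] with z hz
      by_cases hzb : z ∈ e ⁻¹' cubeBox c (3 * ε)
      · rw [Set.indicator_of_mem hzb]
        refine (hcoef z hz (3 * ε) (by positivity) hzb
          fun i => partialDeriv i (testFunction e c ε) z).trans ?_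
        have := hgrad e c ε hε z (openSimplex_subset hz) (heL z)
        gcongr
      · rw [Set.indicator_of_notMem hzb]
        refine le_of_eq (Finset.sum_eq_zero fun i _ => Finset.sum_eq_zero fun j _ => ?_)
        rw [partialDeriv_testFunction_eq_zero (heL z) hε (openSimplex_subset hz)
          (hout ε hε z hz hzb)]
        simp
    calc gradForm α a (testFunction e c ε) (testFunction e c ε)
        ≤ K * 3 ^ P * ε ^ P * ((3 * ε) ^ r * (G * ε ^ (-2 : ℝ))) :=
          h1.trans (mul_le_mul_of_nonneg_right hupper (by positivity))
      _ = K * 3 ^ P * (3 ^ r * G) * ε ^ (P - (2 - r)) := by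
          have : P - (2 - r) = P + r + (-2) := by ring
          rw [Real.mul_rpow (by norm_num) hε.le, this, Real.rpow_add hε, Real.rpow_add hε]
          ring
      _ ≤ _ := by
          gcongr
          exact le_max_right _ _

theorem sum_mul_sq_le {s : ℝ} {b ξ : Fin N → ℝ} (hb : ∀ i, b i ≤ s) :
    ∑ i, b i * ξ i ^ 2 ≤ s * ∑ i, ξ i ^ 2 := by
  rw [Finset.mul_sum]
  exact Finset.sum_le_sum fun i _ => mul_le_mul_of_nonneg_right (hb i) (sq_nonneg _)

theorem sum_flemingViotCoeff_le (x ξ : Fin N → ℝ) {s : ℝ} (hx : ∀ i, x i ≤ s) :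
    ∑ i, ∑ j, flemingViotCoeff x i j * (ξ i * ξ j) ≤ s * ∑ i, ξ i ^ 2 := by
  rw [sum_flemingViotCoeff]
  linarith [sum_mul_sq_le (ξ := ξ) hx, sq_nonneg (∑ i, x i * ξ i)]

/-- The lower bound from test functions at the vertex `0`. -/
theorem NashInequality.sum_le (hα : ∀ j, 0 < α j) (ha : IsAdmissible a)
    (ha' : ∀ x ξ : Fin N → ℝ, x ∈ simplex N → ∑ i, ∑ j, a x i j * (ξ i * ξ j) ≤
      ∑ i, ∑ j, flemingViotCoeff x i j * (ξ i * ξ j))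
    {p C : ℝ} (hp : 0 < p) (hC : 0 < C)
    (h : NashInequality (dirichletMeasure α) (C1 N) (gradForm α a) p C) :
    ∑ j : Fin N, α j.castSucc ≤ p := by
  have h1 := h.le_of_chart (c := 0) (d := fun j => α j.castSucc) (r := 1) hα hα ha hp hC
    (e := id) contDiff_id hasFDerivAt_id (MeasurePreserving.id _) (fun _ hz => hz)
    (fun j => Or.inl ⟨rfl, rfl⟩) fun z hz s hs hzb ξ => ?_
  · linarith
  · rw [Real.rpow_one]
    refine (ha' z ξ (openSimplex_subset hz)).trans (sum_flemingViotCoeff_le z ξ fun i => ?_)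
    simpa using (hzb i (Set.mem_univ i)).2

/-- The lower bound from test functions at the face where the last barycentric coordinate and the
coordinates of large weight other than the `i`-th vanish. -/
theorem NashInequality.add_sum_max_le (hα : ∀ j, 0 < α j) (ha : IsAdmissible a) (i : Fin N)
    {r : ℝ} (hcoef : ∀ z ∈ openSimplex (Fin N), ∀ s, 0 < s → 1 - ∑ k, z k ≤ s →
      ∀ ξ : Fin N → ℝ, ∑ i, ∑ j, a z i j * (ξ i * ξ j) ≤ s ^ r * ∑ i, ξ i ^ 2)
    {p C : ℝ} (hp : 0 < p) (hC : 0 < C)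
    (h : NashInequality (dirichletMeasure α) (C1 N) (gradForm α a) p C) :
    α (Fin.last N) + ∑ j ∈ Finset.univ.erase i, max 1 (α j.castSucc) ≤ (2 - r) * p := by
  classical
  have hswap : swapLast (swapLast α i) i = α := by
    ext j; simp [swapLast]
  have hmp := measurePreserving_reflect (swapLast α i) i
  rw [hswap] at hmp
  -- A coordinate of weight at least 1 is sent to `0`, where a cube has mass exponent `α_j`; a
  -- smaller one stays at an interior value with exponent 1. This maximizes the total exponent. In
  -- the reflected chart coordinate `i` is `1 - |z|_1`, so `c i = 0` places the bump at the face
  -- `|z|_1 = 1`.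
  set c : Fin N → ℝ := fun j => if j = i ∨ 1 ≤ α j.castSucc then 0 else 1 / (4 * N) with hc
  set d : Fin N → ℝ := fun j => if j = i then α (Fin.last N) else max 1 (α j.castSucc) with hd
  have hci : c i = 0 := by simp [hc]
  have h1 := h.le_of_chart (c := c) (d := d) (r := r) (β := swapLast α i) hα (fun j => hα _) ha hp hC
    (contDiff_reflect i) (hasFDerivAt_reflect i) hmp (fun z hz => reflect_mem_openSimplex i hz)
    (fun j => ?_) fun z hz s hs hzb ξ => ?_
  · have h2 : ∑ j, d j = α (Fin.last N) + ∑ j ∈ Finset.univ.erase i, max 1 (α j.castSucc) := by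
      rw [← Finset.add_sum_erase _ _ (Finset.mem_univ i)]
      congr 1
      · simp [hd]
      · exact Finset.sum_congr rfl fun j hj => by simp [hd, Finset.ne_of_mem_erase hj]
    rwa [h2] at h1
  · rcases eq_or_ne j i with rfl | hji
    · left
      simp [hc, hd, swapLast_self]
    · rcases le_or_gt 1 (α j.castSucc) with h2 | h2
      · left
        simp [hc, hd, hji, h2, swapLast_of_ne α hji]
      · right
        simp [hc, hd, hji, not_le.2 h2, h2.le]
  · refine hcoef z hz s hs ?_ ξ
    have := (hzb i (Set.mem_univ i)).2
    simp only at this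
    rwa [hci, zero_add, reflect_self] at this

/-- At the vertex `0` and on the face `|x|_1 = 1` all coefficients `x_i (1 - |x|_1)` vanish at least
linearly, so `r = 1` in both families. -/
theorem MultivariateNash.lowerBound_le (hα : ∀ j, 0 < α j) {p : ℝ} (hp : 0 < p)
    (h : MultivariateNash α p) : multivariateLowerBound α ≤ p := by
  obtain ⟨C, hC, h⟩ := h
  rw [multivariateForm_eq] at h
  have h1 := h.sum_le hα isAdmissible_multivariateCoeff sum_multivariateCoeff_le hp hC
  have h2 : ∀ i : Fin N,
      α (Fin.last N) + ∑ j ∈ Finset.univ.erase i, max 1 (α j.castSucc) ≤ p := by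
    intro i
    have := h.add_sum_max_le (r := 1) hα isAdmissible_multivariateCoeff i
      (fun z hz s hs hzs ξ => ?_) hp hC
    · linarith
    · rw [sum_multivariateCoeff, Real.rpow_one]
      refine sum_mul_sq_le fun i => ?_
      have h3 := hz.1 i
      have h4 := le_one_of_mem_openSimplex hz i
      have h5 : 0 ≤ 1 - ∑ k, z k := by linarith [hz.2]
      calc z i * (1 - ∑ k, z k) ≤ 1 * (1 - ∑ k, z k) := by gcongr
        _ ≤ s := by linarith
  have hsup : (⨆ i : Fin N, ∑ j ∈ Finset.univ.erase i, max 1 (α j.castSucc)) ≤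
      p - α (Fin.last N) := ciSup_le fun i => by linarith [h2 i]
  refine max_le (ciSup_le fun i => ?_) (by linarith)
  have h3 : ∑ j ∈ Finset.univ.erase i, α j = ∑ j, α j - α i := by
    rw [← Finset.add_sum_erase _ _ (Finset.mem_univ i)]; ring
  rw [h3, Fin.sum_univ_castSucc]
  -- Only the last index needs the bumps at the vertex `0`. For `i ≤ N` the sum is dominated by the
  -- bound from the face, since `α_j ≤ max 1 α_j`.
  induction i using Fin.lastCases with
  | last => linarith
  | cast i =>
    have h4 : ∑ j ∈ Finset.univ.erase i, α j.castSucc ≤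
        ∑ j ∈ Finset.univ.erase i, max 1 (α j.castSucc) :=
      Finset.sum_le_sum fun j _ => le_max_right _ _
    rw [← Finset.add_sum_erase _ (fun j : Fin N => α j.castSucc) (Finset.mem_univ i)]
    linarith [h2 i]

/-- At the vertex `0` the coefficients still vanish linearly. Near the face `|x|_1 = 1` only their
boundedness is used, so `r = 0` there; this yields `2 p`, the origin of the factors `1/2`. -/
theorem FlemingViotNash.lowerBound_le (hα : ∀ j, 0 < α j) {p : ℝ} (hp : 0 < p)
    (h : FlemingViotNash α p) : flemingViotLowerBound α ≤ p := by
  obtain ⟨C, hC, h⟩ := h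
  rw [flemingViotForm_eq] at h
  have h1 := h.sum_le hα isAdmissible_flemingViotCoeff (fun _ _ _ => le_rfl) hp hC
  have h2 : ∀ i : Fin N,
      α (Fin.last N) + ∑ j ∈ Finset.univ.erase i, max 1 (α j.castSucc) ≤ 2 * p := by
    intro i
    have := h.add_sum_max_le (r := 0) hα isAdmissible_flemingViotCoeff i
      (fun z hz s hs hzs ξ => ?_) hp hC
    · linarith
    · rw [Real.rpow_zero]
      exact sum_flemingViotCoeff_le z ξ fun i => le_one_of_mem_openSimplex hz i
  have hsup : (⨆ i : Fin N, ∑ j ∈ Finset.univ.erase i, max 1 (α j.castSucc)) ≤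
      2 * p - α (Fin.last N) := ciSup_le fun i => by linarith [h2 i]
  exact max_le h1 (by linarith)

theorem nashExponent_eq (h : ∀ i : Fin N, α i.castSucc ≤ 1 / 2) (hl : 1 ≤ α (Fin.last N)) :
    nashExponent α = N + α (Fin.last N) - 1 := by
  have h1 : ∀ i : Fin N, max 1 (2 * α i.castSucc) = 1 := fun i => max_eq_left (by linarith [h i])
  simp only [nashExponent, h1]
  rw [max_eq_left (by linarith)]
  simp
  ring

/-- Any index `i` will do, keeping only 1 from each of the `N - 1` maxima. -/
theorem le_multivariateLowerBound : N + α (Fin.last N) - 1 ≤ multivariateLowerBound α := by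
  refine le_trans ?_ (le_max_right _ _)
  have h1 : ((N : ℝ) - 1) ≤ ∑ j ∈ Finset.univ.erase (0 : Fin N), max 1 (α j.castSucc) := by
    calc ((N : ℝ) - 1) = ∑ j ∈ Finset.univ.erase (0 : Fin N), (1 : ℝ) := by
          rw [Finset.sum_const, Finset.card_erase_of_mem (Finset.mem_univ _), Finset.card_univ,
            Fintype.card_fin, nsmul_eq_mul, mul_one, Nat.cast_pred (Nat.pos_of_neZero N)]
      _ ≤ _ := Finset.sum_le_sum fun j _ => le_max_left _ _
  have h2 := le_ciSup (f := fun i : Fin N => ∑ j ∈ Finset.univ.erase i, max 1 (α j.castSucc))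
    (Set.finite_range _).bddAbove 0
  linarith

end LowerBound

end DirichletNash

end

theorem theorem1p1 (N : ℕ) (hN : 2 ≤ N) (α : Fin (N + 1) → ℝ) (hα : ∀ i, 0 < α i) :
    (DirichletNash.MultivariateNash α (DirichletNash.nashExponent α) ∧
      DirichletNash.FlemingViotNash α (DirichletNash.nashExponent α)) ∧
    (∀ p : ℝ, 0 < p → DirichletNash.MultivariateNash α p →
      DirichletNash.multivariateLowerBound α ≤ p) ∧
    (∀ p : ℝ, 0 < p → DirichletNash.FlemingViotNash α p →
      DirichletNash.flemingViotLowerBound α ≤ p) ∧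
    ((∀ i : Fin N, α i.castSucc ≤ 1 / 2) → 1 ≤ α (Fin.last N) →
      DirichletNash.nashExponent α = N + α (Fin.last N) - 1 ∧
      IsLeast {p : ℝ | 0 < p ∧ DirichletNash.MultivariateNash α p}
        (DirichletNash.nashExponent α)) := by
  have : NeZero N := ⟨by omega⟩
  refine ⟨⟨DirichletNash.multivariateNash_nashExponent hα,
    DirichletNash.flemingViotNash_nashExponent hα⟩, fun p hp h => h.lowerBound_le hα hp,
    fun p hp h => h.lowerBound_le hα hp, fun h hl => ?_⟩
  have he := DirichletNash.nashExponent_eq h hl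
  refine ⟨he, ⟨DirichletNash.nashExponent_pos α, DirichletNash.multivariateNash_nashExponent hα⟩,
    fun p hp => ?_⟩
  rw [he]
  exact DirichletNash.le_multivariateLowerBound.trans (hp.2.lowerBound_le hα hp.1)
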